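/- Let $G$ be a Lie groupoid over a smooth manifold $M$, with source $s$, target $t$ and manifolds $G_k$ of strings $(g_1,\dots,g_k)$ of composable arrows ($G_0=M$, $t(g_1,\dots,g_k)=t(g_1)$, $s(g_1,\dots,g_k)=s(g_k)$). For a vector bundle $V\to M$ put $C^k(G;V)=\Gamma(G_k,t^*V)$ and $C^k(G)=C^\infty(G_k)$, with $\delta f(g_1,\dots,g_{k+1})=(-1)^k\{f(g_2,\dots,g_{k+1})+\sum_{i=1}^k(-1)^if(\dots,g_ig_{i+1},\dots)+(-1)^{k+1}f(g_1,\dots,g_k)\}$. For a bounded graded vector bundle $E=\bigoplus_l E^l$ over $M$ put $C(G;E)^n=\bigoplus_{k+l=n}C^k(G;E^l)$, a right $C(G)$-module by $(\eta\star f)(g_1,\dots,g_{k+j})=(-1)^{kj}\eta(g_1,\dots,g_k)f(g_{k+1},\dots,g_{k+j})$ for $\eta\in C^k(G;E^l)$, $f\in C^j(G)$. A representation up to homotopy of $G$ on $E$ is a linear operator $D$ of degree one on $C(G;E)$ with $D^2=0$ and $D(\eta\star f)=D(\eta)\star f+(-1)^n\eta\star\delta f$ for $\eta\in C(G;E)^n$.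 Its structure maps $R_k\in\Gamma(G_k,\mathrm{Hom}(s^*E^\bullet,t^*E^{\bullet+1-k}))$, $k\ge 0$, are those with $D\eta=\sum_kR_k\star\eta+\hat D_0\eta$, where, for $\eta \in C^q(G;E^l)$ and $n=q+l$, $(R_k\star\eta)(g_1,\dots,g_{k+q})=(-1)^{kn}R_k(g_1,\dots,g_k)\,\eta(g_{k+1},\dots,g_{k+q})$ and $\hat D_0\eta(g_1,\dots,g_{q+1})=(-1)^{n}\{\sum_{i=1}^q(-1)^i\eta(\dots,g_ig_{i+1},\dots)+(-1)^{q+1}\eta(g_1,\dots,g_q)\}$. Write $\partial=R_0$ and $\lambda=R_1$; then $(E,\partial)$ is a complex of vector bundles. The representation up to homotopy is unital if $\lambda_g=\mathrm{Id}$ for every unit $g$ and $R_k(g_1,\dots,g_k)=0$ whenever $k\ge2$ and some $g_i$ is a unit; its underlying complex is regular if $\partial$ has constant rank in each degree. $\mathrm{H}_{\mathrm{diff}}(G;E)$ is the cohomology of $(C(G;E),D)$. A morphism $E\to E'$ is a $C(G)$-linear map $\Phi:C(G;E)\to C(G;E')$ of degree zero that commutes with the structure operators; it has the form $\Phi\eta=\sum_k\Phi_k\star\eta$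 with $\Phi_k\in\Gamma(G_k,\mathrm{Hom}(s^*E^\bullet,t^*E'^{\bullet-k}))$, and it is a quasi-isomorphism if $\Phi_0$ induces isomorphisms between the cohomologies of $(E_x,\partial)$ and $(E'_x,\partial')$ for all $x\in M$. Theorem. Let $E$ be a unital representation up to homotopy of $G$ whose underlying complex is regular. (1) The spaces $\ker\partial_x/\operatorname{im}\partial_x$ in degree $l$ are the fibres of a smooth vector bundle $\mathcal H^l(E)$ over $M$ whose smooth sections are those that lift locally to smooth sections of $E^l$ with values in $\ker\partial$, and $\lambda_g(\overline v):=\overline{\lambda_g(v)}$ is a well-defined smooth action that makes each $\mathcal H^l(E)$ an ordinary representation of $G$. (2) Let $\mathcal E_r^{p,q}(E)$ be the spectral sequence of the filtration of $(C(G;E),D)$ by the subspaces $L^p=\bigoplus_{k\ge p}C^k(G;E)$. It converges to $\mathrm{H}_{\mathrm{diff}}^{p+q}(G;E)$ with the induced filtration, and sending an element to its component in $C^p(G;E^q)$ and then to $\mathcal H^q(E)$ induces an isomorphism $$\mathcal E_2^{p,q}(E)\cong \mathrm{H}_{\mathrm{diff}}^p(G;\mathcal H^q(E))$$ (both sides being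 zero for $p<0$), where $\mathrm{H}_{\mathrm{diff}}^\bullet(G;V)$, for an ordinary representation $V$, is the cohomology of $C^\bullet(G;V)$ with the differential $d\eta(g_1,\dots,g_{k+1})=(-1)^k\{\lambda_{g_1}\eta(g_2,\dots,g_{k+1})+\sum_{i=1}^k(-1)^i\eta(\dots,g_ig_{i+1},\dots)+(-1)^{k+1}\eta(g_1,\dots,g_k)\}$. (3) The graded bundle $\mathcal H(E)=\bigoplus_l\mathcal H^l(E)$ carries a representation up to homotopy whose differential $R_0$ is zero and whose $R_1$ is the action in (1), and there is a quasi-isomorphism $\Phi:C(G;E)\to C(G;\mathcal H(E))$. -/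

import Mathlib

open scoped Manifold ContDiff Topology
open Bundle CategoryTheory

universe u v w

noncomputable section

namespace LieRep

/-- The Euclidean space `ℝⁿ`. -/
abbrev Eu (n : ℕ) : Type := EuclideanSpace ℝ (Fin n)

section Bundles

variable {m : ℕ} {M : Type u} [TopologicalSpace M] [ChartedSpace (Eu m) M]

/-- A smooth real vector bundle of finite rank over the `m`-dimensional manifold `M`
(Mathlib's smooth vector bundles, bundled). -/
structure SmoothVectorBundle (m : ℕ) (M : Type u) [TopologicalSpace M]
    [ChartedSpace (Eu m) M] where
  rank : ℕ
  Fib : M → Type v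
  [addCommGroup : ∀ x, AddCommGroup (Fib x)]
  [module : ∀ x, Module ℝ (Fib x)]
  [topFib : ∀ x, TopologicalSpace (Fib x)]
  [topTotal : TopologicalSpace (TotalSpace (Eu rank) Fib)]
  [fiberBundle : FiberBundle (Eu rank) Fib]
  [vectorBundle : VectorBundle ℝ (Eu rank) Fib]
  [smoothBundle : ContMDiffVectorBundle ∞ (Eu rank) Fib (𝓡 m)]

attribute [instance] SmoothVectorBundle.addCommGroup SmoothVectorBundle.module
  SmoothVectorBundle.topFib SmoothVectorBundle.topTotal SmoothVectorBundle.fiberBundle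
  SmoothVectorBundle.vectorBundle SmoothVectorBundle.smoothBundle

/-- `v` is a smooth lift of the base map `b : ℝⁿ → M` to the total space of `V`. -/
def SmoothVectorBundle.SmoothAlong (V : SmoothVectorBundle.{u, v} m M) {n : ℕ}
    (b : Eu n → M) (v : ∀ z, V.Fib (b z)) : Prop :=
  ContMDiff (𝓡 n) ((𝓡 m).prod 𝓘(ℝ, Eu V.rank)) ∞
    (fun z => (⟨b z, v z⟩ : TotalSpace (Eu V.rank) V.Fib))

/-- The section `h` of `V` is smooth on the set `U`. -/
def SmoothVectorBundle.SmoothOn (V : SmoothVectorBundle.{u, v} m M) (h : ∀ x, V.Fib x)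
    (U : Set M) : Prop :=
  ContMDiffOn (𝓡 m) ((𝓡 m).prod 𝓘(ℝ, Eu V.rank)) ∞
    (fun x => (⟨x, h x⟩ : TotalSpace (Eu V.rank) V.Fib)) U

theorem SmoothVectorBundle.smoothAlong_iff (V : SmoothVectorBundle.{u, v} m M) {n : ℕ}
    (b : Eu n → M) (hb : ContMDiff (𝓡 n) (𝓡 m) ∞ b) (v : ∀ z, V.Fib (b z)) :
    V.SmoothAlong b v ↔ ∀ z₀, ContMDiffAt (𝓡 n) 𝓘(ℝ, Eu V.rank) ∞
      (fun z => (trivializationAt (Eu V.rank) V.Fib (b z₀) ⟨b z, v z⟩).2) z₀ := by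
  refine forall_congr' fun z₀ => ?_
  rw [Bundle.contMDiffAt_totalSpace]
  exact and_iff_right (hb z₀)

theorem SmoothVectorBundle.SmoothAlong.smul_add {V : SmoothVectorBundle.{u, v} m M} {n : ℕ}
    {b : Eu n → M} (hb : ContMDiff (𝓡 n) (𝓡 m) ∞ b) {v w : ∀ z, V.Fib (b z)} {f : Eu n → ℝ}
    (hf : ContMDiff (𝓡 n) 𝓘(ℝ, ℝ) ∞ f)
    (hv : V.SmoothAlong b v) (hw : V.SmoothAlong b w) :
    V.SmoothAlong b (fun z => f z • v z + w z) := by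
  rw [V.smoothAlong_iff b hb] at hv hw ⊢
  intro z₀
  have hmem : ∀ᶠ z in 𝓝 z₀,
      b z ∈ (trivializationAt (Eu V.rank) V.Fib (b z₀)).baseSet :=
    (hb.continuous.continuousAt).eventually_mem
      ((trivializationAt (Eu V.rank) V.Fib (b z₀)).open_baseSet.mem_nhds
        (FiberBundle.mem_baseSet_trivializationAt' (b z₀)))
  refine (((hf z₀).smul (hv z₀)).add (hw z₀)).congr_of_eventuallyEq ?_
  filter_upwards [hmem] with z hz
  have hl := (trivializationAt (Eu V.rank) V.Fib (b z₀)).linear ℝ hz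
  rw [hl.map_add, hl.map_smul]
  rfl

theorem SmoothVectorBundle.smoothAlong_zero (V : SmoothVectorBundle.{u, v} m M) {n : ℕ}
    {b : Eu n → M} (hb : ContMDiff (𝓡 n) (𝓡 m) ∞ b) :
    V.SmoothAlong b (fun _ => 0) := by
  rw [V.smoothAlong_iff b hb]
  intro z₀
  have hmem : ∀ᶠ z in 𝓝 z₀,
      b z ∈ (trivializationAt (Eu V.rank) V.Fib (b z₀)).baseSet :=
    (hb.continuous.continuousAt).eventually_mem
      ((trivializationAt (Eu V.rank) V.Fib (b z₀)).open_baseSet.mem_nhds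
        (FiberBundle.mem_baseSet_trivializationAt' (b z₀)))
  refine (contMDiffAt_const (c := (0 : Eu V.rank))).congr_of_eventuallyEq ?_
  filter_upwards [hmem] with z hz
  exact ((trivializationAt (Eu V.rank) V.Fib (b z₀)).linear ℝ hz).map_zero

/-- A graded vector bundle over `M`, bounded from above and from below. -/
structure GradedBundle (m : ℕ) (M : Type u) [TopologicalSpace M]
    [ChartedSpace (Eu m) M] where
  deg : ℤ → SmoothVectorBundle.{u, v} m M
  bounded : ∃ a b : ℤ, ∀ l, l < a ∨ b < l → (deg l).rank = 0

end Bundles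

/-- A Lie groupoid over `M` with manifold of arrows `G₁`. An arrow `g` goes from `src g` to
`tgt g`; only the values of `mul g h` at composable pairs, `src g = tgt h`, are meaningful.
The composable pairs form an embedded submanifold of `G₁ × G₁`, on which `mul` is smooth. -/
structure LieGroupoid (m d : ℕ) (M : Type u) [TopologicalSpace M] [ChartedSpace (Eu m) M]
    (G₁ : Type u) [TopologicalSpace G₁] [ChartedSpace (Eu d) G₁] where
  src : G₁ → M
  tgt : G₁ → M
  unit : M → G₁
  inv : G₁ → G₁
  mul : G₁ → G₁ → G₁
  src_surjective : Function.Surjective src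
  tgt_surjective : Function.Surjective tgt
  src_submersion : Manifold.IsSubmersion (𝓡 d) (𝓡 m) ∞ src
  tgt_submersion : Manifold.IsSubmersion (𝓡 d) (𝓡 m) ∞ tgt
  smooth_unit : ContMDiff (𝓡 m) (𝓡 d) ∞ unit
  smooth_inv : ContMDiff (𝓡 d) (𝓡 d) ∞ inv
  smooth_mul : ContMDiffOn ((𝓡 d).prod (𝓡 d)) (𝓡 d) ∞
    (fun p : G₁ × G₁ => mul p.1 p.2) {p | src p.1 = tgt p.2}
  src_unit : ∀ x, src (unit x) = x
  tgt_unit : ∀ x, tgt (unit x) = x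
  src_inv : ∀ g, src (inv g) = tgt g
  tgt_inv : ∀ g, tgt (inv g) = src g
  src_mul : ∀ g h, src g = tgt h → src (mul g h) = src h
  tgt_mul : ∀ g h, src g = tgt h → tgt (mul g h) = tgt g
  mul_assoc : ∀ g h k, src g = tgt h → src h = tgt k → mul (mul g h) k = mul g (mul h k)
  unit_mul : ∀ g, mul (unit (tgt g)) g = g
  mul_unit : ∀ g, mul g (unit (src g)) = g
  inv_mul : ∀ g, mul (inv g) g = unit (src g)
  mul_inv : ∀ g, mul g (inv g) = unit (tgt g)

variable {m d : ℕ} {M : Type u} [TopologicalSpace M] [ChartedSpace (Eu m) M]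
  {G₁ : Type u} [TopologicalSpace G₁] [ChartedSpace (Eu d) G₁]

namespace LieGroupoid

variable (G : LieGroupoid m d M G₁)

/-- The arrows of `G` from `y` to `x`. -/
structure Arrow (x y : M) where
  val : G₁
  tgt_eq : G.tgt val = x
  src_eq : G.src val = y

/-- The unit arrow at `x`. -/
def idArrow (x : M) : G.Arrow x x := ⟨G.unit x, G.tgt_unit x, G.src_unit x⟩

/-- The composition of arrows. -/
def comp {x y z : M} (g : G.Arrow x y) (h : G.Arrow y z) : G.Arrow x z where
  val := G.mul g.val h.val
  tgt_eq := (G.tgt_mul _ _ (g.src_eq.trans h.tgt_eq.symm)).trans g.tgt_eq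
  src_eq := (G.src_mul _ _ (g.src_eq.trans h.tgt_eq.symm)).trans h.src_eq

/-- A string `x = p₀ ⟵ p₁ ⟵ ⋯ ⟵ pₖ = y` of `k` composable arrows
`(g₁, …, gₖ) = (arr 0, …, arr (k-1))`, with `t(g₁, …, gₖ) = x` and `s(g₁, …, gₖ) = y`.
For `k = 0` it is a point of `M`. -/
@[ext]
structure Str (k : ℕ) (x y : M) where
  pt : Fin (k + 1) → M
  arr : Fin k → G₁
  tgt_arr : ∀ i, G.tgt (arr i) = pt i.castSucc
  src_arr : ∀ i, G.src (arr i) = pt i.succ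
  pt_zero : pt 0 = x
  pt_last : pt (Fin.last k) = y

variable {G}

/-- The point `x` as a string of length zero. -/
def nil (x : M) : G.Str 0 x x where
  pt _ := x
  arr i := i.elim0
  tgt_arr i := i.elim0
  src_arr i := i.elim0
  pt_zero := rfl
  pt_last := rfl

/-- An arrow as a string of length one. -/
def single {x y : M} (g : G.Arrow x y) : G.Str 1 x y where
  pt := ![x, y]
  arr _ := g.val
  tgt_arr i := by rw [Subsingleton.elim i 0]; exact g.tgt_eq
  src_arr i := by rw [Subsingleton.elim i 0]; exact g.src_eq
  pt_zero := rfl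
  pt_last := rfl

/-- The first arrow of a string of positive length. -/
def Str.head {k : ℕ} {x y : M} (g : G.Str (k + 1) x y) : G.Arrow x (g.pt ⟨1, by omega⟩) where
  val := g.arr 0
  tgt_eq := (g.tgt_arr 0).trans g.pt_zero
  src_eq := g.src_arr 0

/-- The substring `(g₁, …, gₚ)`. -/
def Str.front {k : ℕ} {x y : M} (g : G.Str k x y) (p : ℕ) (hp : p ≤ k) :
    G.Str p x (g.pt ⟨p, Nat.lt_succ_of_le hp⟩) where
  pt j := g.pt ⟨j, by omega⟩
  arr j := g.arr ⟨j, by omega⟩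
  tgt_arr j := g.tgt_arr ⟨j, by omega⟩
  src_arr j := g.src_arr ⟨j, by omega⟩
  pt_zero := g.pt_zero
  pt_last := rfl

/-- The substring `(g_{p+1}, …, g_{p+q})` of a string of length `p + q`. -/
def Str.back {k : ℕ} {x y : M} (g : G.Str k x y) (p q : ℕ) (h : p + q = k) :
    G.Str q (g.pt ⟨p, by omega⟩) y where
  pt j := g.pt ⟨p + j, by omega⟩
  arr j := g.arr ⟨p + j, by omega⟩
  tgt_arr j := g.tgt_arr ⟨p + j, by omega⟩
  src_arr j := g.src_arr ⟨p + j, by omega⟩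
  pt_zero := rfl
  pt_last := (congrArg g.pt (Fin.ext h : (⟨p + q, by omega⟩ : Fin (k + 1)) = Fin.last k)).trans
    g.pt_last

/-- The inner face `(g₁, …, g_i g_{i+1}, …, g_{k+1})`; the index `i` is counted from zero here. -/
def Str.inner {k : ℕ} {x y : M} (g : G.Str (k + 1) x y) (i : Fin k) : G.Str k x y where
  pt j := if (j : ℕ) ≤ i then g.pt j.castSucc else g.pt j.succ
  arr j := if (j : ℕ) < i then g.arr j.castSucc
    else if (j : ℕ) = i then G.mul (g.arr j.castSucc) (g.arr j.succ) else g.arr j.succ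
  tgt_arr j := by
    have hc : G.src (g.arr j.castSucc) = G.tgt (g.arr j.succ) := by
      rw [g.src_arr, g.tgt_arr]; rfl
    rcases lt_trichotomy (j : ℕ) i with h | h | h
    · have h1 : ((j.castSucc : Fin (k + 1)) : ℕ) ≤ i := h.le
      rw [if_pos h, if_pos h1, g.tgt_arr]
    · have h1 : ((j.castSucc : Fin (k + 1)) : ℕ) ≤ i := h.le
      rw [if_neg (by omega), if_pos h, if_pos h1, G.tgt_mul _ _ hc, g.tgt_arr]
    · have h1 : ¬ ((j.castSucc : Fin (k + 1)) : ℕ) ≤ i := not_le.mpr h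
      rw [if_neg (by omega), if_neg (by omega), if_neg h1, g.tgt_arr]
      rfl
  src_arr j := by
    have hc : G.src (g.arr j.castSucc) = G.tgt (g.arr j.succ) := by
      rw [g.src_arr, g.tgt_arr]; rfl
    rcases lt_trichotomy (j : ℕ) i with h | h | h
    · have h1 : ((j.succ : Fin (k + 1)) : ℕ) ≤ i := by
        rw [Fin.val_succ]; omega
      rw [if_pos h, if_pos h1, g.src_arr]
      rfl
    · have h1 : ¬ ((j.succ : Fin (k + 1)) : ℕ) ≤ i := by
        rw [Fin.val_succ]; omega
      rw [if_neg (by omega), if_pos h, if_neg h1, G.src_mul _ _ hc, g.src_arr]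
    · have h1 : ¬ ((j.succ : Fin (k + 1)) : ℕ) ≤ i := by
        rw [Fin.val_succ]; omega
      rw [if_neg (by omega), if_neg (by omega), if_neg h1, g.src_arr]
  pt_zero := by
    have h1 : ((0 : Fin (k + 1)) : ℕ) ≤ i := Nat.zero_le _
    rw [if_pos h1]
    exact g.pt_zero
  pt_last := by
    have h1 : ¬ ((Fin.last k : Fin (k + 1)) : ℕ) ≤ i := by
      rw [Fin.val_last]; omega
    rw [if_neg h1]
    exact g.pt_last

/-- A smooth family of strings of length `k`, parametrized by `ℝⁿ`. The manifold `G_k` of strings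
is an embedded submanifold of `M^{k+1} × G₁^k`, so a map into it is smooth when all its
components are, and (as `G_k` is locally diffeomorphic to a Euclidean space) a map defined on it
is smooth if and only if its composition with all these smooth families is smooth. -/
def IsPlot {n k : ℕ} {x y : Eu n → M} (c : ∀ z, G.Str k (x z) (y z)) : Prop :=
  (∀ i, ContMDiff (𝓡 n) (𝓡 m) ∞ (fun z => (c z).pt i)) ∧
    ∀ i, ContMDiff (𝓡 n) (𝓡 d) ∞ (fun z => (c z).arr i)

section Plots

variable {n k : ℕ} {x y : Eu n → M}

theorem IsPlot.smooth_tgt {c : ∀ z, G.Str k (x z) (y z)} (hc : IsPlot c) :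
    ContMDiff (𝓡 n) (𝓡 m) ∞ x := by
  have h := hc.1 0
  simp only [Str.pt_zero] at h
  exact h

theorem IsPlot.front {c : ∀ z, G.Str k (x z) (y z)} (hc : IsPlot c) (p : ℕ) (hp : p ≤ k) :
    IsPlot (fun z => (c z).front p hp) :=
  ⟨fun _ => hc.1 _, fun _ => hc.2 _⟩

theorem IsPlot.back {c : ∀ z, G.Str k (x z) (y z)} (hc : IsPlot c) (p q : ℕ) (h : p + q = k) :
    IsPlot (fun z => (c z).back p q h) :=
  ⟨fun _ => hc.1 _, fun _ => hc.2 _⟩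

theorem IsPlot.inner {c : ∀ z, G.Str (k + 1) (x z) (y z)} (hc : IsPlot c) (i : Fin k) :
    IsPlot (fun z => (c z).inner i) := by
  refine ⟨fun j => ?_, fun j => ?_⟩
  · by_cases h : (j : ℕ) ≤ i
    · simpa only [Str.inner, if_pos h] using hc.1 j.castSucc
    · simpa only [Str.inner, if_neg h] using hc.1 j.succ
  · by_cases h : (j : ℕ) < i
    · simpa only [Str.inner, if_pos h] using hc.2 j.castSucc
    · by_cases h2 : (j : ℕ) = i
      · simp only [Str.inner, if_neg h, if_pos h2]
        rw [← contMDiffOn_univ]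
        refine G.smooth_mul.comp
          (((hc.2 j.castSucc).prodMk (hc.2 j.succ)).contMDiffOn (s := Set.univ)) ?_
        intro z _
        change G.src _ = G.tgt _
        rw [(c z).src_arr, (c z).tgt_arr]
        rfl
      · simpa only [Str.inner, if_neg h, if_neg h2] using hc.2 j.succ

end Plots

end LieGroupoid

open LieGroupoid

variable (G : LieGroupoid m d M G₁)

/-- `C^k(G)`: the smooth functions on the manifold of strings of length `k`. -/
def SCochain (k : ℕ) : Submodule ℝ (∀ x y : M, G.Str k x y → ℝ) where
  carrier := {f | ∀ (n : ℕ) (x y : Eu n → M) (c : ∀ z, G.Str k (x z) (y z)), IsPlot c →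
    ContMDiff (𝓡 n) 𝓘(ℝ, ℝ) ∞ (fun z => f _ _ (c z))}
  add_mem' hf hg n x y c hc := (hf n x y c hc).add (hg n x y c hc)
  zero_mem' _ _ _ _ _ := contMDiff_const
  smul_mem' a _ hf n x y c hc :=
    (contMDiff_const (I := 𝓡 n) (I' := 𝓘(ℝ, ℝ)) (c := a)).smul (hf n x y c hc)

/-- Not necessarily smooth sections of `t^* V` over the manifold of strings of length `k`. -/
def RawCochain (k : ℕ) (V : SmoothVectorBundle.{u, v} m M) : Type (max u v) :=
  ∀ x y : M, G.Str k x y → V.Fib x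

instance (k : ℕ) (V : SmoothVectorBundle.{u, v} m M) : AddCommGroup (RawCochain G k V) :=
  inferInstanceAs (AddCommGroup (∀ x y : M, G.Str k x y → V.Fib x))

instance (k : ℕ) (V : SmoothVectorBundle.{u, v} m M) : Module ℝ (RawCochain G k V) :=
  inferInstanceAs (Module ℝ (∀ x y : M, G.Str k x y → V.Fib x))

/-- `C^k(G; V) = Γ(G_k, t^* V)`. -/
def Cochain (k : ℕ) (V : SmoothVectorBundle.{u, v} m M) :
    Submodule ℝ (RawCochain G k V) where
  carrier := {η | ∀ (n : ℕ) (x y : Eu n → M) (c : ∀ z, G.Str k (x z) (y z)), IsPlot c →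
    V.SmoothAlong x (fun z => η _ _ (c z))}
  add_mem' {f g} hf hg n x y c hc := by
    have h := SmoothVectorBundle.SmoothAlong.smul_add hc.smooth_tgt
      (contMDiff_const (c := (1 : ℝ))) (hf n x y c hc) (hg n x y c hc)
    simp only [one_smul] at h
    exact h
  zero_mem' _ _ _ _ hc := V.smoothAlong_zero hc.smooth_tgt
  smul_mem' a f hf n x y c hc := by
    have h := SmoothVectorBundle.SmoothAlong.smul_add hc.smooth_tgt
      (contMDiff_const (c := a)) (hf n x y c hc) (V.smoothAlong_zero hc.smooth_tgt)
    simp only [add_zero] at h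
    exact h

variable {G}

/-- The differential `δ : C^k(G) → C^{k+1}(G)`,
`δf (g₁, …, g_{k+1}) = (-1)^k (f(g₂, …, g_{k+1}) + ∑ᵢ (-1)^i f(…, gᵢ gᵢ₊₁, …)
+ (-1)^{k+1} f(g₁, …, g_k))`. -/
def delta {k : ℕ} (f : SCochain G k) : SCochain G (k + 1) where
  val x y g := (-1 : ℝ) ^ k *
    (f.1 _ _ (g.back 1 k (by omega)) +
      ∑ i : Fin k, (-1 : ℝ) ^ ((i : ℕ) + 1) * f.1 _ _ (g.inner i) +
      (-1 : ℝ) ^ (k + 1) * f.1 _ _ (g.front k (by omega)))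
  property := by
    intro n x y c hc
    have hf : ∀ (n : ℕ) (x y : Eu n → M) (c : ∀ z, G.Str k (x z) (y z)), IsPlot c →
        ContMDiff (𝓡 n) 𝓘(ℝ, ℝ) ∞ (fun z => f.1 _ _ (c z)) := f.2
    have h1 := (hf n _ _ _ (hc.back 1 k (by omega))).contDiff
    have h2 := (hf n _ _ _ (hc.front k (by omega))).contDiff
    have h3 := fun i : Fin k => (hf n _ _ _ (hc.inner i)).contDiff
    refine ContDiff.contMDiff ?_
    exact contDiff_const.mul ((h1.add (ContDiff.sum fun i _ => contDiff_const.mul (h3 i))).add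
      (contDiff_const.mul h2))

/-! ### Ordinary representations and their differentiable cohomology -/

/-- A representation of `G` on the vector bundle `V`: a smooth action. -/
structure GroupoidRep (G : LieGroupoid m d M G₁) (V : SmoothVectorBundle.{u, v} m M) where
  act : ∀ {x y : M}, G.Arrow x y → V.Fib y →ₗ[ℝ] V.Fib x
  act_id : ∀ x, act (G.idArrow x) = LinearMap.id
  act_comp : ∀ {x y z : M} (g : G.Arrow x y) (h : G.Arrow y z),
    act (G.comp g h) = act g ∘ₗ act h
  smooth : ∀ (n : ℕ) (x y : Eu n → M) (g : ∀ z, G.Arrow (x z) (y z)) (v : ∀ z, V.Fib (y z)),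
    ContMDiff (𝓡 n) (𝓡 d) ∞ (fun z => (g z).val) → ContMDiff (𝓡 n) (𝓡 m) ∞ x →
    V.SmoothAlong y v → V.SmoothAlong x (fun z => act (g z) (v z))

namespace GroupoidRep

variable {V : SmoothVectorBundle.{u, v} m M} (ρ : GroupoidRep G V)

/-- The differential `d_λ : C^k(G; V) → C^{k+1}(G; V)` of a representation. -/
def diff (k : ℕ) : Cochain G k V →ₗ[ℝ] Cochain G (k + 1) V where
  toFun η :=
    { val := fun x y g => (-1 : ℝ) ^ k •
        (ρ.act g.head (η.1 _ _ (g.back 1 k (by omega))) +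
          ∑ i : Fin k, (-1 : ℝ) ^ ((i : ℕ) + 1) • η.1 _ _ (g.inner i) +
          (-1 : ℝ) ^ (k + 1) • η.1 _ _ (g.front k (by omega)))
      property := by
        intro n x y c hc
        have hx := hc.smooth_tgt
        have key : ∀ (s : Finset (Fin k)), V.SmoothAlong x
            (fun z => ∑ i ∈ s, (-1 : ℝ) ^ ((i : ℕ) + 1) • η.1 _ _ ((c z).inner i)) := by
          intro s
          induction s using Finset.induction_on with
          | empty => simpa using V.smoothAlong_zero hx
          | insert a s ha ih =>
            simp only [Finset.sum_insert ha]
            exact SmoothVectorBundle.SmoothAlong.smul_add hx contMDiff_const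
              (η.2 _ _ _ _ (hc.inner a)) ih
        have h1 : V.SmoothAlong x
            (fun z => ρ.act (c z).head (η.1 _ _ ((c z).back 1 k (by omega)))) :=
          ρ.smooth n x _ (fun z => (c z).head) _ (hc.2 0) hx
            (η.2 _ _ _ _ (hc.back 1 k (by omega)))
        have h2 := SmoothVectorBundle.SmoothAlong.smul_add hx (contMDiff_const (c := (1 : ℝ)))
          h1 (key Finset.univ)
        have h3 := SmoothVectorBundle.SmoothAlong.smul_add hx
          (contMDiff_const (c := (-1 : ℝ) ^ (k + 1)))
          (η.2 _ _ _ _ (hc.front k (by omega))) h2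
        have h4 := SmoothVectorBundle.SmoothAlong.smul_add hx
          (contMDiff_const (c := (-1 : ℝ) ^ k)) h3 (V.smoothAlong_zero hx)
        simp only [one_smul, add_zero] at h4
        refine (congrArg (V.SmoothAlong x) (funext fun z => ?_)).mp h4
        exact congrArg _ (add_comm _ _) }
  map_add' η ζ := by
    apply Subtype.ext
    funext x y g
    change (-1 : ℝ) ^ k • (ρ.act g.head (η.1 _ _ _ + ζ.1 _ _ _) +
      ∑ i : Fin k, (-1 : ℝ) ^ ((i : ℕ) + 1) • (η.1 _ _ _ + ζ.1 _ _ _) +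
      (-1 : ℝ) ^ (k + 1) • (η.1 _ _ _ + ζ.1 _ _ _)) =
      (-1 : ℝ) ^ k • (_ + _ + _) + (-1 : ℝ) ^ k • (_ + _ + _)
    simp only [map_add, smul_add, Finset.sum_add_distrib]
    abel
  map_smul' a η := by
    apply Subtype.ext
    funext x y g
    change (-1 : ℝ) ^ k • (ρ.act g.head (a • η.1 _ _ _) +
      ∑ i : Fin k, (-1 : ℝ) ^ ((i : ℕ) + 1) • (a • η.1 _ _ _) +
      (-1 : ℝ) ^ (k + 1) • (a • η.1 _ _ _)) = a • ((-1 : ℝ) ^ k • (_ + _ + _))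
    simp only [map_smul, smul_add, Finset.smul_sum, smul_comm a]

/-- The coboundaries in `C^k(G; V)`. -/
def boundaries : ∀ k : ℕ, Submodule ℝ (Cochain G k V)
  | 0 => ⊥
  | k + 1 => LinearMap.range (ρ.diff k)

/-- `H_diff^k(G; V)`. -/
abbrev Cohomology (k : ℕ) : Type _ :=
  LinearMap.ker (ρ.diff k) ⧸ (ρ.boundaries k).submoduleOf (LinearMap.ker (ρ.diff k))

end GroupoidRep

/-! ### Cochains with values in a graded vector bundle -/

variable (G)

/-- `C(G; E)^n`, the direct sum of the `C^k(G; E^l)` with `k + l = n`. Since `E` is bounded, all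
but finitely many summands vanish, and the direct sum is a product. -/
abbrev Tot (E : GradedBundle.{u, v} m M) (n : ℤ) : Type (max u v) :=
  ∀ i : {i : ℕ × ℤ // (i.1 : ℤ) + i.2 = n}, Cochain G i.1.1 (E.deg i.1.2)

variable {G} in
/-- The component in `C^k(G; E^l)` of an element of `C(G; E)^n`. -/
def Tot.component {E : GradedBundle.{u, v} m M} {n : ℤ} (η : Tot G E n) (k : ℕ) (l : ℤ)
    (h : (k : ℤ) + l = n) : Cochain G k (E.deg l) :=
  η ⟨(k, l), h⟩

/-- Not necessarily smooth elements of `C^k_G(Hom^e(E, F))`. -/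
abbrev HomCochain (E F : GradedBundle.{u, v} m M) (k : ℕ) (e : ℤ) : Type (max u v) :=
  ∀ l l' : ℤ, l + e = l' → ∀ {x y : M}, G.Str k x y → (E.deg l).Fib y →ₗ[ℝ] (F.deg l').Fib x

variable {G}

/-- `T` is a smooth section of `Hom(s^* E, t^* F)` over the manifold of strings of length `k`,
i.e. the fibrewise linear map `s^* E → t^* F` is smooth. -/
def HomCochain.IsSmooth {E F : GradedBundle.{u, v} m M} {k : ℕ} {e : ℤ}
    (T : HomCochain G E F k e) : Prop :=
  ∀ (l l' : ℤ) (h : l + e = l') (n : ℕ) (x y : Eu n → M) (c : ∀ z, G.Str k (x z) (y z))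
    (v : ∀ z, (E.deg l).Fib (y z)), IsPlot c → (E.deg l).SmoothAlong y v →
    (F.deg l').SmoothAlong x (fun z => T l l' h (c z) (v z))

/-- The component in `C^j(G; F^{l'})` of `∑ₖ Tₖ ⋆ η`, where `Tₖ` has bidegree `(k, e - k)` and
`η` has total degree `n`:
`(T ⋆ η)(g₁, …, g_{k+q}) = (-1)^{k n} T(g₁, …, g_k)(η(g_{k+1}, …, g_{k+q}))`. -/
def starSum {E F : GradedBundle.{u, v} m M} {e : ℤ} (T : ∀ k : ℕ, HomCochain G E F k (e - k))
    {n : ℤ} (η : Tot G E n) (j : ℕ) (l' : ℤ) (h : (j : ℤ) + l' = n + e) {x y : M}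
    (g : G.Str j x y) : (F.deg l').Fib x :=
  ∑ k : Fin (j + 1), (-1 : ℝ) ^ (((k : ℕ) : ℤ) * n) •
    T k (n - ((j - k : ℕ) : ℤ)) l' (by have := k.is_lt; omega) (g.front k (by omega))
      ((Tot.component η (j - k) (n - ((j - k : ℕ) : ℤ)) (by omega)).1 _ _
        (g.back k (j - k) (by omega)))

/-- The component in `C^j(G; E^l)` of `D̂₀ η`, where `η` has total degree `n`:
`D̂₀ η (g₁, …, g_{k+1}) = (-1)^n (∑ᵢ (-1)^i η(…, gᵢ gᵢ₊₁, …) + (-1)^{k+1} η(g₁, …, g_k))`. -/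
def hatDiff {E : GradedBundle.{u, v} m M} {n : ℤ} (η : Tot G E n) :
    ∀ (j : ℕ) (l : ℤ), (j : ℤ) + l = n + 1 → ∀ {x y : M}, G.Str j x y → (E.deg l).Fib x
  | 0, _, _, _, _, _ => 0
  | k + 1, l, h, _, _, g => (-1 : ℝ) ^ n •
      (∑ i : Fin k, (-1 : ℝ) ^ ((i : ℕ) + 1) •
          (Tot.component η k l (by push_cast at h; omega)).1 _ _ (g.inner i) +
        (-1 : ℝ) ^ (k + 1) •
          (Tot.component η k l (by push_cast at h; omega)).1 _ _ (g.front k (by omega)))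

/-- The right module structure of `C(G; E)` over `C(G)`: for `η` in `C^k(G; E^l)` and `f` in
`C^j(G)`, `(η ⋆ f)(g₁, …, g_{k+j}) = (-1)^{k j} η(g₁, …, g_k) f(g_{k+1}, …, g_{k+j})`. -/
def rmul {E : GradedBundle.{u, v} m M} {n : ℤ} (η : Tot G E n) {j : ℕ} (f : SCochain G j)
    (n' : ℤ) (hn : n + j = n') : Tot G E n' := fun i =>
  if hj : j ≤ i.1.1 then
    { val := fun x y g =>
        ((-1 : ℝ) ^ ((i.1.1 - j) * j) * f.1 _ _ (g.back (i.1.1 - j) j (by omega))) •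
          (Tot.component η (i.1.1 - j) i.1.2 (by have := i.2; omega)).1 _ _
            (g.front (i.1.1 - j) (by omega))
      property := by
        intro n x y c hc
        have hf : ∀ (n : ℕ) (x y : Eu n → M) (c : ∀ z, G.Str j (x z) (y z)), IsPlot c →
            ContMDiff (𝓡 n) 𝓘(ℝ, ℝ) ∞ (fun z => f.1 _ _ (c z)) := f.2
        have hη := (Tot.component η (i.1.1 - j) i.1.2 (by have := i.2; omega)).2 n _ _ _
          (hc.front (i.1.1 - j) (by omega))
        have h0 := (hf n _ _ _ (hc.back (i.1.1 - j) j (by omega))).contDiff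
        have h1 := SmoothVectorBundle.SmoothAlong.smul_add hc.smooth_tgt
          ((contDiff_const (c := (-1 : ℝ) ^ ((i.1.1 - j) * j))).mul h0).contMDiff hη
          ((E.deg i.1.2).smoothAlong_zero hc.smooth_tgt)
        simp only [add_zero] at h1
        exact h1 }
  else 0

/-! ### Representations up to homotopy -/

/-- A representation up to homotopy of `G` on the bounded graded vector bundle `E`: a linear
operator of degree one on `C(G; E)` with square zero which satisfies the Leibniz identity. -/
structure RepUpToHomotopy (G : LieGroupoid m d M G₁) (E : GradedBundle.{u, v} m M) where
  D : ∀ n n' : ℤ, n + 1 = n' → Tot G E n →ₗ[ℝ] Tot G E n'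
  D_sq : ∀ (n n' n'' : ℤ) (h : n + 1 = n') (h' : n' + 1 = n'') (η : Tot G E n),
    D n' n'' h' (D n n' h η) = 0
  leibniz : ∀ (n n₁ n₂ n₃ : ℤ) (j : ℕ) (h : n + 1 = n₁) (h₂ : n + j = n₂) (h₃ : n₂ + 1 = n₃)
    (η : Tot G E n) (f : SCochain G j),
    D n₂ n₃ h₃ (rmul η f n₂ h₂) = rmul (D n n₁ h η) f n₃ (by omega) +
      (-1 : ℝ) ^ n • rmul η (delta f) n₃ (by push_cast; omega)

namespace RepUpToHomotopy

variable {E F : GradedBundle.{u, v} m M}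

/-- The `Rₖ ∈ C^k_G(End^{1-k}(E))` are the structure maps of the representation up to homotopy,
i.e. they are smooth and `D η = ∑ₖ Rₖ ⋆ η + D̂₀ η`. -/
structure HasComponents (A : RepUpToHomotopy G E) (R : ∀ k : ℕ, HomCochain G E E k (1 - k)) :
    Prop where
  smooth : ∀ k, (R k).IsSmooth
  eq : ∀ (n n' : ℤ) (hn : n + 1 = n') (η : Tot G E n) (j : ℕ) (l : ℤ) (h : (j : ℤ) + l = n')
    (x y : M) (g : G.Str j x y),
    (Tot.component (A.D n n' hn η) j l h).1 x y g =
      starSum R η j l (by omega) g + hatDiff η j l (by omega) g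

/-- `R₁(g) = id` for all units `g`, and `Rₖ(g₁, …, gₖ) = 0` if `k ≥ 2` and some `gᵢ` is a unit. -/
structure IsUnital (R : ∀ k : ℕ, HomCochain G E E k (1 - k)) : Prop where
  one : ∀ (l : ℤ) (x : M), R 1 l l (by simp) (single (G.idArrow x)) = LinearMap.id
  zero : ∀ (k : ℕ), 2 ≤ k → ∀ (l l' : ℤ) (h : l + (1 - (k : ℤ)) = l') (x y : M)
    (g : G.Str k x y), (∃ i z, g.arr i = G.unit z) → R k l l' h g = 0

/-- The differential `∂ = R₀ : E^l → E^{l+1}` of the underlying complex at the point `x`. -/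
def bdry (R : ∀ k : ℕ, HomCochain G E E k (1 - k)) (l l' : ℤ) (h : l + 1 = l') (x : M) :
    (E.deg l).Fib x →ₗ[ℝ] (E.deg l').Fib x :=
  R 0 l l' (by simpa using h) (nil x)

/-- The quasi-action `λ_g = R₁(g)` of an arrow `g` on `E^l`. -/
def quasiAct (R : ∀ k : ℕ, HomCochain G E E k (1 - k)) (l : ℤ) {x y : M} (g : G.Arrow x y) :
    (E.deg l).Fib y →ₗ[ℝ] (E.deg l).Fib x :=
  R 1 l l (by simp) (single g)

/-- The underlying complex is regular: `∂` has constant rank in each degree. -/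
def IsRegular (R : ∀ k : ℕ, HomCochain G E E k (1 - k)) : Prop :=
  ∀ l : ℤ, ∃ r : ℕ, ∀ x : M, Module.finrank ℝ (LinearMap.range (bdry R l (l + 1) rfl x)) = r

/-- `H` is the cohomology bundle of the underlying complex: `proj` identifies the fibre of `H^l`
at `x` with `ker ∂ / im ∂`, and the smooth sections of `H^l` are those that can locally be
lifted to smooth sections of `E^l` with values in `ker ∂`. -/
structure CohomologyBundle (R : ∀ k : ℕ, HomCochain G E E k (1 - k))
    (H : GradedBundle.{u, v} m M) where
  proj : ∀ (l : ℤ) (x : M), LinearMap.ker (bdry R l (l + 1) rfl x) →ₗ[ℝ] (H.deg l).Fib x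
  proj_surjective : ∀ l x, Function.Surjective (proj l x)
  ker_proj : ∀ (l : ℤ) (x : M), LinearMap.ker (proj l x) =
    (LinearMap.range (bdry R (l - 1) l (by omega) x)).submoduleOf
      (LinearMap.ker (bdry R l (l + 1) rfl x))
  smooth_iff : ∀ (l : ℤ) (U : Set M), IsOpen U → ∀ h : ∀ x, (H.deg l).Fib x,
    (H.deg l).SmoothOn h U ↔ ∀ x ∈ U, ∃ W : Set M, IsOpen W ∧ x ∈ W ∧
      ∃ c : ∀ x, (E.deg l).Fib x, (E.deg l).SmoothOn c W ∧
        ∀ y ∈ W, ∃ hy : c y ∈ LinearMap.ker (bdry R l (l + 1) rfl y), proj l y ⟨c y, hy⟩ = h y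

/-- A morphism of representations up to homotopy: a `C(G)`-linear map of degree zero
`C(G; E) → C(G; F)` which commutes with the structure operators. -/
structure Morphism (A : RepUpToHomotopy G E) (B : RepUpToHomotopy G F) where
  map : ∀ n : ℤ, Tot G E n →ₗ[ℝ] Tot G F n
  map_rmul : ∀ (n n' : ℤ) (j : ℕ) (h : n + j = n') (η : Tot G E n) (f : SCochain G j),
    map n' (rmul η f n' h) = rmul (map n η) f n' h
  comm : ∀ (n n' : ℤ) (h : n + 1 = n') (η : Tot G E n),
    map n' (A.D n n' h η) = B.D n n' h (map n η)

/-- The `Φₖ ∈ C^k_G(Hom^{-k}(E, F))` are the components of the morphism `Φ`,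
i.e. they are smooth and `Φ η = ∑ₖ Φₖ ⋆ η`. -/
structure Morphism.HasComponents {A : RepUpToHomotopy G E} {B : RepUpToHomotopy G F}
    (Φ : Morphism A B) (φ : ∀ k : ℕ, HomCochain G E F k (0 - k)) : Prop where
  smooth : ∀ k, (φ k).IsSmooth
  eq : ∀ (n : ℤ) (η : Tot G E n) (j : ℕ) (l : ℤ) (h : (j : ℤ) + l = n)
    (x y : M) (g : G.Str j x y),
    (Tot.component (Φ.map n η) j l h).1 x y g = starSum φ η j l (by omega) g

/-- The map `Φ₀ : E^l → F^l` at the point `x`. -/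
def Morphism.fiberMap (φ : ∀ k : ℕ, HomCochain G E F k (0 - k)) (l : ℤ) (x : M) :
    (E.deg l).Fib x →ₗ[ℝ] (F.deg l).Fib x :=
  φ 0 l l (by simp) (nil x)

/-- `Φ₀ : (E, ∂) → (F, ∂)` induces an isomorphism in cohomology at every point: it maps cocycles
to cocycles and coboundaries to coboundaries, and the induced map between the cohomology spaces
is injective and surjective. -/
structure IsQuasiIso (R : ∀ k : ℕ, HomCochain G E E k (1 - k))
    (S : ∀ k : ℕ, HomCochain G F F k (1 - k)) (φ : ∀ k : ℕ, HomCochain G E F k (0 - k)) :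
    Prop where
  cocycle : ∀ (l : ℤ) (x : M) (v : (E.deg l).Fib x), bdry R l (l + 1) rfl x v = 0 →
    bdry S l (l + 1) rfl x (Morphism.fiberMap φ l x v) = 0
  coboundary : ∀ (l : ℤ) (x : M) (v : (E.deg l).Fib x),
    v ∈ LinearMap.range (bdry R (l - 1) l (by omega) x) →
    Morphism.fiberMap φ l x v ∈ LinearMap.range (bdry S (l - 1) l (by omega) x)
  injective : ∀ (l : ℤ) (x : M) (v : (E.deg l).Fib x), bdry R l (l + 1) rfl x v = 0 →
    Morphism.fiberMap φ l x v ∈ LinearMap.range (bdry S (l - 1) l (by omega) x) →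
    v ∈ LinearMap.range (bdry R (l - 1) l (by omega) x)
  surjective : ∀ (l : ℤ) (x : M) (w : (F.deg l).Fib x), bdry S l (l + 1) rfl x w = 0 →
    ∃ v : (E.deg l).Fib x, bdry R l (l + 1) rfl x v = 0 ∧
      Morphism.fiberMap φ l x v - w ∈ LinearMap.range (bdry S (l - 1) l (by omega) x)

end RepUpToHomotopy

/-- The filtration of `C(G; E)` by the cocycle degree, `L^p = ⨁_{k ≥ p} C^k(G; E)`. -/
def cocycleFiltration (G : LieGroupoid m d M G₁) (E : GradedBundle.{u, v} m M) (p n : ℤ) :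
    Submodule ℝ (Tot G E n) where
  carrier := {η | ∀ i, (i.1.1 : ℤ) < p → η i = 0}
  add_mem' hη hζ i hi := by rw [Pi.add_apply, hη i hi, hζ i hi, add_zero]
  zero_mem' _ _ := rfl
  smul_mem' a η hη i hi := by rw [Pi.smul_apply, hη i hi, smul_zero]

/-! ### Spectral sequences of filtered complexes -/

namespace Filtered

variable {C : ℤ → Type w} [∀ n, AddCommGroup (C n)] [∀ n, Module ℝ (C n)]
  (D : ∀ n n' : ℤ, n + 1 = n' → C n →ₗ[ℝ] C n') (L : ∀ _ n : ℤ, Submodule ℝ (C n))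

/-- The `n`-th cohomology of the complex `(C, D)`. -/
abbrev Cohomology (n : ℤ) : Type w :=
  LinearMap.ker (D n (n + 1) rfl) ⧸
    (LinearMap.range (D (n - 1) n (by omega))).submoduleOf (LinearMap.ker (D n (n + 1) rfl))

/-- The filtration of the cohomology induced by the filtration `L` of the complex:
`F^p H^n` is the image of `H^n(L^p)`. -/
def inducedFiltration (p n : ℤ) : Submodule ℝ (Cohomology D n) :=
  ((L p n).submoduleOf (LinearMap.ker (D n (n + 1) rfl))).map (Submodule.mkQ _)

/-- `Z_r^p`: the elements `z` of `L^p C^n` with `D z ∈ L^{p+r}`. -/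
def cycles (r p n : ℤ) : Submodule ℝ (C n) :=
  L p n ⊓ (L (p + r) (n + 1)).comap (D n (n + 1) rfl)

/-- `Z_{r-1}^{p+1} + D Z_{r-1}^{p-r+1}`. -/
def boundaries (r p n : ℤ) : Submodule ℝ (C n) :=
  cycles D L (r - 1) (p + 1) n ⊔
    (cycles D L (r - 1) (p - r + 1) (n - 1)).map (D (n - 1) n (by omega))

/-- The entry `E_r^{p,q} = Z_r^p / (Z_{r-1}^{p+1} + D Z_{r-1}^{p-r+1})`, in total degree `p + q`,
of the spectral sequence of the filtered complex `(C, D, L)`. -/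
abbrev Page (r p q : ℤ) : Type w :=
  cycles D L r p (p + q) ⧸ (boundaries D L r p (p + q)).submoduleOf (cycles D L r p (p + q))

/-- The class in `E_r^{p,q}` of an element of `Z_r^p`. -/
def Page.mk (r p q : ℤ) (z : C (p + q)) (hz : z ∈ cycles D L r p (p + q)) : Page D L r p q :=
  Submodule.Quotient.mk ⟨z, hz⟩

/-- `S` is the spectral sequence of the filtered complex `(C, D, L)`: its entries are the
`E_r^{p,q}` above, the differentials are induced by `D`, and the identifications of the homology
of a page with the next page are induced by the identity of `C`. -/
structure IsSpectralSequence (S : CohomologicalSpectralSequence (ModuleCat.{w} ℝ) 0) where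
  equiv : ∀ (r : ℤ) (hr : 0 ≤ r) (p q : ℤ), (S.page r hr).X (p, q) ≃ₗ[ℝ] Page D L r p q
  equiv_d : ∀ (r : ℤ) (hr : 0 ≤ r) (p q p' q' : ℤ) (_ : p + r = p') (_ : q + 1 - r = q')
    (z : C (p + q)) (hz : z ∈ cycles D L r p (p + q))
    (hz' : D (p + q) (p' + q') (by omega) z ∈ cycles D L r p' (p' + q')),
    equiv r hr p' q' ((S.page r hr).d (p, q) (p', q')
      ((equiv r hr p q).symm (Page.mk D L r p q z hz))) = Page.mk D L r p' q' _ hz'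
  equiv_iso : ∀ (r : ℤ) (hr : 0 ≤ r) (p q : ℤ) (c : (S.page r hr).cycles (p, q))
    (z : C (p + q)) (hz : z ∈ cycles D L r p (p + q)) (hz' : z ∈ cycles D L (r + 1) p (p + q)),
    equiv r hr p q ((S.page r hr).iCycles (p, q) c) = Page.mk D L r p q z hz →
    equiv (r + 1) (by omega) p q
      ((S.iso r (r + 1) (p, q) rfl hr).hom ((S.page r hr).homologyπ (p, q) c)) =
        Page.mk D L (r + 1) p q z hz'

end Filtered

/-- The spectral sequence `S` converges to the graded vector space `A` with the decreasing
filtration `F`: in each degree the filtration is finite, exhaustive and separated; for each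
`(p, q)`, from some page on the differentials from and to the entry at `(p, q)` vanish; and the
resulting stable value `E_∞^{p,q}` is identified with `F^p A^{p+q} / F^{p+1} A^{p+q}`. -/
structure ConvergesTo (S : CohomologicalSpectralSequence (ModuleCat.{w} ℝ) 0)
    {A : ℤ → Type w} [∀ n, AddCommGroup (A n)] [∀ n, Module ℝ (A n)]
    (F : ∀ _ n : ℤ, Submodule ℝ (A n)) : Prop where
  decreasing : ∀ p n, F (p + 1) n ≤ F p n
  exhaustive : ∀ n, ∃ p, F p n = ⊤
  separated : ∀ n, ∃ p, F p n = ⊥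
  limit : ∀ p q : ℤ, ∃ (r₀ : ℤ) (h₀ : 0 ≤ r₀),
    (∀ (r : ℤ) (hr : r₀ ≤ r) (b : ℤ × ℤ),
      (S.page r (h₀.trans hr)).d (p, q) b = 0 ∧ (S.page r (h₀.trans hr)).d b (p, q) = 0) ∧
    ∃ e : ∀ (r : ℤ) (hr : r₀ ≤ r), (S.page r (h₀.trans hr)).X (p, q) ≃ₗ[ℝ]
        F p (p + q) ⧸ (F (p + 1) (p + q)).submoduleOf (F p (p + q)),
      ∀ (r : ℤ) (hr : r₀ ≤ r) (c : (S.page r (h₀.trans hr)).cycles (p, q)),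
        e (r + 1) (by omega) ((S.iso r (r + 1) (p, q) rfl (h₀.trans hr)).hom
          ((S.page r (h₀.trans hr)).homologyπ (p, q) c)) =
        e r hr ((S.page r (h₀.trans hr)).iCycles (p, q) c)

end LieRep

end

open LieRep

/-! Since ∂ has constant rank, it has a smooth generalized inverse h. Near a point one inverts a
matrix close to the identity (`nearInverse_spec`), and as the equation ∂h∂ = ∂ is affine in h, a
partition of unity makes the choice global (`SmoothVectorBundle.exists_generalizedInverse`).
Algebraic corrections give h∂h = h and hh = 0 as well (`exists_homotopy`). Then 1 − ∂h − h∂ is a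
smooth projection of constant rank, and its image H is a vector bundle whose fibres are complements
of im ∂ in ker ∂. The inclusion i, the projection p and h form a contraction of (E, ∂) onto (H, 0)
(`exists_contraction`).

Homological perturbation transfers D to H. Write D = ∂ + δ. The operator δ does not raise the degree
l of E^l, while h lowers it by one; as E is bounded, δh is nilpotent and u = (1 + δh)⁻¹ is a finite
geometric sum. The operators D' = p u δ i and Φ = p u satisfy D'D' = 0 and ΦD = D'Φ
(`perturbation_identity`). They must also be of the required form, that is, given by sections over
strings and, for D', the operator D̂₀. This holds because D̂₀ commutes with p and i and anticommutes
with h, so that the side conditions hh = 0, ph = 0, hi = 0 remove it from the series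
(`Contraction.pOp_pert_pow`, `Contraction.totalD_transferD`). The low components are R'₀ = 0, R'₁ =
pλi and Φ₀ = p, which gives (3).

Statement (1) follows from D² = 0 and D'² = 0, evaluated on short strings and on sections through a
given vector: λ commutes with ∂ (`base_comm`), and pλi is multiplicative (`fn_one_comp`). By the
first fact pλi is the action induced by λ on cohomology.

For (2), the pages and their homology are computed with representatives in Z_r and B_r. On the
second page, a representative in L^p is sent to p of its component of cocycle degree p. The morphism
Φ has leading term p, and the leading term of D' is the differential of the representation up to
sign, so cocycles go to cocycles (`projComponent_D`). Lifting by i and solving ∂-equations with h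
give bijectivity (`projComponent_mem_boundaries_iff`, `exists_secondPageEquiv`).

Operators are mostly treated on `Cochains`, the product of all C^k(G; E^l), where they are elements
of an endomorphism ring; `Cochains.res` and `Cochains.ext` pass to a fixed total degree and back. -/

noncomputable section

namespace LieRep

variable {m d : ℕ} {M : Type u} [TopologicalSpace M] [ChartedSpace (Eu m) M]
  {G₁ : Type u} [TopologicalSpace G₁] [ChartedSpace (Eu d) G₁]

open LieGroupoid

/-! ### Smooth families of linear maps between vector bundles, in coordinates and on plots. -/

namespace SmoothVectorBundle

/-- The preferred trivialization of `V` at `x`. -/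
abbrev triv (V : SmoothVectorBundle.{u, v} m M) (x : M) :
    Trivialization (Eu V.rank) (π (Eu V.rank) V.Fib) :=
  trivializationAt (Eu V.rank) V.Fib x

variable {V W Z : SmoothVectorBundle.{u, v} m M}

instance (V : SmoothVectorBundle.{u, v} m M) (x : M) : FiniteDimensional ℝ (V.Fib x) :=
  ((V.triv x).linearEquivAt ℝ x (FiberBundle.mem_baseSet_trivializationAt' x)).symm.finiteDimensional

theorem finrank_fib (V : SmoothVectorBundle.{u, v} m M) (x : M) :
    Module.finrank ℝ (V.Fib x) = V.rank := by
  rw [((V.triv x).linearEquivAt ℝ x (FiberBundle.mem_baseSet_trivializationAt' x)).finrank_eq]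
  simp

theorem mem_triv (V : SmoothVectorBundle.{u, v} m M) (x : M) : x ∈ (V.triv x).baseSet :=
  FiberBundle.mem_baseSet_trivializationAt' x

theorem eventually_mem_triv (V : SmoothVectorBundle.{u, v} m M) {x₀ x : M}
    (h : x ∈ (V.triv x₀).baseSet) : ∀ᶠ y in 𝓝 x, y ∈ (V.triv x₀).baseSet :=
  (V.triv x₀).open_baseSet.mem_nhds h

/-- The matrix at `x`, with respect to the preferred trivializations at `x₀`, of a family of
linear maps between the fibres of two bundles. -/
def coord (x₀ : M) (T : ∀ x, V.Fib x →ₗ[ℝ] W.Fib x) (x : M) : Eu V.rank →L[ℝ] Eu W.rank :=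
  LinearMap.toContinuousLinearMap
    ((W.triv x₀).linearMapAt ℝ x ∘ₗ T x ∘ₗ (V.triv x₀).symmₗ ℝ x)

theorem coord_apply (x₀ : M) (T : ∀ x, V.Fib x →ₗ[ℝ] W.Fib x) (x : M) (ξ : Eu V.rank) :
    coord x₀ T x ξ = (W.triv x₀).linearMapAt ℝ x (T x ((V.triv x₀).symmₗ ℝ x ξ)) := rfl

/-- The family `T` of linear maps between the fibres is smooth at `x₀`. -/
def HomSmoothAt (T : ∀ x, V.Fib x →ₗ[ℝ] W.Fib x) (x₀ : M) : Prop :=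
  ContMDiffAt (𝓡 m) 𝓘(ℝ, Eu V.rank →L[ℝ] Eu W.rank) ∞ (coord x₀ T) x₀

theorem symmₗ_linearMapAt' {x₀ x : M} (h : x ∈ (V.triv x₀).baseSet) (v : V.Fib x) :
    (V.triv x₀).symmₗ ℝ x ((V.triv x₀).linearMapAt ℝ x v) = v :=
  Trivialization.symmₗ_linearMapAt _ h v

theorem linearMapAt_symmₗ' {x₀ x : M} (h : x ∈ (V.triv x₀).baseSet) (ξ : Eu V.rank) :
    (V.triv x₀).linearMapAt ℝ x ((V.triv x₀).symmₗ ℝ x ξ) = ξ :=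
  Trivialization.linearMapAt_symmₗ _ h ξ

theorem linearMapAt_eq {x₀ x : M} (h : x ∈ (V.triv x₀).baseSet) (v : V.Fib x) :
    (V.triv x₀).linearMapAt ℝ x v = (V.triv x₀ ⟨x, v⟩).2 := by
  rw [Trivialization.coe_linearMapAt_of_mem _ h]

theorem mk_symmₗ {x₀ x : M} (h : x ∈ (V.triv x₀).baseSet) (ξ : Eu V.rank) :
    (⟨x, (V.triv x₀).symmₗ ℝ x ξ⟩ : TotalSpace (Eu V.rank) V.Fib) =
      (V.triv x₀).toOpenPartialHomeomorph.symm (x, ξ) := by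
  rw [Trivialization.symmₗ_apply, Trivialization.mk_symm _ h]
  exact h

theorem coordChangeL_linearMapAt {x₀ x₁ x : M} (h₀ : x ∈ (V.triv x₀).baseSet)
    (h₁ : x ∈ (V.triv x₁).baseSet) (v : V.Fib x) :
    (V.triv x₀).coordChangeL ℝ (V.triv x₁) x ((V.triv x₀).linearMapAt ℝ x v) =
      (V.triv x₁).linearMapAt ℝ x v := by
  rw [Trivialization.coordChangeL_apply _ _ ⟨h₀, h₁⟩, ← Trivialization.symmₗ_apply (R := ℝ),
    symmₗ_linearMapAt' h₀, linearMapAt_eq h₁]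
  exact h₀

theorem coord_change {x₀ x₁ x : M} (T : ∀ x, V.Fib x →ₗ[ℝ] W.Fib x)
    (hV₀ : x ∈ (V.triv x₀).baseSet) (hV₁ : x ∈ (V.triv x₁).baseSet)
    (hW₀ : x ∈ (W.triv x₀).baseSet) (hW₁ : x ∈ (W.triv x₁).baseSet) :
    coord x₀ T x = ((W.triv x₁).coordChangeL ℝ (W.triv x₀) x : Eu W.rank →L[ℝ] Eu W.rank) ∘L
      (coord x₁ T x ∘L ((V.triv x₀).coordChangeL ℝ (V.triv x₁) x : Eu V.rank →L[ℝ] Eu V.rank)) := by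
  ext1 ξ
  obtain ⟨v, rfl⟩ : ∃ v, (V.triv x₀).linearMapAt ℝ x v = ξ :=
    ⟨_, linearMapAt_symmₗ' hV₀ ξ⟩
  simp only [ContinuousLinearMap.comp_apply, ContinuousLinearEquiv.coe_coe]
  rw [coordChangeL_linearMapAt hV₀ hV₁, coord_apply, coord_apply, symmₗ_linearMapAt' hV₀,
    symmₗ_linearMapAt' hV₁, coordChangeL_linearMapAt hW₁ hW₀]

theorem contMDiffAt_coord_of_coord {x₀ x₁ x : M} (T : ∀ x, V.Fib x →ₗ[ℝ] W.Fib x)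
    (hV₀ : x ∈ (V.triv x₀).baseSet) (hV₁ : x ∈ (V.triv x₁).baseSet)
    (hW₀ : x ∈ (W.triv x₀).baseSet) (hW₁ : x ∈ (W.triv x₁).baseSet)
    (h : ContMDiffAt (𝓡 m) 𝓘(ℝ, Eu V.rank →L[ℝ] Eu W.rank) ∞ (coord x₁ T) x) :
    ContMDiffAt (𝓡 m) 𝓘(ℝ, Eu V.rank →L[ℝ] Eu W.rank) ∞ (coord x₀ T) x := by
  refine ContMDiffAt.congr_of_eventuallyEq ?_ (f := fun x =>
    ((W.triv x₁).coordChangeL ℝ (W.triv x₀) x : Eu W.rank →L[ℝ] Eu W.rank) ∘L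
      (coord x₁ T x ∘L ((V.triv x₀).coordChangeL ℝ (V.triv x₁) x : Eu V.rank →L[ℝ] Eu V.rank))) ?_
  · exact (contMDiffAt_coordChangeL hW₁ hW₀).clm_comp
      (h.clm_comp (contMDiffAt_coordChangeL hV₀ hV₁))
  · filter_upwards [V.eventually_mem_triv hV₀, V.eventually_mem_triv hV₁,
      W.eventually_mem_triv hW₀, W.eventually_mem_triv hW₁] with y h1 h2 h3 h4
    exact coord_change T h1 h2 h3 h4

theorem HomSmoothAt.contMDiffAt_coord {T : ∀ x, V.Fib x →ₗ[ℝ] W.Fib x} {x₀ x : M}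
    (h : HomSmoothAt T x) (hV : x ∈ (V.triv x₀).baseSet) (hW : x ∈ (W.triv x₀).baseSet) :
    ContMDiffAt (𝓡 m) 𝓘(ℝ, Eu V.rank →L[ℝ] Eu W.rank) ∞ (coord x₀ T) x :=
  contMDiffAt_coord_of_coord T hV (V.mem_triv x) hW (W.mem_triv x) h

theorem homSmoothAt_of_coord {T : ∀ x, V.Fib x →ₗ[ℝ] W.Fib x} {x₀ x : M}
    (hV : x ∈ (V.triv x₀).baseSet) (hW : x ∈ (W.triv x₀).baseSet)
    (h : ContMDiffAt (𝓡 m) 𝓘(ℝ, Eu V.rank →L[ℝ] Eu W.rank) ∞ (coord x₀ T) x) :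
    HomSmoothAt T x :=
  contMDiffAt_coord_of_coord T (V.mem_triv x) hV (W.mem_triv x) hW h

section Apply

variable {F H N : Type*} [NormedAddCommGroup F] [NormedSpace ℝ F] [TopologicalSpace H]
  {I : ModelWithCorners ℝ F H} [TopologicalSpace N] [ChartedSpace H N]

/-- The parameter manifold and the set `s` are arbitrary, so that plots (`SmoothAlong`) and sections
over open sets (`SmoothOn`) are both covered. -/
theorem HomSmoothAt.contMDiffWithinAt {T : ∀ x, V.Fib x →ₗ[ℝ] W.Fib x} {b : N → M}
    {w : ∀ z, V.Fib (b z)} {s : Set N} {z₀ : N} (hT : HomSmoothAt T (b z₀))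
    (hw : ContMDiffWithinAt I ((𝓡 m).prod 𝓘(ℝ, Eu V.rank)) ∞
      (fun z => (⟨b z, w z⟩ : TotalSpace (Eu V.rank) V.Fib)) s z₀) :
    ContMDiffWithinAt I ((𝓡 m).prod 𝓘(ℝ, Eu W.rank)) ∞
      (fun z => (⟨b z, T (b z) (w z)⟩ : TotalSpace (Eu W.rank) W.Fib)) s z₀ := by
  rw [Bundle.contMDiffWithinAt_totalSpace] at hw ⊢
  obtain ⟨hb, hw⟩ := hw
  refine ⟨hb, ?_⟩
  have h1 := (ContMDiffAt.comp_contMDiffWithinAt z₀ hT hb).clm_apply hw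
  have key : ∀ z, b z ∈ (V.triv (b z₀)).baseSet → b z ∈ (W.triv (b z₀)).baseSet →
      (W.triv (b z₀) ⟨b z, T (b z) (w z)⟩).2 =
        (coord (b z₀) T (b z)) (V.triv (b z₀) ⟨b z, w z⟩).2 := by
    intro z hV hW
    rw [← linearMapAt_eq hV, ← linearMapAt_eq hW, coord_apply, symmₗ_linearMapAt' hV]
  refine h1.congr_of_eventuallyEq ?_ (key z₀ (V.mem_triv _) (W.mem_triv _))
  filter_upwards [hb.continuousWithinAt (V.eventually_mem_triv (V.mem_triv _)),
    hb.continuousWithinAt (W.eventually_mem_triv (W.mem_triv _))] with z hV hW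
  exact key z hV hW

end Apply

theorem smoothAlong_of_homSmooth {T : ∀ x, V.Fib x →ₗ[ℝ] W.Fib x} (hT : ∀ x, HomSmoothAt T x)
    {n : ℕ} {b : Eu n → M} {w : ∀ z, V.Fib (b z)} (hw : V.SmoothAlong b w) :
    W.SmoothAlong b (fun z => T (b z) (w z)) := fun z =>
  (HomSmoothAt.contMDiffWithinAt (hT _) (hw z).contMDiffWithinAt).contMDiffAt Filter.univ_mem

theorem smoothOn_of_homSmooth {T : ∀ x, V.Fib x →ₗ[ℝ] W.Fib x} (hT : ∀ x, HomSmoothAt T x)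
    {w : ∀ x, V.Fib x} {U : Set M} (hw : V.SmoothOn w U) :
    W.SmoothOn (fun x => T x (w x)) U := fun x hx =>
  HomSmoothAt.contMDiffWithinAt (b := fun x => x) (hT _) (hw x hx)

/-- Plots are defined on a whole Euclidean space, whereas a chart only has an open target. The
diffeomorphism `univBall` of ℝᵐ onto a small ball in the chart removes this mismatch; `σ` is the
local inverse of the plot. -/
theorem exists_plot [IsManifold (𝓡 m) ∞ M] {x₀ : M} {U : Set M} (hU : U ∈ 𝓝 x₀) :
    ∃ (ψ : Eu m → M) (σ : M → Eu m), ContMDiff (𝓡 m) (𝓡 m) ∞ ψ ∧ ψ 0 = x₀ ∧ (∀ z, ψ z ∈ U) ∧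
      ContMDiffAt (𝓡 m) (𝓡 m) ∞ σ x₀ ∧ σ x₀ = 0 ∧ ∀ᶠ x in 𝓝 x₀, ψ (σ x) = x := by
  set e := chartAt (Eu m) x₀ with he
  have hx₀ : x₀ ∈ e.source := mem_chart_source _ _
  have hT : e.target ∩ e.symm ⁻¹' U ∈ 𝓝 (e x₀) := by
    refine Filter.inter_mem (e.open_target.mem_nhds (e.map_source hx₀)) ?_
    refine e.continuousAt_symm (e.map_source hx₀) ?_
    rwa [e.left_inv hx₀]
  obtain ⟨r, hr, hball⟩ := Metric.mem_nhds_iff.1 hT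
  set β := OpenPartialHomeomorph.univBall (e x₀) r with hβ
  have hβmem : ∀ z, β z ∈ Metric.ball (e x₀) r := by
    intro z
    rw [← OpenPartialHomeomorph.univBall_target (e x₀) hr]
    exact β.map_source (by rw [hβ, OpenPartialHomeomorph.univBall_source]; trivial)
  have hβ0 : β 0 = e x₀ := OpenPartialHomeomorph.univBall_apply_zero _ _
  refine ⟨fun z => e.symm (β z), fun x => β.symm (e x), ?_, ?_, fun z => (hball (hβmem z)).2,
    ?_, ?_, ?_⟩
  · exact (contMDiffOn_chart_symm (I := 𝓡 m) (n := ∞)).comp_contMDiff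
      (OpenPartialHomeomorph.contDiff_univBall.contMDiff) fun z => (hball (hβmem z)).1
  · simp only [hβ0, e.left_inv hx₀]
  · have hβs : ContMDiffAt (𝓡 m) (𝓡 m) ∞ β.symm (e x₀) :=
      (OpenPartialHomeomorph.contDiffOn_univBall_symm.contDiffAt
        (Metric.ball_mem_nhds _ hr)).contMDiffAt
    exact hβs.comp x₀ (contMDiffAt_of_mem_maximalAtlas (I := 𝓡 m) (n := ∞)
        (IsManifold.chart_mem_maximalAtlas x₀) hx₀)
  · exact OpenPartialHomeomorph.univBall_symm_apply_center _ _
  · filter_upwards [e.open_source.mem_nhds hx₀,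
      e.continuousAt hx₀ (Metric.ball_mem_nhds _ hr)] with x hx hx'
    have h1 : e x ∈ β.target := by
      rw [hβ, OpenPartialHomeomorph.univBall_target _ hr]; exact hx'
    simp only [β.right_inv h1, e.left_inv hx]

/-- The test sections are those with constant coordinates along the plot of `exists_plot`: their
images are the columns of the matrix of `T`, and a matrix is smooth when its values on fixed vectors
are. Composing with the local inverse `σ` returns to `M`. -/
theorem homSmoothAt_of_plots [IsManifold (𝓡 m) ∞ M] {T : ∀ x, V.Fib x →ₗ[ℝ] W.Fib x}
    (hT : ∀ (n : ℕ) (b : Eu n → M) (w : ∀ z, V.Fib (b z)), V.SmoothAlong b w →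
      W.SmoothAlong b (fun z => T (b z) (w z))) (x₀ : M) : HomSmoothAt T x₀ := by
  obtain ⟨ψ, σ, hψ, hψ0, hψU, hσ, hσ0, hψσ⟩ := exists_plot (m := m) (Filter.inter_mem
    (V.eventually_mem_triv (V.mem_triv x₀)) (W.eventually_mem_triv (W.mem_triv x₀)))
  have h1 : ∀ ξ : Eu V.rank, ContDiff ℝ ∞ (fun z => coord x₀ T (ψ z) ξ) := by
    intro ξ
    have hs : V.SmoothAlong ψ (fun z => (V.triv x₀).symmₗ ℝ (ψ z) ξ) := by
      have h2 : ContMDiff (𝓡 m) ((𝓡 m).prod 𝓘(ℝ, Eu V.rank)) ∞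
          (fun z => (ψ z, ξ)) := hψ.prodMk contMDiff_const
      have h3 := ((V.triv x₀).contMDiffOn_symm (IB := 𝓡 m) (n := ∞)).comp_contMDiff h2
        (fun z => (Trivialization.mem_target _).2 (hψU z).1)
      exact h3.congr fun z => mk_symmₗ (hψU z).1 ξ
    have h4 := (hT m ψ _ hs)
    have hsrc : ∀ z, (⟨ψ z, T (ψ z) ((V.triv x₀).symmₗ ℝ (ψ z) ξ)⟩ :
        TotalSpace (Eu W.rank) W.Fib) ∈ (W.triv x₀).source := fun z =>
      (Trivialization.mem_source _).2 (hψU z).2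
    have h5 := ((W.triv x₀).contMDiff_iff (IB := 𝓡 m) hsrc).1 h4
    refine (h5.2.congr fun z => ?_).contDiff
    rw [coord_apply, linearMapAt_eq (hψU z).2]
  have h6 : ContDiff ℝ ∞ (fun z => coord x₀ T (ψ z)) := contDiff_clm_apply_iff.2 h1
  refine ContMDiffAt.congr_of_eventuallyEq (f := fun x => coord x₀ T (ψ (σ x))) ?_ ?_
  · exact ContMDiffAt.comp (I' := 𝓡 m) x₀ (g := fun z => coord x₀ T (ψ z))
      h6.contMDiff.contMDiffAt hσ
  · filter_upwards [hψσ] with x hx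
    rw [hx]

end SmoothVectorBundle

/-! ### Generalized inverses of linear maps, and their smooth dependence at constant rank. -/

section GeneralizedInverse

/-- Any extension B of a section of A over its range satisfies ABA = A; then BAB satisfies both
identities. -/
theorem _root_.LinearMap.exists_generalizedInverse {K V W : Type*} [Field K] [AddCommGroup V]
    [Module K V] [AddCommGroup W] [Module K W] (A : V →ₗ[K] W) :
    ∃ B : W →ₗ[K] V, A ∘ₗ B ∘ₗ A = A ∧ B ∘ₗ A ∘ₗ B = B := by
  obtain ⟨s, hs⟩ := A.rangeRestrict.exists_rightInverse_of_surjective A.range_rangeRestrict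
  obtain ⟨B, hB⟩ := LinearMap.exists_extend s
  have h1 : ∀ v, A (B (A v)) = A v := by
    intro v
    have h2 : B (A v) = s (A.rangeRestrict v) := by rw [← hB]; rfl
    rw [h2]
    exact congrArg Subtype.val (LinearMap.congr_fun hs (A.rangeRestrict v))
  refine ⟨B ∘ₗ A ∘ₗ B, ?_, ?_⟩ <;> ext v <;> simp [h1]

variable {F F' : Type*} [NormedAddCommGroup F] [NormedSpace ℝ F] [FiniteDimensional ℝ F]
  [NormedAddCommGroup F'] [NormedSpace ℝ F']

/-- Given a generalized inverse `B₀` of `A₀`, a generalized inverse of the linear maps near `A₀`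
of the same rank. -/
def nearInverse (A₀ : F →L[ℝ] F') (B₀ : F' →L[ℝ] F) (A : F →L[ℝ] F') : F' →L[ℝ] F :=
  Ring.inverse (1 + B₀ ∘L (A - A₀)) ∘L B₀

theorem contDiffAt_nearInverse (A₀ : F →L[ℝ] F') (B₀ : F' →L[ℝ] F) {A : F →L[ℝ] F'}
    (h : IsUnit (1 + B₀ ∘L (A - A₀))) : ContDiffAt ℝ ∞ (nearInverse A₀ B₀) A := by
  have : CompleteSpace F := FiniteDimensional.complete ℝ F
  obtain ⟨c, hc⟩ := h
  have h1 : ContDiffAt ℝ ∞ (fun A : F →L[ℝ] F' => 1 + B₀ ∘L (A - A₀)) A := by fun_prop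
  have h2 := contDiffAt_ringInverse (R := F →L[ℝ] F) ℝ (n := ∞) c
  rw [hc] at h2
  have h3 : ContDiffAt ℝ ∞ (fun A : F →L[ℝ] F' => Ring.inverse (1 + B₀ ∘L (A - A₀))) A :=
    ContDiffAt.comp (g := (Ring.inverse : (F →L[ℝ] F) → (F →L[ℝ] F))) A h2 h1
  exact h3.clm_comp contDiffAt_const

theorem eventually_isUnit_nearInverse (A₀ : F →L[ℝ] F') (B₀ : F' →L[ℝ] F) :
    ∀ᶠ A in 𝓝 A₀, IsUnit (1 + B₀ ∘L (A - A₀)) := by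
  have : CompleteSpace F := FiniteDimensional.complete ℝ F
  have h1 : Continuous (fun A : F →L[ℝ] F' => 1 + B₀ ∘L (A - A₀)) := by fun_prop
  refine h1.continuousAt (Units.isOpen.mem_nhds ?_)
  simp

/-- Let c = 1 + B₀(A − A₀) and B = c⁻¹B₀. One always has BAB = B, hence rank AB = rank B ≥ rank A₀.
If A has the same rank as A₀, then AB and A have the same range, and ABA = A follows because AB is
idempotent. Without the rank condition this conclusion fails. -/
theorem nearInverse_spec [FiniteDimensional ℝ F'] {A₀ : F →L[ℝ] F'} {B₀ : F' →L[ℝ] F}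
    (hA : ∀ v, A₀ (B₀ (A₀ v)) = A₀ v) (hB : ∀ w, B₀ (A₀ (B₀ w)) = B₀ w) {A : F →L[ℝ] F'}
    (hu : IsUnit (1 + B₀ ∘L (A - A₀)))
    (hr : Module.finrank ℝ A.range = Module.finrank ℝ A₀.range) (v : F) :
    A (nearInverse A₀ B₀ A (A v)) = A v := by
  obtain ⟨c, hc⟩ := hu
  set B := nearInverse A₀ B₀ A with hBdef
  have hB1 : ∀ w, B w = (c⁻¹ : (F →L[ℝ] F)ˣ).1 (B₀ w) := by
    intro w
    rw [hBdef, nearInverse, ← hc, Ring.inverse_unit]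
    rfl
  have hc1 : ∀ v, c.1 v = v + (B₀ (A v) - B₀ (A₀ v)) := by
    intro v; rw [hc]; simp
  have hcc : ∀ v, c.1 ((c⁻¹ : (F →L[ℝ] F)ˣ).1 v) = v := fun v => by
    have := congrArg (fun f : F →L[ℝ] F => f v) c.mul_inv
    exact this
  have hcc' : ∀ v, (c⁻¹ : (F →L[ℝ] F)ˣ).1 (c.1 v) = v := fun v => by
    have := congrArg (fun f : F →L[ℝ] F => f v) c.inv_mul
    exact this
  -- The equation c(Bw) = B₀w puts Bw in the range of B₀, where B₀A₀ is the identity.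
  have hB2 : ∀ w, B₀ (A₀ (B w)) = B w := by
    intro w
    have h1 := hc1 (B w)
    rw [hB1 w, hcc, ← hB1 w] at h1
    have h2 : B w = B₀ w - (B₀ (A (B w)) - B₀ (A₀ (B w))) := by rw [h1]; abel
    rw [h2]
    simp only [map_sub, hB]
  -- Since B₀A₀B = B, the definition of c reduces to cB = B₀AB.
  have hBA : ∀ w, B (A (B w)) = B w := by
    intro w
    have h1 : B₀ (A (B w)) = c.1 (B w) := by rw [hc1, hB2]; abel
    rw [hB1 (A (B w)), h1, hcc']
  have hrB : Module.finrank ℝ A₀.range ≤ Module.finrank ℝ B.range := by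
    have h1 : A₀.range = B.range.map (A₀.toLinearMap ∘ₗ c.1.toLinearMap) := by
      ext y
      constructor
      · rintro ⟨x, rfl⟩
        refine ⟨_, ⟨A₀ x, rfl⟩, ?_⟩
        change A₀ (c.1 (B (A₀ x))) = _
        rw [hB1, hcc]
        exact hA x
      · rintro ⟨x, -, rfl⟩
        exact ⟨_, rfl⟩
    rw [h1]
    exact Submodule.finrank_map_le _ _
  have hrAB : Module.finrank ℝ B.range ≤ Module.finrank ℝ (A.toLinearMap ∘ₗ B.toLinearMap).range := by
    have h1 : B.range = (A.toLinearMap ∘ₗ B.toLinearMap).range.map B.toLinearMap := by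
      ext y
      constructor
      · rintro ⟨x, rfl⟩
        exact ⟨_, ⟨x, rfl⟩, hBA x⟩
      · rintro ⟨x, -, rfl⟩
        exact ⟨_, rfl⟩
    conv_lhs => rw [h1]
    exact Submodule.finrank_map_le _ _
  have hle : (A.toLinearMap ∘ₗ B.toLinearMap).range ≤ A.range := by
    rintro _ ⟨x, rfl⟩
    exact ⟨_, rfl⟩
  have heq := Submodule.eq_of_le_of_finrank_le hle ((hr.trans_le hrB).trans hrAB)
  have hmem : A v ∈ (A.toLinearMap ∘ₗ B.toLinearMap).range := heq ▸ ⟨v, rfl⟩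
  obtain ⟨w, hw⟩ := hmem
  have hw' : A (B w) = A v := hw
  rw [← hw', hBA]

end GeneralizedInverse

/-! ### Global generalized inverses and global sections by partitions of unity. -/

namespace SmoothVectorBundle

variable {V W Z : SmoothVectorBundle.{u, v} m M}

theorem finsum_smul_eq_sum {ι A : Type*} [AddCommGroup A] [Module ℝ A]
    (f : SmoothPartitionOfUnity ι (𝓡 m) M Set.univ) (x : M) (a : ι → A) :
    ∑ᶠ i, f i x • a i = ∑ i ∈ (f.locallyFinite.point_finite x).toFinset, f i x • a i := by
  refine finsum_eq_sum_of_support_subset _ fun i hi => ?_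
  simp only [Set.Finite.coe_toFinset, Set.mem_ofPred_eq, Function.mem_support] at hi ⊢
  contrapose! hi
  rw [hi, zero_smul]

theorem homSmoothAt_finsum {ι : Type*} [IsManifold (𝓡 m) ∞ M]
    (f : SmoothPartitionOfUnity ι (𝓡 m) M Set.univ) (T : ι → ∀ x, V.Fib x →ₗ[ℝ] W.Fib x) {x₀ : M}
    (hT : ∀ i, x₀ ∈ tsupport (f i) → HomSmoothAt (T i) x₀) :
    HomSmoothAt (fun x => ∑ᶠ i, f i x • T i x) x₀ := by
  refine ContMDiffAt.congr_of_eventuallyEq (f.contMDiffAt_finsum (g := fun i => coord x₀ (T i))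
    hT) (Filter.Eventually.of_forall fun x => ?_)
  ext1 ξ
  dsimp only
  rw [coord_apply, finsum_smul_eq_sum, finsum_smul_eq_sum]
  simp [coord_apply]

theorem finrank_range_coord {x₀ x : M} (T : ∀ x, V.Fib x →ₗ[ℝ] W.Fib x)
    (hV : x ∈ (V.triv x₀).baseSet) (hW : x ∈ (W.triv x₀).baseSet) :
    Module.finrank ℝ (coord x₀ T x).range = Module.finrank ℝ (LinearMap.range (T x)) := by
  have h1 : (coord x₀ T x).range =
      (LinearMap.range (T x)).map ((W.triv x₀).linearEquivAt ℝ x hW).toLinearMap := by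
    ext y
    constructor
    · rintro ⟨ξ, rfl⟩
      exact ⟨_, ⟨_, rfl⟩, (linearMapAt_eq hW _).symm⟩
    · rintro ⟨_, ⟨v, rfl⟩, rfl⟩
      refine ⟨(V.triv x₀).linearMapAt ℝ x v, ?_⟩
      change coord x₀ T x _ = _
      rw [coord_apply, symmₗ_linearMapAt' hV, linearMapAt_eq hW]
      rfl
  rw [h1]
  exact LinearEquiv.finrank_map_eq _ _

theorem exists_local_generalizedInverse (T : ∀ x, V.Fib x →ₗ[ℝ] W.Fib x)
    (hT : ∀ x, HomSmoothAt T x) {r : ℕ} (hr : ∀ x, Module.finrank ℝ (LinearMap.range (T x)) = r)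
    (x₀ : M) : ∃ h : ∀ x, W.Fib x →ₗ[ℝ] V.Fib x,
      ∀ᶠ x in 𝓝 x₀, HomSmoothAt h x ∧ T x ∘ₗ h x ∘ₗ T x = T x := by
  obtain ⟨B₀, hA, hB⟩ := LinearMap.exists_generalizedInverse (coord x₀ T x₀).toLinearMap
  set A₀ := coord x₀ T x₀ with hA₀
  set B₁ := LinearMap.toContinuousLinearMap B₀ with hB₁
  have hA' : ∀ v, A₀ (B₁ (A₀ v)) = A₀ v := LinearMap.congr_fun hA
  have hB' : ∀ v, B₁ (A₀ (B₁ v)) = B₁ v := LinearMap.congr_fun hB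
  set N := nearInverse A₀ B₁ with hN
  refine ⟨fun x => (V.triv x₀).symmₗ ℝ x ∘ₗ (N (coord x₀ T x)).toLinearMap ∘ₗ
    (W.triv x₀).linearMapAt ℝ x, ?_⟩
  have hcont : ContinuousAt (coord x₀ T) x₀ := (hT x₀).continuousAt
  filter_upwards [(V.eventually_mem_triv (V.mem_triv x₀)).eventually_nhds,
    (W.eventually_mem_triv (W.mem_triv x₀)).eventually_nhds,
    hcont (eventually_isUnit_nearInverse A₀ B₁)] with x hV hW hu
  refine ⟨homSmoothAt_of_coord hW.self_of_nhds hV.self_of_nhds ?_, ?_⟩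
  · refine ContMDiffAt.congr_of_eventuallyEq (f := fun x => N (coord x₀ T x)) ?_ ?_
    · exact ContMDiffAt.comp (I' := 𝓘(ℝ, Eu V.rank →L[ℝ] Eu W.rank)) x
        (contDiffAt_nearInverse A₀ B₁ hu).contMDiffAt
        ((hT x).contMDiffAt_coord hV.self_of_nhds hW.self_of_nhds)
    · filter_upwards [hV, hW] with y hy hy'
      ext1 ξ
      rw [coord_apply]
      simp only [LinearMap.comp_apply, linearMapAt_symmₗ' hy', linearMapAt_symmₗ' hy]
      rfl
  · have h1 := nearInverse_spec hA' hB' hu (A := coord x₀ T x) (by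
      rw [finrank_range_coord T hV.self_of_nhds hW.self_of_nhds, hA₀,
        finrank_range_coord T (V.mem_triv _) (W.mem_triv _), hr, hr])
    ext v
    have h2 := congrArg ((W.triv x₀).symmₗ ℝ x) (h1 ((V.triv x₀).linearMapAt ℝ x v))
    rw [coord_apply, coord_apply, symmₗ_linearMapAt' hV.self_of_nhds,
      symmₗ_linearMapAt' hW.self_of_nhds, symmₗ_linearMapAt' hW.self_of_nhds] at h2
    exact h2

/-- The identity ThT = T is affine in h, so it survives the averaging of local solutions by a
partition of unity. The quadratic identity hTh = h would not; it is restored afterwards by an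
algebraic correction. -/
theorem exists_generalizedInverse [IsManifold (𝓡 m) ∞ M] [T2Space M] [SecondCountableTopology M]
    (T : ∀ x, V.Fib x →ₗ[ℝ] W.Fib x)
    (hT : ∀ x, HomSmoothAt T x) {r : ℕ} (hr : ∀ x, Module.finrank ℝ (LinearMap.range (T x)) = r) :
    ∃ h : ∀ x, W.Fib x →ₗ[ℝ] V.Fib x,
      (∀ x, HomSmoothAt h x) ∧ ∀ x, T x ∘ₗ h x ∘ₗ T x = T x := by
  have : LocallyCompactSpace M := ChartedSpace.locallyCompactSpace (Eu m) M
  choose h hh using exists_local_generalizedInverse T hT hr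
  obtain ⟨f, hf⟩ := SmoothPartitionOfUnity.exists_isSubordinate (𝓡 m) (s := Set.univ) isClosed_univ
    (fun x₀ => interior {x | HomSmoothAt (h x₀) x ∧ T x ∘ₗ h x₀ x ∘ₗ T x = T x})
    (fun _ => isOpen_interior)
    (fun x _ => Set.mem_iUnion.2 ⟨x, mem_interior_iff_mem_nhds.2 (hh x)⟩)
  refine ⟨fun x => ∑ᶠ i, f i x • h i x, fun x => homSmoothAt_finsum f h fun i hi =>
    (interior_subset (hf i hi)).1, fun x => ?_⟩
  have hsum : ∑ i ∈ (f.locallyFinite.point_finite x).toFinset, f i x = 1 := by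
    have h1 := finsum_smul_eq_sum f x (fun _ => (1 : ℝ))
    simp only [smul_eq_mul, mul_one] at h1
    rw [← h1, f.sum_eq_one (Set.mem_univ x)]
  ext v
  simp only [finsum_smul_eq_sum, LinearMap.comp_apply, LinearMap.sum_apply, LinearMap.smul_apply,
    map_sum, map_smul]
  conv_rhs => rw [← one_smul ℝ (T x v), ← hsum, Finset.sum_smul]
  refine Finset.sum_congr rfl fun i hi => ?_
  have hi' : x ∈ tsupport (f i) := subset_closure (by simpa using hi)
  exact congrArg _ (LinearMap.congr_fun (interior_subset (hf i hi')).2 v)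

/-- This turns identities between operators on sections into pointwise identities. The condition
imposed on a section is convex in each fibre: a single vector over `x₀`, no condition elsewhere. -/
theorem exists_section [IsManifold (𝓡 m) ∞ M] [T2Space M] [SecondCountableTopology M]
    (x₀ : M) (v : V.Fib x₀) :
    ∃ s : ∀ x, V.Fib x, ContMDiff (𝓡 m) ((𝓡 m).prod 𝓘(ℝ, Eu V.rank)) ∞
      (fun x => (⟨x, s x⟩ : TotalSpace (Eu V.rank) V.Fib)) ∧ s x₀ = v := by
  classical
  have : LocallyCompactSpace M := ChartedSpace.locallyCompactSpace (Eu m) M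
  obtain ⟨s, hs⟩ := exists_contMDiffSection_forall_mem_convex_of_local (n := ⊤) (𝓡 m)
    (F_fiber := Eu V.rank) V.Fib (fun x => {w | ∀ h : x = x₀, h ▸ w = v})
    (fun x => by
      by_cases h : x = x₀
      · subst h; simp
      · simpa [h] using convex_univ) (fun x₁ => by
      by_cases h : x₁ = x₀
      · subst h
        refine ⟨(V.triv x₁).baseSet, V.eventually_mem_triv (V.mem_triv x₁),
          fun x => (V.triv x₁).symmₗ ℝ x ((V.triv x₁).linearMapAt ℝ x₁ v), ?_, ?_⟩
        · have h3 := ((V.triv x₁).contMDiffOn_symm (IB := 𝓡 m) (n := ∞)).comp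
            (contMDiffOn_id.prodMk (contMDiffOn_const (c := (V.triv x₁).linearMapAt ℝ x₁ v)))
            (s := (V.triv x₁).baseSet)
            (fun z hz => (Trivialization.mem_target _).2 hz)
          exact h3.congr fun z hz => mk_symmₗ hz _
        · rintro y - rfl
          exact symmₗ_linearMapAt' (V.mem_triv _) v
      · refine ⟨{x₀}ᶜ, isOpen_compl_singleton.mem_nhds h, fun _ => 0, ?_, ?_⟩
        · exact (Bundle.contMDiff_zeroSection ℝ V.Fib).contMDiffOn
        · intro y hy hy'
          exact absurd hy' hy)
  exact ⟨s, s.contMDiff, hs x₀ rfl⟩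

end SmoothVectorBundle

/-! ### The image of a smooth projection of constant rank as a smooth vector bundle. -/

namespace SmoothVectorBundle

section Image

/-- Identify the range of C with ℝʳ, let a be its inclusion and b be C followed by the
identification; C is the identity on its range. -/
theorem exists_frame {F : Type*} [NormedAddCommGroup F] [NormedSpace ℝ F] [FiniteDimensional ℝ F]
    (C : F →L[ℝ] F) (hC : ∀ v, C (C v) = C v) {r : ℕ} (hr : Module.finrank ℝ C.range = r) :
    ∃ (a : Eu r →L[ℝ] F) (b : F →L[ℝ] Eu r), ∀ ξ, b (C (a ξ)) = ξ := by
  obtain ⟨φ⟩ : Nonempty (C.toLinearMap.range ≃ₗ[ℝ] Eu r) :=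
    FiniteDimensional.nonempty_linearEquiv_of_finrank_eq (by simpa using hr)
  refine ⟨LinearMap.toContinuousLinearMap (C.toLinearMap.range.subtype ∘ₗ φ.symm.toLinearMap),
    LinearMap.toContinuousLinearMap (φ.toLinearMap ∘ₗ C.toLinearMap.rangeRestrict), fun ξ => ?_⟩
  have h1 : C (C (φ.symm ξ).1) = (φ.symm ξ).1 := by
    obtain ⟨w, hw⟩ := (φ.symm ξ).2
    have hw' : C w = (φ.symm ξ).1 := hw
    rw [← hw', hC, hC]
  have h2 : C.toLinearMap.rangeRestrict (C (φ.symm ξ).1) = φ.symm ξ := Subtype.ext h1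
  change φ (C.toLinearMap.rangeRestrict (C (φ.symm ξ).1)) = ξ
  rw [h2, φ.apply_symm_apply]

/-- A smooth field of projections of constant rank `r` on the bundle `V`. -/
structure SmoothProjection (V : SmoothVectorBundle.{u, v} m M) (r : ℕ) where
  toFun : ∀ x, V.Fib x →ₗ[ℝ] V.Fib x
  smooth : ∀ x, HomSmoothAt toFun x
  idem : ∀ x v, toFun x (toFun x v) = toFun x v
  finrank_range : ∀ x, Module.finrank ℝ (LinearMap.range (toFun x)) = r

namespace SmoothProjection

variable {V : SmoothVectorBundle.{u, v} m M} {r : ℕ} (P : SmoothProjection V r)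

/-- The image of the projection at `x`. -/
abbrev Im (x : M) : Type v := LinearMap.range (P.toFun x)

instance (x : M) : TopologicalSpace (P.Im x) := instTopologicalSpaceSubtype

theorem coord_idem {x₀ x : M} (hx : x ∈ (V.triv x₀).baseSet) (ξ : Eu V.rank) :
    coord x₀ P.toFun x (coord x₀ P.toFun x ξ) = coord x₀ P.toFun x ξ := by
  rw [coord_apply x₀ P.toFun x (coord x₀ P.toFun x ξ), coord_apply, symmₗ_linearMapAt' hx, P.idem]

theorem exists_frame (x₀ : M) : ∃ (a : Eu r →L[ℝ] Eu V.rank) (b : Eu V.rank →L[ℝ] Eu r),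
    ∀ ξ, b (coord x₀ P.toFun x₀ (a ξ)) = ξ :=
  SmoothVectorBundle.exists_frame _ (P.coord_idem (V.mem_triv x₀))
    ((finrank_range_coord _ (V.mem_triv x₀) (V.mem_triv x₀)).trans (P.finrank_range x₀))

/-- A frame of the image of the projection at `x₀`. -/
def frame (x₀ : M) : Eu r →L[ℝ] Eu V.rank := (P.exists_frame x₀).choose

/-- A linear map which is inverse to the frame of the image at `x₀`. -/
def coframe (x₀ : M) : Eu V.rank →L[ℝ] Eu r := (P.exists_frame x₀).choose_spec.choose

theorem coframe_frame (x₀ : M) (ξ : Eu r) :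
    P.coframe x₀ (coord x₀ P.toFun x₀ (P.frame x₀ ξ)) = ξ :=
  (P.exists_frame x₀).choose_spec.choose_spec ξ

/-- The comparison of the image at `x` with the image at `x₀`. -/
def gram (x₀ x : M) : Eu r →L[ℝ] Eu r :=
  P.coframe x₀ ∘L coord x₀ P.toFun x ∘L P.frame x₀

/-- The set on which the image is trivialized by the frame at `x₀`. -/
def dom (x₀ : M) : Set M := (V.triv x₀).baseSet ∩ {x | IsUnit (P.gram x₀ x)}

theorem contMDiffAt_gram {x₀ x : M} (hx : x ∈ (V.triv x₀).baseSet) :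
    ContMDiffAt (𝓡 m) 𝓘(ℝ, Eu r →L[ℝ] Eu r) ∞ (P.gram x₀) x :=
  contMDiffAt_const.clm_comp
    (((P.smooth x).contMDiffAt_coord hx hx).clm_comp contMDiffAt_const)

theorem contMDiffAt_inverse_gram {x₀ x : M} (hx : x ∈ P.dom x₀) :
    ContMDiffAt (𝓡 m) 𝓘(ℝ, Eu r →L[ℝ] Eu r) ∞ (fun x => Ring.inverse (P.gram x₀ x)) x := by
  obtain ⟨hx, c, hc⟩ := hx
  have h2 := contDiffAt_ringInverse (R := Eu r →L[ℝ] Eu r) ℝ (n := ∞) c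
  rw [hc] at h2
  exact h2.contMDiffAt.comp x (P.contMDiffAt_gram hx)

theorem isOpen_dom (x₀ : M) : IsOpen (P.dom x₀) := by
  have h1 : ContinuousOn (P.gram x₀) (V.triv x₀).baseSet := fun x hx =>
    (P.contMDiffAt_gram hx).continuousAt.continuousWithinAt
  exact h1.isOpen_inter_preimage (V.triv x₀).open_baseSet Units.isOpen

theorem mem_dom (x₀ : M) : x₀ ∈ P.dom x₀ := by
  refine ⟨V.mem_triv x₀, ?_⟩
  have h1 : P.gram x₀ x₀ = 1 := by ext1 ξ; exact P.coframe_frame x₀ ξ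
  rw [Set.mem_ofPred_eq, h1]
  exact isUnit_one

/-- The section over the domain of the frame at `x₀` with given coordinates. -/
def lift (x₀ x : M) (ξ : Eu r) : P.Im x :=
  ⟨P.toFun x ((V.triv x₀).symmₗ ℝ x (P.frame x₀ (Ring.inverse (P.gram x₀ x) ξ))), _, rfl⟩

theorem gram_inverse {x₀ x : M} (hx : x ∈ P.dom x₀) (ξ : Eu r) :
    P.gram x₀ x (Ring.inverse (P.gram x₀ x) ξ) = ξ :=
  congrArg (fun f : Eu r →L[ℝ] Eu r => f ξ) (Ring.mul_inverse_cancel _ hx.2)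

theorem inverse_gram {x₀ x : M} (hx : x ∈ P.dom x₀) (ξ : Eu r) :
    Ring.inverse (P.gram x₀ x) (P.gram x₀ x ξ) = ξ :=
  congrArg (fun f : Eu r →L[ℝ] Eu r => f ξ) (Ring.inverse_mul_cancel _ hx.2)

theorem linearMapAt_lift {x₀ x : M} (ξ : Eu r) :
    (V.triv x₀).linearMapAt ℝ x (P.lift x₀ x ξ).1 =
      coord x₀ P.toFun x (P.frame x₀ (Ring.inverse (P.gram x₀ x) ξ)) := rfl

theorem coframe_lift {x₀ x : M} (hx : x ∈ P.dom x₀) (ξ : Eu r) :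
    P.coframe x₀ ((V.triv x₀).linearMapAt ℝ x (P.lift x₀ x ξ).1) = ξ := by
  rw [linearMapAt_lift]
  exact P.gram_inverse hx ξ

/-- Invertibility of `gram` makes the map C ∘ `frame` injective. Its range lies in the range of C
and has the same dimension r, so every vector of the image is C(`frame` η) for some η, and applying
`coframe` and the inverse of `gram` recovers η. -/
theorem lift_coframe {x₀ x : M} (hx : x ∈ P.dom x₀) (w : P.Im x) :
    P.lift x₀ x (P.coframe x₀ ((V.triv x₀).linearMapAt ℝ x w.1)) = w := by
  set C := coord x₀ P.toFun x with hC
  have hmem : (V.triv x₀).linearMapAt ℝ x w.1 ∈ C.range := by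
    obtain ⟨v, hv⟩ := w.2
    refine ⟨(V.triv x₀).linearMapAt ℝ x v, ?_⟩
    change coord x₀ P.toFun x _ = _
    rw [coord_apply, symmₗ_linearMapAt' hx.1, hv]
  have hle : (C.toLinearMap ∘ₗ (P.frame x₀).toLinearMap).range ≤ C.range :=
    LinearMap.range_comp_le_range _ _
  have hinj : Function.Injective (C.toLinearMap ∘ₗ (P.frame x₀).toLinearMap) := by
    intro ξ η h
    rw [← P.inverse_gram hx ξ, ← P.inverse_gram hx η]
    exact congrArg (fun ζ => Ring.inverse (P.gram x₀ x) (P.coframe x₀ ζ)) h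
  have heq := Submodule.eq_of_le_of_finrank_le hle (by
    rw [LinearMap.finrank_range_of_inj hinj, hC, finrank_range_coord _ hx.1 hx.1, P.finrank_range]
    simp)
  rw [← heq] at hmem
  obtain ⟨η, hη⟩ := hmem
  have hη' : C (P.frame x₀ η) = (V.triv x₀).linearMapAt ℝ x w.1 := hη
  have h1 : P.coframe x₀ ((V.triv x₀).linearMapAt ℝ x w.1) = P.gram x₀ x η := by
    rw [← hη']; rfl
  apply Subtype.ext
  have h2 : (V.triv x₀).linearMapAt ℝ x (P.lift x₀ x (P.gram x₀ x η)).1 =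
      (V.triv x₀).linearMapAt ℝ x w.1 := by
    rw [linearMapAt_lift, P.inverse_gram hx, ← hη']
  have h3 := congrArg ((V.triv x₀).symmₗ ℝ x) h2
  rw [symmₗ_linearMapAt' hx.1, symmₗ_linearMapAt' hx.1] at h3
  rw [h1, h3]

/-- The trivialization of the image defined by the frame at `x₀`. -/
def pretriv (x₀ : M) : Pretrivialization (Eu r) (π (Eu r) P.Im) where
  toFun w := (w.1, P.coframe x₀ ((V.triv x₀).linearMapAt ℝ w.1 w.2.1))
  invFun q := ⟨q.1, P.lift x₀ q.1 q.2⟩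
  source := (π (Eu r) P.Im) ⁻¹' P.dom x₀
  target := P.dom x₀ ×ˢ Set.univ
  map_source' _ hw := ⟨hw, trivial⟩
  map_target' _ hq := hq.1
  left_inv' := by
    rintro ⟨x, w⟩ hx
    exact congrArg (TotalSpace.mk x) (P.lift_coframe hx w)
  right_inv' := by
    rintro ⟨x, ξ⟩ ⟨hx, -⟩
    exact Prod.ext rfl (P.coframe_lift hx ξ)
  open_target := (P.isOpen_dom x₀).prod isOpen_univ
  baseSet := P.dom x₀
  open_baseSet := P.isOpen_dom x₀
  source_eq := rfl
  target_eq := rfl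
  proj_toFun _ _ := rfl

theorem pretriv_apply (x₀ x : M) (w : P.Im x) :
    (P.pretriv x₀ ⟨x, w⟩).2 = P.coframe x₀ ((V.triv x₀).linearMapAt ℝ x w.1) := rfl

/-- The transition function between the trivializations defined by two frames. -/
def trans (x₀ x₁ x : M) : Eu r →L[ℝ] Eu r :=
  P.coframe x₁ ∘L ((V.triv x₀).coordChangeL ℝ (V.triv x₁) x : Eu V.rank →L[ℝ] Eu V.rank) ∘L
    coord x₀ P.toFun x ∘L P.frame x₀ ∘L Ring.inverse (P.gram x₀ x)

theorem trans_apply {x₀ x₁ x : M} (h₀ : x ∈ P.dom x₀) (h₁ : x ∈ P.dom x₁) (ξ : Eu r) :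
    P.trans x₀ x₁ x ξ = (P.pretriv x₁ ⟨x, (P.pretriv x₀).symm x ξ⟩).2 := by
  rw [(P.pretriv x₀).mk_symm h₀]
  change _ = P.coframe x₁ ((V.triv x₁).linearMapAt ℝ x (P.lift x₀ x ξ).1)
  rw [← coordChangeL_linearMapAt h₀.1 h₁.1, linearMapAt_lift]
  rfl

theorem contMDiffOn_trans (x₀ x₁ : M) :
    ContMDiffOn (𝓡 m) 𝓘(ℝ, Eu r →L[ℝ] Eu r) ∞ (P.trans x₀ x₁) (P.dom x₀ ∩ P.dom x₁) :=
  fun x hx => ContMDiffAt.contMDiffWithinAt <|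
    contMDiffAt_const.clm_comp <| (contMDiffAt_coordChangeL hx.1.1 hx.2.1).clm_comp <|
      ((P.smooth x).contMDiffAt_coord hx.1.1 hx.1.1).clm_comp <|
        contMDiffAt_const.clm_comp (P.contMDiffAt_inverse_gram hx.1)

theorem isInducing_pretriv (x : M) :
    Topology.IsInducing (P.pretriv x ∘ (TotalSpace.mk x : P.Im x → TotalSpace (Eu r) P.Im)) := by
  refine (Function.LeftInverse.isEmbedding (f := fun q : M × Eu r => P.lift x x q.2)
    (fun w => P.lift_coframe (P.mem_dom x) w) ?_ ?_).isInducing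
  · refine Continuous.subtype_mk ?_ _
    -- The projection on the fibre is only known to be linear; rewriting it through its matrix
    -- `coord`, a continuous linear map, makes continuity visible.
    have h1 : ∀ q : M × Eu r, P.toFun x ((V.triv x).symmₗ ℝ x
        (P.frame x (Ring.inverse (P.gram x x) q.2))) = (V.triv x).symmL ℝ x
          (coord x P.toFun x (P.frame x (Ring.inverse (P.gram x x) q.2))) := fun q =>
      (symmₗ_linearMapAt' (V.mem_triv x) _).symm
    simp only [h1]
    fun_prop
  · exact continuous_const.prodMk ((P.coframe x).continuous.comp
      (((V.triv x).continuousLinearMapAt ℝ x).continuous.comp continuous_subtype_val))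

/-- The trivializations of the image form a vector prebundle. -/
def prebundle : VectorPrebundle ℝ (Eu r) P.Im where
  pretrivializationAtlas := Set.range P.pretriv
  pretrivialization_linear' := by
    rintro _ ⟨x₀, rfl⟩
    exact ⟨fun x _ => ⟨fun v w => by simp [pretriv_apply], fun c v => by simp [pretriv_apply]⟩⟩
  pretrivializationAt := P.pretriv
  mem_base_pretrivializationAt := P.mem_dom
  pretrivialization_mem_atlas x := ⟨x, rfl⟩
  exists_coordChange := by
    rintro _ ⟨x₀, rfl⟩ _ ⟨x₁, rfl⟩
    exact ⟨P.trans x₀ x₁, (P.contMDiffOn_trans x₀ x₁).continuousOn,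
      fun x hx ξ => P.trans_apply hx.1 hx.2 ξ⟩
  totalSpaceMk_isInducing := P.isInducing_pretriv

instance : P.prebundle.IsContMDiff (𝓡 m) ∞ where
  exists_contMDiffCoordChange := by
    rintro _ ⟨x₀, rfl⟩ _ ⟨x₁, rfl⟩
    exact ⟨P.trans x₀ x₁, P.contMDiffOn_trans x₀ x₁, fun x hx ξ => P.trans_apply hx.1 hx.2 ξ⟩

/-- The image of a smooth field of projections of constant rank, as a smooth vector bundle. -/
def image : SmoothVectorBundle.{u, v} m M :=
  letI := P.prebundle.totalSpaceTopology
  letI := P.prebundle.toFiberBundle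
  haveI := P.prebundle.toVectorBundle
  haveI := P.prebundle.contMDiffVectorBundle (IB := 𝓡 m) (n := ∞)
  { rank := r
    Fib := P.Im }

/-- The inclusion of the image. -/
def incl (x : M) : P.image.Fib x →ₗ[ℝ] V.Fib x := (LinearMap.range (P.toFun x)).subtype

/-- The projection onto the image. -/
def proj (x : M) : V.Fib x →ₗ[ℝ] P.image.Fib x := (P.toFun x).rangeRestrict

theorem incl_proj (x : M) (v : V.Fib x) : P.incl x (P.proj x v) = P.toFun x v := rfl

theorem incl_injective (x : M) : Function.Injective (P.incl x) := Subtype.val_injective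

theorem proj_incl (x : M) (w : P.image.Fib x) : P.proj x (P.incl x w) = w := by
  apply P.incl_injective
  obtain ⟨v, hv⟩ := w.2
  have hv' : P.toFun x v = P.incl x w := hv
  rw [incl_proj, ← hv', P.idem]

theorem image_triv_apply {x₀ x : M} (w : P.image.Fib x) :
    (P.image.triv x₀ ⟨x, w⟩).2 =
      P.coframe x₀ ((V.triv x₀).linearMapAt ℝ x (P.incl x w)) := rfl

theorem coe_lift_coframe {x₀ x : M} (hx : x ∈ P.dom x₀) (w : P.image.Fib x) :
    (P.lift x₀ x (P.coframe x₀ ((V.triv x₀).linearMapAt ℝ x (P.incl x w)))).1 = P.incl x w :=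
  congrArg Subtype.val (P.lift_coframe hx w)

variable {F H N : Type*} [NormedAddCommGroup F] [NormedSpace ℝ F] [TopologicalSpace H]
  {I : ModelWithCorners ℝ F H} [TopologicalSpace N] [ChartedSpace H N]

/-- The smooth structure of the image is the one induced from `V`: the coordinates of a vector in
the two bundles are obtained from each other by matrices that depend smoothly on the base point,
`coframe` in one direction and C ∘ `frame` ∘ `gram`⁻¹ in the other. -/
theorem contMDiffWithinAt_incl_iff {b : N → M} {w : ∀ z, P.image.Fib (b z)} {s : Set N} {z₀ : N} :
    ContMDiffWithinAt I ((𝓡 m).prod 𝓘(ℝ, Eu V.rank)) ∞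
      (fun z => (⟨b z, P.incl (b z) (w z)⟩ : TotalSpace (Eu V.rank) V.Fib)) s z₀ ↔
    ContMDiffWithinAt I ((𝓡 m).prod 𝓘(ℝ, Eu P.image.rank)) ∞
      (fun z => (⟨b z, w z⟩ : TotalSpace (Eu P.image.rank) P.image.Fib)) s z₀ := by
  rw [Bundle.contMDiffWithinAt_totalSpace, Bundle.contMDiffWithinAt_totalSpace]
  refine and_congr_right fun hb => ?_
  dsimp only at hb
  have hdom : ∀ᶠ z in 𝓝[s] z₀, b z ∈ P.dom (b z₀) :=
    hb.continuousWithinAt ((P.isOpen_dom _).mem_nhds (P.mem_dom _))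
  constructor
  · intro h
    have key : ∀ z, b z ∈ P.dom (b z₀) → (P.image.triv (b z₀) ⟨b z, w z⟩).2 =
        P.coframe (b z₀) (V.triv (b z₀) ⟨b z, P.incl (b z) (w z)⟩).2 := fun z hz => by
      rw [image_triv_apply, linearMapAt_eq hz.1]
    refine ContMDiffWithinAt.congr_of_eventuallyEq ?_ (hdom.mono key) (key _ (P.mem_dom _))
    exact (contMDiffWithinAt_const (c := P.coframe (b z₀))).clm_apply h
  · intro h
    have key : ∀ z, b z ∈ P.dom (b z₀) →
        (V.triv (b z₀) ⟨b z, P.incl (b z) (w z)⟩).2 =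
        coord (b z₀) P.toFun (b z) (P.frame (b z₀) (Ring.inverse (P.gram (b z₀) (b z))
          (P.image.triv (b z₀) ⟨b z, w z⟩).2)) := fun z hz => by
      rw [image_triv_apply, ← linearMapAt_lift, P.coe_lift_coframe hz, linearMapAt_eq hz.1]
    refine ContMDiffWithinAt.congr_of_eventuallyEq ?_ (hdom.mono key) (key _ (P.mem_dom _))
    exact (ContMDiffAt.comp_contMDiffWithinAt z₀ (P.smooth (b z₀)) hb).clm_apply
      ((contMDiffWithinAt_const (c := P.frame (b z₀))).clm_apply
        ((ContMDiffAt.comp_contMDiffWithinAt z₀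
          (P.contMDiffAt_inverse_gram (P.mem_dom (b z₀))) hb).clm_apply h))

theorem smoothAlong_incl_iff {n : ℕ} {b : Eu n → M} {w : ∀ z, P.image.Fib (b z)} :
    V.SmoothAlong b (fun z => P.incl (b z) (w z)) ↔ P.image.SmoothAlong b w := by
  refine forall_congr' fun z => ?_
  rw [← contMDiffWithinAt_univ, ← contMDiffWithinAt_univ]
  exact P.contMDiffWithinAt_incl_iff

theorem smoothAlong_proj {n : ℕ} {b : Eu n → M} {w : ∀ z, V.Fib (b z)} (hw : V.SmoothAlong b w) :
    P.image.SmoothAlong b (fun z => P.proj (b z) (w z)) :=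
  P.smoothAlong_incl_iff.1 (smoothAlong_of_homSmooth P.smooth hw)

end SmoothProjection

end Image

end SmoothVectorBundle

/-! ### The operators η ↦ ∑ Tₖ ⋆ η and their composition. -/

section Operators

variable {G : LieGroupoid m d M G₁} {E F K : GradedBundle.{u, v} m M}

/-- All cochains with values in `E`, in all bidegrees. -/
abbrev Cochains (G : LieGroupoid m d M G₁) (E : GradedBundle.{u, v} m M) : Type (max u v) :=
  ∀ (k : ℕ) (l : ℤ), Cochain G k (E.deg l)

namespace Cochains

/-- The part of total degree `n`. -/
def res (n : ℤ) : Cochains G E →ₗ[ℝ] Tot G E n where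
  toFun η i := η i.1.1 i.1.2
  map_add' _ _ := rfl
  map_smul' _ _ := rfl

/-- Extension by zero. -/
def ext (n : ℤ) : Tot G E n →ₗ[ℝ] Cochains G E where
  toFun η k l := if h : (k : ℤ) + l = n then η ⟨(k, l), h⟩ else 0
  map_add' η ζ := by
    funext k l
    by_cases h : (k : ℤ) + l = n <;> simp [h]
  map_smul' a η := by
    funext k l
    by_cases h : (k : ℤ) + l = n <;> simp [h]

@[simp] theorem res_ext (n : ℤ) (η : Tot G E n) : res n (ext n η) = η := by
  funext i
  exact dif_pos i.2

end Cochains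

/-- Nested substrings such as `back` of `back` agree only up to propositional equality of their
endpoints. The fibre in which a cochain takes its value depends on the target alone, so sources may
differ here without a cast. -/
theorem cochain_congr {k : ℕ} {V : M → Type*} (η : ∀ x y : M, G.Str k x y → V x) {x y y' : M}
    (g : G.Str k x y) (g' : G.Str k x y') (hp : ∀ i, g.pt i = g'.pt i)
    (ha : ∀ i, g.arr i = g'.arr i) : η x y g = η x y' g' := by
  obtain rfl : y = y' := by rw [← g.pt_last, ← g'.pt_last, hp]
  obtain rfl : g = g' := by ext i; exacts [hp i, ha i]
  rfl

theorem scochain_congr {k : ℕ} {A : Type*} (f : ∀ x y : M, G.Str k x y → A) {x y x' y' : M}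
    (g : G.Str k x y) (g' : G.Str k x' y') (hp : ∀ i, g.pt i = g'.pt i)
    (ha : ∀ i, g.arr i = g'.arr i) : f x y g = f x' y' g' := by
  obtain rfl : x = x' := by rw [← g.pt_zero, ← g'.pt_zero, hp]
  exact cochain_congr f g g' hp ha

theorem neg_one_zpow_congr {a b : ℤ} (h : Even (a - b)) : (-1 : ℝ) ^ a = (-1 : ℝ) ^ b := by
  have h1 : a = (a - b) + b := by ring
  rw [h1, zpow_add₀ (by norm_num), h.neg_one_zpow, one_mul]

theorem SmoothVectorBundle.SmoothAlong.add {V : SmoothVectorBundle.{u, v} m M} {n : ℕ}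
    {b : Eu n → M} (hb : ContMDiff (𝓡 n) (𝓡 m) ∞ b) {v w : ∀ z, V.Fib (b z)}
    (hv : V.SmoothAlong b v) (hw : V.SmoothAlong b w) : V.SmoothAlong b (fun z => v z + w z) := by
  have h := smul_add hb (contMDiff_const (c := (1 : ℝ))) hv hw
  simp only [one_smul] at h
  exact h

theorem SmoothVectorBundle.SmoothAlong.smul {V : SmoothVectorBundle.{u, v} m M} {n : ℕ}
    {b : Eu n → M} (hb : ContMDiff (𝓡 n) (𝓡 m) ∞ b) {v : ∀ z, V.Fib (b z)} (a : ℝ)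
    (hv : V.SmoothAlong b v) : V.SmoothAlong b (fun z => a • v z) := by
  have h := smul_add hb (contMDiff_const (c := a)) hv (V.smoothAlong_zero hb)
  simp only [add_zero] at h
  exact h

theorem SmoothVectorBundle.SmoothAlong.sum {V : SmoothVectorBundle.{u, v} m M} {n : ℕ}
    {b : Eu n → M} (hb : ContMDiff (𝓡 n) (𝓡 m) ∞ b) {ι : Type*} (s : Finset ι)
    {v : ι → ∀ z, V.Fib (b z)} (hv : ∀ i ∈ s, V.SmoothAlong b (v i)) :
    V.SmoothAlong b (fun z => ∑ i ∈ s, v i z) := by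
  classical
  induction s using Finset.induction_on with
  | empty => simpa using V.smoothAlong_zero hb
  | insert a s ha ih =>
    simp only [Finset.sum_insert ha]
    exact add hb (hv a (Finset.mem_insert_self _ _))
      (ih fun i hi => hv i (Finset.mem_insert_of_mem hi))

theorem SmoothVectorBundle.SmoothAlong.contMDiff_base {V : SmoothVectorBundle.{u, v} m M} {n : ℕ}
    {b : Eu n → M} {v : ∀ z, V.Fib (b z)} (hv : V.SmoothAlong b v) :
    ContMDiff (𝓡 n) (𝓡 m) ∞ b := fun z =>
  (Bundle.contMDiffAt_totalSpace.1 (hv z)).1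

/-- The smooth sections of the bundles `Hom(s^* E^l, t^* F^{l + e - k})` over the strings of
length `k`, for all `k`. -/
def homSeries (G : LieGroupoid m d M G₁) (E F : GradedBundle.{u, v} m M) (e : ℤ) :
    Submodule ℝ (∀ (k : ℕ) (i : {i : ℤ × ℤ // i.1 + (e - k) = i.2}) (x y : M), G.Str k x y →
      (E.deg i.1.1).Fib y →ₗ[ℝ] (F.deg i.1.2).Fib x) where
  carrier := {T | ∀ k, HomCochain.IsSmooth (fun l l' h x y g => T k ⟨(l, l'), h⟩ x y g :
    HomCochain G E F k (e - k))}
  add_mem' hS hT k l l' h n x y c w hc hw :=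
    (hS k l l' h n x y c w hc hw).add hc.smooth_tgt (hT k l l' h n x y c w hc hw)
  zero_mem' _ _ l' _ _ _ _ _ _ hc _ := (F.deg l').smoothAlong_zero hc.smooth_tgt
  smul_mem' a _ hT k l l' h n x y c w hc hw :=
    (hT k l l' h n x y c w hc hw).smul hc.smooth_tgt a

/-- The smooth sections of the bundles `Hom(s^* E^l, t^* F^{l + e - k})` over the strings of
length `k`, for all `k`. -/
def HomSeries (G : LieGroupoid m d M G₁) (E F : GradedBundle.{u, v} m M) (e : ℤ) :
    Type (max u v) :=
  homSeries G E F e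

instance (e : ℤ) : AddCommGroup (HomSeries G E F e) :=
  inferInstanceAs (AddCommGroup (homSeries G E F e))

instance (e : ℤ) : Module ℝ (HomSeries G E F e) :=
  inferInstanceAs (Module ℝ (homSeries G E F e))

/-- The components of a series of sections of homomorphism bundles. -/
def HomSeries.fn {e : ℤ} (T : HomSeries G E F e) (k : ℕ) : HomCochain G E F k (e - k) :=
  fun l l' h x y g => T.1 k ⟨(l, l'), h⟩ x y g

/-- A family of smooth sections of homomorphism bundles, as a series. -/
def HomSeries.mk {e : ℤ} (T : ∀ k : ℕ, HomCochain G E F k (e - k)) (hT : ∀ k, (T k).IsSmooth) :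
    HomSeries G E F e :=
  ⟨fun k i _ _ g => T k i.1.1 i.1.2 i.2 g, hT⟩

theorem HomSeries.isSmooth {e : ℤ} (T : HomSeries G E F e) (k : ℕ) : (T.fn k).IsSmooth := T.2 k

theorem HomSeries.add_apply {e : ℤ} (S T : HomSeries G E F e) (k : ℕ) (l l' : ℤ)
    (h : l + (e - k) = l') {x y : M} (g : G.Str k x y) :
    (S + T).fn k l l' h g = S.fn k l l' h g + T.fn k l l' h g := rfl

theorem isSmooth_starSum {e : ℤ} (T : HomSeries G E F e) {n : ℤ} (η : Tot G E n) (j : ℕ) (l' : ℤ)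
    (h : (j : ℤ) + l' = n + e) :
    (fun _ _ g => starSum T.fn η j l' h g : RawCochain G j (F.deg l')) ∈ Cochain G j (F.deg l') := by
  intro n x y c hc
  refine SmoothVectorBundle.SmoothAlong.sum hc.smooth_tgt _ fun k _ => ?_
  exact (T.isSmooth _ _ _ _ _ _ _ _ _ (hc.front _ _) ((Tot.component η _ _ _).2 _ _ _ _
    (hc.back _ _ _))).smul hc.smooth_tgt _

section Linear

variable {e n : ℤ} (S T : HomSeries G E F e) (η ζ : Tot G E n) (a : ℝ) (j : ℕ) (l' : ℤ)
  (h : (j : ℤ) + l' = n + e) {x y : M} (g : G.Str j x y)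

theorem starSum_add : starSum T.fn (η + ζ) j l' h g =
    starSum T.fn η j l' h g + starSum T.fn ζ j l' h g := by
  rw [starSum, starSum, starSum, ← Finset.sum_add_distrib]
  refine Finset.sum_congr rfl fun k _ => ?_
  rw [← smul_add, ← map_add]
  rfl

theorem starSum_smul : starSum T.fn (a • η) j l' h g = a • starSum T.fn η j l' h g := by
  rw [starSum, starSum, Finset.smul_sum]
  refine Finset.sum_congr rfl fun k _ => ?_
  rw [smul_comm a]
  congr 1
  exact map_smul _ a _

theorem add_starSum : starSum (S + T).fn η j l' h g =
    starSum S.fn η j l' h g + starSum T.fn η j l' h g := by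
  rw [starSum, starSum, starSum, ← Finset.sum_add_distrib]
  refine Finset.sum_congr rfl fun k _ => ?_
  rw [← smul_add]
  rfl

theorem smul_starSum : starSum (a • T).fn η j l' h g = a • starSum T.fn η j l' h g := by
  rw [starSum, starSum, Finset.smul_sum]
  refine Finset.sum_congr rfl fun k _ => ?_
  rw [smul_comm a]
  rfl

end Linear

/-- The operator `η ↦ ∑ₖ Tₖ ⋆ η` in a given total degree. -/
def starTot {e : ℤ} (T : HomSeries G E F e) (n n' : ℤ) (h : n + e = n') :
    Tot G E n →ₗ[ℝ] Tot G F n' where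
  toFun η i := ⟨fun _ _ g => starSum T.fn η i.1.1 i.1.2 (i.2.trans h.symm) g,
    isSmooth_starSum T η _ _ _⟩
  map_add' η ζ := by
    funext i
    apply Subtype.ext
    funext x y g
    exact starSum_add T η ζ _ _ (i.2.trans h.symm) g
  map_smul' a η := by
    funext i
    apply Subtype.ext
    funext x y g
    exact starSum_smul T η a _ _ (i.2.trans h.symm) g

/-- The operator `η ↦ ∑ₖ Tₖ ⋆ η`. -/
def star {e : ℤ} : HomSeries G E F e →ₗ[ℝ] Cochains G E →ₗ[ℝ] Cochains G F where
  toFun T :=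
    { toFun := fun η j l => starTot T (j + l - e) (j + l) (by ring) (Cochains.res _ η) ⟨(j, l), rfl⟩
      map_add' := fun η ζ => by
        funext j l
        rw [map_add, map_add]
        rfl
      map_smul' := fun a η => by
        funext j l
        rw [map_smul, map_smul]
        rfl }
  map_add' S T := by
    refine LinearMap.ext fun η => ?_
    funext j l
    apply Subtype.ext
    funext x y g
    exact add_starSum S T (Cochains.res (j + l - e) η) j l (by ring) g
  map_smul' a T := by
    refine LinearMap.ext fun η => ?_
    funext j l
    apply Subtype.ext
    funext x y g
    exact smul_starSum T (Cochains.res (j + l - e) η) a j l (by ring) g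

theorem starTot_res {e : ℤ} (T : HomSeries G E F e) (n n' : ℤ) (h : n + e = n')
    (η : Cochains G E) : starTot T n n' h (Cochains.res n η) = Cochains.res n' (star T η) := by
  obtain rfl : n = n' - e := by omega
  funext i
  obtain ⟨⟨j, l⟩, rfl⟩ := i
  rfl

/-- The summand `Tₖ ⋆ η` of `∑ₖ Tₖ ⋆ η`, where `q` is the degree of `η`. -/
def starTerm {e : ℤ} (T : HomSeries G E F e) (η : Cochains G E) {j : ℕ} {l' : ℤ} {x y : M}
    (g : G.Str j x y) (k q : ℕ) (hk : k + q = j) (l : ℤ) (hl : l + (e - k) = l') :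
    (F.deg l').Fib x :=
  (-1 : ℝ) ^ ((k : ℤ) * (q + l)) • T.fn k l l' hl (g.front k (by omega))
    ((η q l).1 _ _ (g.back k q hk))

theorem starTerm_congr {e : ℤ} (T : HomSeries G E F e) (η : Cochains G E) {j : ℕ} {l' : ℤ}
    {x y : M} (g : G.Str j x y) (k q q' : ℕ) (hk : k + q = j) (hk' : k + q' = j) (l l₁ : ℤ)
    (hl : l + (e - k) = l') (hl₁ : l₁ + (e - k) = l') :
    starTerm T η g k q hk l hl = starTerm T η g k q' hk' l₁ hl₁ := by
  obtain rfl : q = q' := by omega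
  obtain rfl : l = l₁ := by omega
  rfl

theorem star_apply {e : ℤ} (T : HomSeries G E F e) (η : Cochains G E) {j : ℕ} {l' : ℤ} {x y : M}
    (g : G.Str j x y) :
    (star T η j l').1 x y g = ∑ k : Fin (j + 1),
      starTerm T η g k (j - k) (by have := k.2; omega) (l' - (e - (k : ℕ))) (by ring) := by
  change starSum T.fn (Cochains.res (j + l' - e) η) j l' (by ring) g = _
  rw [starSum]
  refine Finset.sum_congr rfl fun k _ => ?_
  have h1 : (j : ℤ) + l' - e - ((j - k : ℕ) : ℤ) = l' - (e - (k : ℕ)) := by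
    have := k.2; omega
  rw [starTerm_congr T η g k (j - k) (j - k) _ (by have := k.2; omega) _
    ((j : ℤ) + l' - e - ((j - k : ℕ) : ℤ)) _ (by rw [h1]; ring), starTerm]
  congr 2
  ring

/-- The value of a composition of a section over strings of length `a` with a section over strings
of length `b` and a cochain. -/
def compTerm {e₁ e₂ : ℤ} (S : HomSeries G F K e₁) (T : HomSeries G E F e₂) (η : Cochains G E)
    {j : ℕ} {l'' : ℤ} {x y : M} (g : G.Str j x y) (a b k q : ℕ) (hk : a + b = k) (hq : k + q = j)
    (l l' : ℤ) (hl : l + (e₂ - b) = l') (hl' : l' + (e₁ - a) = l'') : (K.deg l'').Fib x :=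
  S.fn a l' l'' hl' (g.front a (by omega)) (T.fn b l l' hl
    ((g.front k (by omega)).back a b hk) ((η q l).1 _ _ (g.back k q hq)))

theorem compTerm_congr {e₁ e₂ : ℤ} (S : HomSeries G F K e₁) (T : HomSeries G E F e₂)
    (η : Cochains G E) {j : ℕ} {l'' : ℤ} {x y : M} (g : G.Str j x y) (a b k q : ℕ)
    (hk : a + b = k) (hq : k + q = j) (l l' : ℤ) (hl : l + (e₂ - b) = l')
    (hl' : l' + (e₁ - a) = l'') (b₁ k₁ q₁ : ℕ)
    (hk₁ : a + b₁ = k₁) (hq₁ : k₁ + q₁ = j) (l₁ l₁' : ℤ) (hl₁ : l₁ + (e₂ - b₁) = l₁')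
    (hl₁' : l₁' + (e₁ - a) = l'') (hb : b = b₁) :
    compTerm S T η g a b k q hk hq l l' hl hl' =
      compTerm S T η g a b₁ k₁ q₁ hk₁ hq₁ l₁ l₁' hl₁ hl₁' := by
  subst hb
  obtain rfl : k = k₁ := by omega
  obtain rfl : q = q₁ := by omega
  obtain rfl : l' = l₁' := by omega
  obtain rfl : l = l₁ := by omega
  rfl

/-- The composition of two series of sections of homomorphism bundles. -/
def HomSeries.comp {e₁ e₂ : ℤ} (S : HomSeries G F K e₁) (T : HomSeries G E F e₂) (e : ℤ)
    (he : e₁ + e₂ = e) : HomSeries G E K e :=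
  HomSeries.mk (fun k l l'' h x y g => ∑ a : Fin (k + 1), (-1 : ℝ) ^ (((a : ℕ) : ℤ) * e₂) •
    (S.fn a (l + (e₂ - ((k - a : ℕ) : ℤ))) l'' (by have := a.2; omega) (g.front a (by omega)) ∘ₗ
      T.fn (k - a) l _ rfl (g.back a (k - a) (by omega)))) <| by
    intro k l l' h n x y c w hc hw
    simp only [LinearMap.sum_apply, LinearMap.smul_apply]
    refine SmoothVectorBundle.SmoothAlong.sum hc.smooth_tgt _ fun a _ => ?_
    exact (S.isSmooth _ _ _ _ _ _ _ _ _ (hc.front _ _)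
      (T.isSmooth _ _ _ _ _ _ _ _ _ (hc.back _ _ _) hw)).smul hc.smooth_tgt _

theorem HomSeries.comp_apply {e₁ e₂ : ℤ} (S : HomSeries G F K e₁) (T : HomSeries G E F e₂) (e : ℤ)
    (he : e₁ + e₂ = e) (k : ℕ) (l l'' : ℤ) (h : l + (e - k) = l'') {x y : M} (g : G.Str k x y) :
    (S.comp T e he).fn k l l'' h g = ∑ a : Fin (k + 1), (-1 : ℝ) ^ (((a : ℕ) : ℤ) * e₂) •
    (S.fn a (l + (e₂ - ((k - a : ℕ) : ℤ))) l'' (by have := a.2; omega) (g.front a (by omega)) ∘ₗ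
      T.fn (k - a) l _ rfl (g.back a (k - a) (by omega))) := rfl

/-- Both sides are sums over the splittings of a string into pieces of lengths a, b and the rest.
The sign (-1)^(a e₂) in `HomSeries.comp` accounts for the total degree of T ⋆ η exceeding that of η
by e₂. -/
theorem star_comp {e₁ e₂ : ℤ} (S : HomSeries G F K e₁) (T : HomSeries G E F e₂) (e : ℤ)
    (he : e₁ + e₂ = e) (η : Cochains G E) : star (S.comp T e he) η = star S (star T η) := by
  funext j l''
  apply Subtype.ext
  funext x y g
  -- The common summand; j + l'' − e is the total degree of the part of η that contributes. The
  -- value 0 is never reached in the two sums, which only meet a + b ≤ j.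
  set Y : ℕ → ℕ → (K.deg l'').Fib x := fun a b => if h : a + b ≤ j then
    (-1 : ℝ) ^ ((a : ℤ) * e₂ + (a + b) * (j + l'' - e)) •
    compTerm S T η g a b (a + b) (j - (a + b)) rfl (by omega)
      (l'' - (e₁ - a) - (e₂ - b)) (l'' - (e₁ - a)) (by ring) (by ring) else 0 with hY
  have h1 := Finset.sum_range_diag_flip (j + 1) Y
  rw [star_apply, star_apply]
  rw [← Fin.sum_univ_eq_sum_range (fun k => ∑ a ∈ Finset.range (k + 1), Y a (k - a)),
    ← Fin.sum_univ_eq_sum_range (fun a => ∑ b ∈ Finset.range (j + 1 - a), Y a b)] at h1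
  refine Eq.trans (Finset.sum_congr rfl fun k _ => ?_)
    (h1.trans (Finset.sum_congr rfl fun a _ => ?_))
  · have hk := k.2
    rw [starTerm, HomSeries.comp_apply, LinearMap.sum_apply, Finset.smul_sum,
      ← Fin.sum_univ_eq_sum_range (fun a => Y a (k - a))]
    refine Finset.sum_congr rfl fun a _ => ?_
    have ha := a.2
    rw [hY]
    dsimp only
    rw [dif_pos (by omega), LinearMap.smul_apply, smul_smul, ← zpow_add₀ (by norm_num)]
    congr 1
    · apply neg_one_zpow_congr
      have h2 : ((j - k : ℕ) : ℤ) = (j : ℤ) - (k : ℕ) := by omega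
      have h3 : ((k - a : ℕ) : ℤ) = ((k : ℕ) : ℤ) - (a : ℕ) := by omega
      rw [h2, h3]
      ring_nf
      exact Even.zero
    · exact compTerm_congr S T η g a (k - a) k (j - k) (by omega) (by omega) _ _ rfl
        (by subst he; omega) _ _ _ _ _ _ _ _ _ rfl
  · have ha := a.2
    rw [starTerm]
    have h2 : j + 1 - (a : ℕ) = (j - a) + 1 := by omega
    rw [star_apply, h2, ← Fin.sum_univ_eq_sum_range (fun b => Y a b), map_sum, Finset.smul_sum]
    refine Finset.sum_congr rfl fun b _ => ?_
    have hb := b.2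
    rw [hY]
    dsimp only
    rw [dif_pos (by omega), starTerm, map_smul, smul_smul, ← zpow_add₀ (by norm_num)]
    congr 1
    · apply neg_one_zpow_congr
      have h2 : ((j - a : ℕ) : ℤ) = (j : ℤ) - (a : ℕ) := by omega
      have h3 : ((j - a - b : ℕ) : ℤ) = (j : ℤ) - (a : ℕ) - (b : ℕ) := by omega
      rw [h2, h3, ← he]
      ring_nf
      exact Even.zero
    · refine Eq.trans (compTerm_congr S T η g a b (a + b) (j - (a + b)) rfl (by omega)
        (l'' - (e₁ - a) - (e₂ - b)) (l'' - (e₁ - a)) (by ring) (by ring)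
        b (a + b) (j - a - b) rfl (by omega) (l'' - (e₁ - a) - (e₂ - b)) (l'' - (e₁ - a)) (by ring)
        (by ring) rfl) ?_
      rw [compTerm]
      congr 2
      refine cochain_congr (V := fun x => (E.deg _).Fib x) _ _ _ (fun i => ?_) (fun i => ?_)
      · exact congrArg g.pt (Fin.ext (Nat.add_assoc _ _ _))
      · exact congrArg g.arr (Fin.ext (Nat.add_assoc _ _ _))

end Operators

/-! ### The operator D̂₀ on all bidegrees. -/

section HatD

variable {G : LieGroupoid m d M G₁} {E F K : GradedBundle.{u, v} m M}

/-- The operator `D̂₀`. -/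
def hatD : Cochains G E →ₗ[ℝ] Cochains G E where
  toFun η j l := ⟨fun _ _ g => hatDiff (Cochains.res (j + l - 1) η) j l (by ring) g, by
    intro n x y c hc
    cases j with
    | zero => exact (E.deg l).smoothAlong_zero hc.smooth_tgt
    | succ k =>
      refine ((SmoothVectorBundle.SmoothAlong.sum hc.smooth_tgt _ fun i _ =>
        ((η k l).2 _ _ _ _ (hc.inner i)).smul hc.smooth_tgt _).add hc.smooth_tgt
        (((η k l).2 _ _ _ _ (hc.front k (by omega))).smul hc.smooth_tgt _)).smul hc.smooth_tgt _⟩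
  map_add' η ζ := by
    funext j l
    apply Subtype.ext
    funext x y g
    cases j with
    | zero => exact (add_zero (0 : (E.deg l).Fib x)).symm
    | succ k =>
      change (-1 : ℝ) ^ (((k + 1 : ℕ) : ℤ) + l - 1) • (∑ i : Fin k, (-1 : ℝ) ^ ((i : ℕ) + 1) •
          ((η k l).1 _ _ (g.inner i) + (ζ k l).1 _ _ (g.inner i)) + (-1 : ℝ) ^ (k + 1) •
          ((η k l).1 _ _ (g.front k (by omega)) + (ζ k l).1 _ _ (g.front k (by omega)))) =
        (-1 : ℝ) ^ (((k + 1 : ℕ) : ℤ) + l - 1) • (_ + _) +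
        (-1 : ℝ) ^ (((k + 1 : ℕ) : ℤ) + l - 1) • (_ + _)
      simp only [smul_add, Finset.sum_add_distrib]
      exact add_add_add_comm _ _ _ _
  map_smul' a η := by
    funext j l
    apply Subtype.ext
    funext x y g
    cases j with
    | zero => exact (smul_zero a).symm
    | succ k =>
      change (-1 : ℝ) ^ (((k + 1 : ℕ) : ℤ) + l - 1) • (∑ i : Fin k, (-1 : ℝ) ^ ((i : ℕ) + 1) •
          (a • (η k l).1 _ _ (g.inner i)) + (-1 : ℝ) ^ (k + 1) •
          (a • (η k l).1 _ _ (g.front k (by omega)))) =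
        a • (-1 : ℝ) ^ (((k + 1 : ℕ) : ℤ) + l - 1) • (_ + _)
      simp only [smul_add, Finset.smul_sum, smul_comm a]
      rfl

theorem hatD_zero (η : Cochains G E) (l : ℤ) {x y : M} (g : G.Str 0 x y) :
    (hatD η 0 l).1 x y g = 0 := rfl

theorem hatD_succ (η : Cochains G E) (k : ℕ) (l : ℤ) {x y : M} (g : G.Str (k + 1) x y) :
    (hatD η (k + 1) l).1 x y g = (-1 : ℝ) ^ ((k : ℤ) + l) •
      (∑ i : Fin k, (-1 : ℝ) ^ ((i : ℕ) + 1) • (η k l).1 _ _ (g.inner i) +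
        (-1 : ℝ) ^ (k + 1) • (η k l).1 _ _ (g.front k (by omega))) := by
  change (-1 : ℝ) ^ (((k + 1 : ℕ) : ℤ) + l - 1) • _ = _
  congr 2
  push_cast
  ring

end HatD

/-! ### Fibrewise maps as operators, and the components of low cocycle degree. -/

section OfFib

variable {G : LieGroupoid m d M G₁} {E F K : GradedBundle.{u, v} m M}

/-- The identification of the fibres at equal points. -/
def castFib (V : SmoothVectorBundle.{u, v} m M) {x y : M} (h : x = y) : V.Fib x →ₗ[ℝ] V.Fib y :=
  h.rec LinearMap.id

theorem castFib_cochain {V : SmoothVectorBundle.{u, v} m M} {k : ℕ}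
    (η : ∀ x y : M, G.Str k x y → V.Fib x) {x y x' y' : M} (h : x = x')
    (g : G.Str k x y) (g' : G.Str k x' y') (hp : ∀ i, g.pt i = g'.pt i)
    (ha : ∀ i, g.arr i = g'.arr i) : castFib V h (η x y g) = η x' y' g' := by
  subst h
  exact cochain_congr (V := V.Fib) η g g' hp ha

theorem _root_.LieRep.LieGroupoid.Str.eq_of_zero {x y : M} (g : G.Str 0 x y) : y = x :=
  g.pt_last.symm.trans g.pt_zero

theorem _root_.LieRep.LieGroupoid.Str.eq_nil {x : M} (g : G.Str 0 x x) : g = nil x := by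
  ext i
  · have h : i = 0 := Fin.ext (by omega)
    rw [h, g.pt_zero]
    rfl
  · exact i.elim0

/-- Fibrewise linear maps of degree `e` from `E` to `F`. -/
abbrev FibMaps (E F : GradedBundle.{u, v} m M) (e : ℤ) : Type (max u v) :=
  ∀ l l' : ℤ, l + e = l' → ∀ x, (E.deg l).Fib x →ₗ[ℝ] (F.deg l').Fib x

/-- The family of fibrewise linear maps `T` sends smooth sections to smooth sections. -/
def FibMaps.IsSmooth {e : ℤ} (T : FibMaps E F e) : Prop :=
  ∀ (l l' : ℤ) (h : l + e = l') (n : ℕ) (b : Eu n → M) (w : ∀ z, (E.deg l).Fib (b z)),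
    (E.deg l).SmoothAlong b w → (F.deg l').SmoothAlong b (fun z => T l l' h (b z) (w z))

variable (G) in
/-- A family of fibrewise linear maps as a family of sections of homomorphism bundles. -/
def FibMaps.toHomCochain {e : ℤ} (T : FibMaps E F e) : ∀ k : ℕ, HomCochain G E F k (e - k)
  | 0, l, l', h, x, _, g => T l l' (by simpa using h) x ∘ₗ castFib (E.deg l) g.eq_of_zero
  | _ + 1, _, _, _, _, _, _ => 0

theorem FibMaps.IsSmooth.toHomCochain {e : ℤ} {T : FibMaps E F e} (hT : T.IsSmooth) (k : ℕ) :
    (T.toHomCochain G k).IsSmooth := by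
  intro l l' h n x y c w hc hw
  cases k with
  | zero =>
    obtain rfl : y = x := funext fun z => (c z).eq_of_zero
    exact hT _ _ _ _ _ _ hw
  | succ k => exact (F.deg l').smoothAlong_zero hc.smooth_tgt

variable (G) in
/-- A family of fibrewise linear maps as a series concentrated in degree zero. -/
def ofFib {e : ℤ} (T : FibMaps E F e) (hT : T.IsSmooth) : HomSeries G E F e :=
  HomSeries.mk (T.toHomCochain G) hT.toHomCochain

theorem ofFib_succ {e : ℤ} (T : FibMaps E F e) (hT : T.IsSmooth) (k : ℕ) (l l' : ℤ)
    (h : l + (e - (k + 1 : ℕ)) = l') {x y : M} (g : G.Str (k + 1) x y) :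
    (ofFib G T hT).fn (k + 1) l l' h g = 0 := rfl

theorem star_ofFib {e : ℤ} (T : FibMaps E F e) (hT : T.IsSmooth) (η : Cochains G E) {j : ℕ}
    (l l' : ℤ) (h : l + e = l') {x y : M} (g : G.Str j x y) :
    (star (ofFib G T hT) η j l').1 x y g = T l l' h x ((η j l).1 x y g) := by
  rw [star_apply, Fin.sum_univ_succ, Finset.sum_eq_zero, add_zero]
  · rw [starTerm_congr _ _ _ _ _ j _ (by simp) _ l _ (by simpa using h)]
    rw [starTerm]
    have h1 : (-1 : ℝ) ^ ((((0 : Fin (j + 1)) : ℕ) : ℤ) * (j + l)) = 1 := by simp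
    rw [h1, one_smul]
    refine congrArg (T l l' h x) ?_
    refine castFib_cochain _ _ _ _ (fun i => ?_) (fun i => ?_)
    · exact congrArg g.pt (Fin.ext (Nat.zero_add _))
    · exact congrArg g.arr (Fin.ext (Nat.zero_add _))
  · intro k _
    rw [starTerm]
    exact smul_zero _

/-- The inner faces and the last face keep the target of a string, so maps acting on the fibre at
the target pass through them. Only the prefactor of D̂₀ sees the shift of total degree by e. -/
theorem hatD_star_ofFib {e : ℤ} (T : FibMaps E F e) (hT : T.IsSmooth) (η : Cochains G E) :
    hatD (star (ofFib G T hT) η) = (-1 : ℝ) ^ e • star (ofFib G T hT) (hatD η) := by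
  funext j l'
  apply Subtype.ext
  funext x y g
  change _ = (-1 : ℝ) ^ e • (star (ofFib G T hT) (hatD η) j l').1 x y g
  rw [star_ofFib T hT _ (l' - e) l' (by ring)]
  cases j with
  | zero => rw [hatD_zero, hatD_zero, map_zero, smul_zero]
  | succ k =>
    rw [hatD_succ, hatD_succ, map_smul, smul_smul, ← zpow_add₀ (by norm_num), map_add, map_sum]
    congr 1
    · congr 1
      ring
    · congr 1
      · refine Finset.sum_congr rfl fun i _ => ?_
        rw [star_ofFib T hT _ (l' - e) l' (by ring), map_smul]
      · rw [star_ofFib T hT _ (l' - e) l' (by ring), map_smul]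

/-- The fibrewise linear map given by the component of degree zero of a series. -/
def HomSeries.base {e : ℤ} (T : HomSeries G E F e) : FibMaps E F e := fun l l' h x =>
  T.fn 0 l l' (by simpa using h) (nil x)

theorem HomSeries.isSmooth_base {e : ℤ} (T : HomSeries G E F e) : T.base.IsSmooth := by
  intro l l' h n b w hw
  exact T.isSmooth 0 l l' _ n b b (fun z => nil (b z)) w
    ⟨fun _ => hw.contMDiff_base, fun i => i.elim0⟩ hw

/-- The components of positive degree. -/
def HomSeries.tailFn {e : ℤ} (T : HomSeries G E F e) : ∀ k : ℕ, HomCochain G E F k (e - k)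
  | 0, _, _, _, _, _, _ => 0
  | k + 1, l, l', h, _, _, g => T.fn (k + 1) l l' h g

/-- The part of positive degree of a series. -/
def HomSeries.tail {e : ℤ} (T : HomSeries G E F e) : HomSeries G E F e :=
  HomSeries.mk T.tailFn fun k => by
    cases k with
    | zero =>
      intro l l' h n x y c w hc hw
      exact (F.deg l').smoothAlong_zero hc.smooth_tgt
    | succ k => exact T.isSmooth (k + 1)

theorem HomSeries.tail_zero {e : ℤ} (T : HomSeries G E F e) (l l' : ℤ)
    (h : l + (e - (0 : ℕ)) = l') {x y : M} (g : G.Str 0 x y) : T.tail.fn 0 l l' h g = 0 := rfl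

theorem HomSeries.tail_succ {e : ℤ} (T : HomSeries G E F e) (k : ℕ) (l l' : ℤ)
    (h : l + (e - (k + 1 : ℕ)) = l') {x y : M} (g : G.Str (k + 1) x y) :
    T.tail.fn (k + 1) l l' h g = T.fn (k + 1) l l' h g := rfl

theorem HomSeries.ext_fn {e : ℤ} {S T : HomSeries G E F e}
    (h : ∀ (k : ℕ) (l l' : ℤ) (h : l + (e - k) = l') (x y : M) (g : G.Str k x y),
      S.fn k l l' h g = T.fn k l l' h g) : S = T := by
  apply Subtype.ext
  funext k i x y g
  exact h k i.1.1 i.1.2 i.2 x y g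

theorem HomSeries.base_add_tail {e : ℤ} (T : HomSeries G E F e) :
    ofFib G T.base T.isSmooth_base + T.tail = T := by
  refine ext_fn fun k l l' h x y g => ?_
  rw [add_apply]
  cases k with
  | zero =>
    obtain rfl := g.eq_of_zero
    rw [g.eq_nil, tail_zero, add_zero]
    rfl
  | succ k => rw [ofFib_succ, tail_succ, zero_add]

theorem HomSeries.comp_nil {e₁ e₂ : ℤ} (S : HomSeries G F K e₁) (T : HomSeries G E F e₂) (e : ℤ)
    (he : e₁ + e₂ = e) (l l' l'' : ℤ) (h : l + (e - (0 : ℕ)) = l'') (h₁ : l + (e₂ - (0 : ℕ)) = l')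
    (h₂ : l' + (e₁ - (0 : ℕ)) = l'') (x : M) :
    (S.comp T e he).fn 0 l l'' h (nil x) =
      S.fn 0 l' l'' h₂ (nil x) ∘ₗ T.fn 0 l l' h₁ (nil x) := by
  subst h₁
  rw [comp_apply, Fin.sum_univ_one]
  have h1 : (-1 : ℝ) ^ ((((0 : Fin 1) : ℕ) : ℤ) * e₂) = 1 := by simp
  rw [h1, one_smul]
  rfl

/-- An arrow splits in two ways, as it is used by `T` or by `S`; the sign arises when `S` takes the
arrow. -/
theorem HomSeries.comp_single {e₁ e₂ : ℤ} (S : HomSeries G F K e₁) (T : HomSeries G E F e₂) (e : ℤ)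
    (he : e₁ + e₂ = e) (l l₁ l₂ l'' : ℤ) (h : l + (e - (1 : ℕ)) = l'')
    (h₁ : l + (e₂ - (1 : ℕ)) = l₁) (h₁' : l₁ + (e₁ - (0 : ℕ)) = l'')
    (h₂ : l + (e₂ - (0 : ℕ)) = l₂) (h₂' : l₂ + (e₁ - (1 : ℕ)) = l'') {x y : M} (g : G.Arrow x y) :
    (S.comp T e he).fn 1 l l'' h (single g) =
      S.fn 0 l₁ l'' h₁' (nil x) ∘ₗ T.fn 1 l l₁ h₁ (single g) +
      (-1 : ℝ) ^ e₂ • (S.fn 1 l₂ l'' h₂' (single g) ∘ₗ T.fn 0 l l₂ h₂ (nil y)) := by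
  subst h₁ h₂
  rw [comp_apply, Fin.sum_univ_two]
  have h1 : (-1 : ℝ) ^ ((((0 : Fin 2) : ℕ) : ℤ) * e₂) = 1 := by simp
  have h2 : (-1 : ℝ) ^ ((((1 : Fin 2) : ℕ) : ℤ) * e₂) = (-1 : ℝ) ^ e₂ := by simp
  rw [h1, h2, one_smul]
  have h3 : @Eq (G.Str 0 x x) ((single g).front 0 (Nat.zero_le 1)) (nil x) := LieGroupoid.Str.eq_nil _
  have h4 : @Eq (G.Str 0 y y) ((single g).back 1 0 rfl) (nil y) := LieGroupoid.Str.eq_nil _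
  have h5 : @Eq (G.Str 1 x y) ((single g).back 0 1 rfl) (single g) := by
    ext i
    · exact congrArg (single g).pt
        (Fin.ext (Nat.zero_add _) : (⟨0 + (i : ℕ), by omega⟩ : Fin 2) = i)
    · rfl
  have h6 : @Eq (G.Str 1 x y) ((single g).front 1 le_rfl) (single g) := rfl
  congr 1
  · exact congrArg₂ (fun (a : G.Str 0 x x) (b : G.Str 1 x y) =>
      S.fn 0 _ l'' h₁' a ∘ₗ T.fn 1 l _ rfl b) h3 h5
  · exact congrArg₂ (fun (a : G.Str 1 x y) (b : G.Str 0 y y) =>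
      (-1 : ℝ) ^ e₂ • (S.fn 1 _ l'' h₂' a ∘ₗ T.fn 0 l _ rfl b)) h6 h4

end OfFib

/-! ### Linearity over C(G) and the Leibniz identity. -/

section RightMul

variable {G : LieGroupoid m d M G₁} {E F K : GradedBundle.{u, v} m M}

/-- The right action of `C^j(G)` in all bidegrees. -/
def Cochains.rmul (η : Cochains G E) {j : ℕ} (f : SCochain G j) : Cochains G E := fun k l =>
  LieRep.rmul (Cochains.res (k + l - j) η) f (k + l) (by ring) ⟨(k, l), rfl⟩

theorem rmul_res (η : Cochains G E) {j : ℕ} (f : SCochain G j) (n n' : ℤ) (h : n + j = n') :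
    rmul (Cochains.res n η) f n' h = Cochains.res n' (η.rmul f) := by
  obtain rfl : n = n' - j := by omega
  funext i
  obtain ⟨⟨k, l⟩, rfl⟩ := i
  rfl

theorem Cochains.rmul_apply (η : Cochains G E) {j : ℕ} (f : SCochain G j) (k q : ℕ) (l : ℤ)
    (h : q + j = k) {x y : M} (g : G.Str k x y) : (η.rmul f k l).1 x y g =
      ((-1 : ℝ) ^ (q * j) * f.1 _ _ (g.back q j h)) • (η q l).1 _ _ (g.front q (by omega)) := by
  obtain rfl : q = k - j := by omega
  rw [Cochains.rmul, LieRep.rmul, dif_pos (by change j ≤ k; omega)]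
  rfl

theorem Cochains.rmul_of_lt (η : Cochains G E) {j : ℕ} (f : SCochain G j) (k : ℕ) (l : ℤ)
    (h : k < j) : η.rmul f k l = 0 := by
  rw [Cochains.rmul, LieRep.rmul, dif_neg (by change ¬ j ≤ k; omega)]

theorem star_apply_range {e : ℤ} (T : HomSeries G E F e) (η : Cochains G E) {j : ℕ} {l' : ℤ}
    {x y : M} (g : G.Str j x y) :
    (star T η j l').1 x y g = ∑ k ∈ Finset.range (j + 1), if h : k ≤ j then
      starTerm T η g k (j - k) (by omega) (l' - (e - k)) (by ring) else 0 := by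
  rw [star_apply, ← Fin.sum_univ_eq_sum_range (fun k => if h : k ≤ j then
      starTerm T η g k (j - k) (by omega) (l' - (e - k)) (by ring) else 0)]
  refine Finset.sum_congr rfl fun k _ => ?_
  rw [dif_pos (by omega)]

/-- The pieces taken by `T` and by `f` lie at opposite ends of a string. Terms in which they would
overlap vanish, since η ⋆ f has no component of cocycle degree below that of f. -/
theorem star_rmul {e : ℤ} (T : HomSeries G E F e) (η : Cochains G E) {j : ℕ} (f : SCochain G j) :
    star T (η.rmul f) = (star T η).rmul f := by
  funext k l'
  apply Subtype.ext
  funext x y g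
  by_cases hk : k < j
  · rw [Cochains.rmul_of_lt _ _ _ _ hk, star_apply]
    refine Finset.sum_eq_zero fun i _ => ?_
    rw [starTerm, Cochains.rmul_of_lt _ _ _ _ (by omega)]
    exact (congrArg _ (map_zero _)).trans (smul_zero _)
  obtain ⟨q, rfl⟩ : ∃ q, k = q + j := ⟨k - j, by omega⟩
  rw [Cochains.rmul_apply _ _ _ q _ rfl, star_apply_range, star_apply_range, Finset.smul_sum]
  symm
  refine (Finset.sum_congr rfl fun i hi => ?_).trans
    (Finset.sum_subset (Finset.range_mono (by omega : q + 1 ≤ q + j + 1)) fun i hi hi' => ?_)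
  · have hi := Finset.mem_range.1 hi
    rw [dif_pos (by omega), dif_pos (by omega), starTerm, starTerm,
      Cochains.rmul_apply _ _ _ (q - i) _ (by omega), map_smul, smul_smul, smul_smul]
    congr 1
    · have h1 : f.1 _ _ ((g.back i (q + j - i) (by omega)).back (q - i) j (by omega)) =
          f.1 _ _ (g.back q j rfl) := by
        refine scochain_congr f.1 _ _ (fun a => ?_) (fun a => ?_)
        · exact congrArg g.pt (Fin.ext (by change i + (q - i + a) = q + a; omega))
        · exact congrArg g.arr (Fin.ext (by change i + (q - i + a) = q + a; omega))
      rw [h1]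
      have h2 : (-1 : ℝ) ^ (q * j) * (-1 : ℝ) ^ ((i : ℤ) * ((q - i : ℕ) + (l' - (e - i)))) =
          (-1 : ℝ) ^ ((i : ℤ) * ((q + j - i : ℕ) + (l' - (e - i)))) * (-1 : ℝ) ^ ((q - i) * j) := by
        rw [← zpow_natCast, ← zpow_natCast, ← zpow_add₀ (by norm_num), ← zpow_add₀ (by norm_num)]
        congr 1
        push_cast [show i ≤ q by omega, show i ≤ q + j by omega]
        ring
      linear_combination f.1 _ _ (g.back q j rfl) * h2
    · refine congrArg (T.fn i _ l' _ _) ?_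
      refine cochain_congr (V := (E.deg _).Fib) _ _ _ (fun a => ?_) (fun a => ?_)
      · rfl
      · rfl
  · have hi := Finset.mem_range.1 hi
    have hi' := Finset.mem_range.not.1 hi'
    rw [dif_pos (by omega), starTerm, Cochains.rmul_of_lt _ _ _ _ (by omega)]
    exact (congrArg _ (map_zero _)).trans (smul_zero _)

theorem delta_apply {j : ℕ} (f : SCochain G j) {x y : M} (g : G.Str (j + 1) x y) :
    (delta f).1 x y g = (-1 : ℝ) ^ j * (f.1 _ _ (g.back 1 j (by omega)) +
      ∑ i : Fin j, (-1 : ℝ) ^ ((i : ℕ) + 1) * f.1 _ _ (g.inner i) +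
      (-1 : ℝ) ^ (j + 1) * f.1 _ _ (g.front j (by omega))) := rfl

/-- The inner faces of a string of length q + j + 1 either compose arrows among the first q + 1,
which gives D̂₀η, or among the last j + 1, which gives δf. The last face of D̂₀η and the first face
of δf both produce η(g₁, …, g_q) f(g_{q+2}, …), and these two terms cancel. -/
theorem hatD_rmul (η : Cochains G E) {j : ℕ} (f : SCochain G j) (k : ℕ) (l : ℤ) {x y : M}
    (g : G.Str k x y) : (hatD (η.rmul f) k l).1 x y g = ((hatD η).rmul f k l).1 x y g +
      (-1 : ℝ) ^ ((k : ℤ) + l - 1 - j) • (η.rmul (delta f) k l).1 x y g := by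
  by_cases hk : k ≤ j
  · rw [η.rmul_of_lt (delta f) k l (by omega)]
    have h1 : ((hatD η).rmul f k l).1 x y g = 0 := by
      rcases hk.lt_or_eq with hk | rfl
      · rw [Cochains.rmul_of_lt _ _ _ _ hk]
        rfl
      · rw [Cochains.rmul_apply _ _ _ 0 _ (Nat.zero_add _), hatD_zero, smul_zero]
    rw [h1]
    refine Eq.trans ?_ ((zero_add _).trans (smul_zero _)).symm
    cases k with
    | zero => exact hatD_zero _ _ _
    | succ k =>
      rw [hatD_succ, η.rmul_of_lt f k l (by omega)]
      exact (congrArg _ ((congrArg₂ (· + ·) (Finset.sum_eq_zero fun i _ => smul_zero _)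
        (smul_zero _)).trans (add_zero _))).trans (smul_zero _)
  obtain ⟨q, rfl⟩ : ∃ q, k = q + j + 1 := ⟨k - j - 1, by omega⟩
  rw [hatD_succ, Cochains.rmul_apply _ f (q + j + 1) (q + 1) l (by omega),
    Cochains.rmul_apply _ (delta f) (q + j + 1) q l (by omega), hatD_succ, delta_apply,
    Fin.sum_univ_add]
  have h1 : ∀ i : Fin q, (η.rmul f (q + j) l).1 _ _ (g.inner (i.castAdd j)) =
      ((-1 : ℝ) ^ (q * j) * f.1 _ _ (g.back (q + 1) j (by omega))) •
        (η q l).1 _ _ ((g.front (q + 1) (by omega)).inner i) := by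
    intro i
    rw [Cochains.rmul_apply _ _ _ q _ rfl]
    congr 1
    · congr 1
      refine scochain_congr f.1 _ _ (fun a => ?_) (fun a => ?_)
      · refine (if_neg ?_).trans (congrArg g.pt (Fin.ext ?_))
        · change ¬ q + (a : ℕ) ≤ i; omega
        · change q + (a : ℕ) + 1 = q + 1 + a; omega
      · refine (if_neg ?_).trans ((if_neg ?_).trans (congrArg g.arr (Fin.ext ?_)))
        · change ¬ q + (a : ℕ) < i; omega
        · change ¬ q + (a : ℕ) = i; omega
        · change q + (a : ℕ) + 1 = q + 1 + a; omega
    · exact cochain_congr (V := (E.deg l).Fib) _ _ _ (fun a => rfl) (fun a => rfl)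
  have h2 : ∀ i : Fin j, (η.rmul f (q + j) l).1 _ _ (g.inner (i.natAdd q)) =
      ((-1 : ℝ) ^ (q * j) * f.1 _ _ ((g.back q (j + 1) (by omega)).inner i)) •
        (η q l).1 _ _ (g.front q (by omega)) := by
    intro i
    rw [Cochains.rmul_apply _ _ _ q _ rfl]
    congr 1
    · congr 1
      refine scochain_congr f.1 _ _ (fun a => ?_) (fun a => ?_)
      · change (if q + (a : ℕ) ≤ q + (i : ℕ) then _ else _) = (if (a : ℕ) ≤ i then _ else _)
        simp only [add_le_add_iff_left]
        rfl
      · change (if q + (a : ℕ) < q + (i : ℕ) then _ else if q + (a : ℕ) = q + (i : ℕ) then _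
          else _) = (if (a : ℕ) < i then _ else if (a : ℕ) = i then _ else _)
        simp only [add_lt_add_iff_left, add_right_inj]
        rfl
    · refine cochain_congr (V := (E.deg l).Fib) _ _ _ (fun a => if_pos ?_) (fun a => if_pos ?_)
      · change (a : ℕ) ≤ q + i; omega
      · change (a : ℕ) < q + i; omega
  have h3 : (η.rmul f (q + j) l).1 _ _ (g.front (q + j) (by omega)) =
      ((-1 : ℝ) ^ (q * j) * f.1 _ _ ((g.back q (j + 1) (by omega)).front j (by omega))) •
        (η q l).1 _ _ (g.front q (by omega)) := by
    rw [Cochains.rmul_apply _ _ _ q _ rfl]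
    congr 1
  have h4 : (η q l).1 _ _ ((g.front (q + 1) (by omega)).front q (by omega)) =
      (η q l).1 _ _ (g.front q (by omega)) := rfl
  have h5 : f.1 _ _ ((g.back q (j + 1) (by omega)).back 1 j (by omega)) =
      f.1 _ _ (g.back (q + 1) j (by omega)) := by
    refine scochain_congr f.1 _ _ (fun a => congrArg g.pt (Fin.ext ?_))
      (fun a => congrArg g.arr (Fin.ext ?_))
    · change q + (1 + (a : ℕ)) = q + 1 + a; omega
    · change q + (1 + (a : ℕ)) = q + 1 + a; omega
  simp only [h1, h2]
  rw [h3, h4, h5]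
  set X := f.1 _ _ (g.back (q + 1) j (by omega))
  set Y := f.1 _ _ ((g.back q (j + 1) (by omega)).front j (by omega))
  set A := (η q l).1 _ _ (g.front q (by omega))
  have h6 : ∑ i : Fin q, (-1 : ℝ) ^ (((i.castAdd j : Fin (q + j)) : ℕ) + 1) •
      ((-1 : ℝ) ^ (q * j) * X) • (η q l).1 _ _ ((g.front (q + 1) (by omega)).inner i) =
      ((-1 : ℝ) ^ (q * j) * X) • ∑ i : Fin q, (-1 : ℝ) ^ ((i : ℕ) + 1) •
        (η q l).1 _ _ ((g.front (q + 1) (by omega)).inner i) := by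
    rw [Finset.smul_sum]
    exact Finset.sum_congr rfl fun i _ => smul_comm _ _ _
  have h7 : ∑ i : Fin j, (-1 : ℝ) ^ (((i.natAdd q : Fin (q + j)) : ℕ) + 1) •
      ((-1 : ℝ) ^ (q * j) * f.1 _ _ ((g.back q (j + 1) (by omega)).inner i)) • A =
      ((-1 : ℝ) ^ q * (-1 : ℝ) ^ (q * j) * ∑ i : Fin j, (-1 : ℝ) ^ ((i : ℕ) + 1) *
        f.1 _ _ ((g.back q (j + 1) (by omega)).inner i)) • A := by
    rw [Finset.mul_sum, Finset.sum_smul]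
    refine Finset.sum_congr rfl fun i _ => ?_
    rw [smul_smul, Fin.val_natAdd]
    congr 1
    ring
  rw [h6, h7]
  set S := ∑ i : Fin q, (-1 : ℝ) ^ ((i : ℕ) + 1) •
        (η q l).1 _ _ ((g.front (q + 1) (by omega)).inner i)
  set σ := ∑ i : Fin j, (-1 : ℝ) ^ ((i : ℕ) + 1) *
        f.1 _ _ ((g.back q (j + 1) (by omega)).inner i)
  have s1 : (-1 : ℝ) ^ (((q + j : ℕ) : ℤ) + l) = (-1 : ℝ) ^ q * (-1 : ℝ) ^ j * (-1 : ℝ) ^ l := by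
    rw [zpow_add₀ (by norm_num), zpow_natCast, pow_add]
  have s2 : (-1 : ℝ) ^ ((q : ℤ) + l) = (-1 : ℝ) ^ q * (-1 : ℝ) ^ l := by
    rw [zpow_add₀ (by norm_num), zpow_natCast]
  have s3 : (-1 : ℝ) ^ (((q + j + 1 : ℕ) : ℤ) + l - 1 - j) = (-1 : ℝ) ^ q * (-1 : ℝ) ^ l := by
    rw [← s2]
    congr 1
    push_cast
    ring
  rw [s1, s2, s3]
  simp only [add_mul, mul_add, pow_add, one_mul, mul_one, pow_one]
  generalize (-1 : ℝ) ^ q = a at *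
  generalize (-1 : ℝ) ^ j = b at *
  generalize (-1 : ℝ) ^ (q * j) = c at *
  generalize (-1 : ℝ) ^ l = t at *
  match_scalars
  · ring
  · ring

end RightMul

/-! ### The homological perturbation lemma in a ring of endomorphisms. -/

section Algebra

/-- Put X = uδ, so that (1 + δh)X = δ = X(1 + hδ). Multiplying the left side by 1 + δh on the left
and by 1 + hδ on the right turns it into dδ + δd + δδ, which is (d + δ)² − d² = 0. Both factors can
be cancelled: the inverse of the second is 1 − hX. -/
theorem perturbation_identity {A : Type*} [Ring A] {d h δ u : A} (hd : d * d = 0)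
    (hD : (d + δ) * (d + δ) = 0) (hu : u * (1 + δ * h) = 1) (hu' : (1 + δ * h) * u = 1) :
    u * δ * d + d * (u * δ) + u * δ * (1 - d * h - h * d) * (u * δ) = 0 := by
  have h1 : (1 + δ * h) * (u * δ) = δ := by rw [← _root_.mul_assoc, hu', one_mul]
  have h2 : u * δ * (1 + h * δ) = δ := by
    have : u * δ * (1 + h * δ) = u * (1 + δ * h) * δ := by noncomm_ring
    rw [this, hu, one_mul]
  have h3 : (1 + h * δ) * (1 - h * (u * δ)) = 1 := by
    have : (1 + h * δ) * (1 - h * (u * δ)) = 1 + h * δ - h * ((1 + δ * h) * (u * δ)) := by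
      noncomm_ring
    rw [this, h1]
    noncomm_ring
  have h4 : d * δ + δ * d + δ * δ = 0 := by
    have : (d + δ) * (d + δ) = d * d + (d * δ + δ * d + δ * δ) := by noncomm_ring
    rw [this, hd, zero_add] at hD
    exact hD
  set X := u * δ * d + d * (u * δ) + u * δ * (1 - d * h - h * d) * (u * δ) with hX
  have h5 : (1 + δ * h) * X * (1 + h * δ) = 0 := by
    have e1 : (1 + δ * h) * X * (1 + h * δ) = (1 + δ * h) * (u * δ) * d * (1 + h * δ) +
        (1 + δ * h) * d * (u * δ * (1 + h * δ)) +
        (1 + δ * h) * (u * δ) * (1 - d * h - h * d) * (u * δ * (1 + h * δ)) := by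
      rw [hX]
      noncomm_ring
    rw [e1, h1, h2, ← h4]
    noncomm_ring
  calc X = (u * (1 + δ * h)) * X * ((1 + h * δ) * (1 - h * (u * δ))) := by
        rw [hu, h3, one_mul, mul_one]
    _ = u * ((1 + δ * h) * X * (1 + h * δ)) * (1 - h * (u * δ)) := by noncomm_ring
    _ = 0 := by rw [h5, mul_zero, zero_mul]

variable {X Y : Type*} [AddCommGroup X] [Module ℝ X] [AddCommGroup Y] [Module ℝ Y]
  {d h δ u : Module.End ℝ X} {p : X →ₗ[ℝ] Y} {i : Y →ₗ[ℝ] X}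

theorem perturbation_apply (hd : d * d = 0) (hD : (d + δ) * (d + δ) = 0)
    (hu : u * (1 + δ * h) = 1) (hu' : (1 + δ * h) * u = 1)
    (hip : ∀ x, i (p x) = x - d (h x) - h (d x)) (x : X) :
    u (δ (d x)) + d (u (δ x)) + u (δ (i (p (u (δ x))))) = 0 := by
  rw [hip]
  exact congrArg (fun f : Module.End ℝ X => f x) (perturbation_identity hd hD hu hu')

/-- Apply p to `perturbation_apply` at i y: the terms containing d vanish because pd = 0 and di = 0.
The side conditions hh = 0, ph = 0, hi = 0 play no role here. -/
theorem perturbation_sq (hd : d * d = 0) (hD : (d + δ) * (d + δ) = 0)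
    (hu : u * (1 + δ * h) = 1) (hu' : (1 + δ * h) * u = 1)
    (hip : ∀ x, i (p x) = x - d (h x) - h (d x)) (hpd : ∀ x, p (d x) = 0) (hdi : ∀ y, d (i y) = 0)
    (y : Y) : p (u (δ (i (p (u (δ (i y))))))) = 0 := by
  have h1 := congrArg p (perturbation_apply hd hD hu hu' hip (i y))
  rw [hdi, map_zero, map_zero, zero_add, map_add, hpd, zero_add, map_zero] at h1
  exact h1

/-- Substituting u = 1 − uδh reduces both sides to p, puδ and puδh; the remaining term puδdh is
supplied by `perturbation_apply` at h x. -/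
theorem perturbation_comm (hd : d * d = 0) (hD : (d + δ) * (d + δ) = 0)
    (hu : u * (1 + δ * h) = 1) (hu' : (1 + δ * h) * u = 1)
    (hip : ∀ x, i (p x) = x - d (h x) - h (d x)) (hpd : ∀ x, p (d x) = 0) (x : X) :
    p (u ((d + δ) x)) = p (u (δ (i (p (u x))))) := by
  have hux : ∀ x, u x = x - u (δ (h x)) := fun x => by
    have := congrArg (fun f : Module.End ℝ X => f x) hu
    change u (x + δ (h x)) = x at this
    rw [map_add] at this
    exact eq_sub_of_add_eq this
  have h1 := congrArg p (perturbation_apply hd hD hu hu' hip (h x))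
  rw [map_add, map_add, hpd, add_zero, map_zero] at h1
  rw [LinearMap.add_apply, map_add, map_add, hux (d x), map_sub, hpd, zero_sub, hux x, map_sub,
    map_sub, map_sub, map_sub, map_sub, hip x, map_sub, map_sub, map_sub, map_sub, map_sub, map_sub,
    eq_neg_of_add_eq_zero_right h1]
  abel

end Algebra

/-! ### Smooth contraction of a regular complex of vector bundles onto its cohomology. -/

section Contraction

variable {E H : GradedBundle.{u, v} m M}

/-- A contraction of the complex of vector bundles `(E, bd)` onto the graded bundle `H` with zero
differential. -/
structure Contraction (bd : FibMaps E E 1) (H : GradedBundle.{u, v} m M) where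
  h : FibMaps E E (-1)
  p : ∀ l x, (E.deg l).Fib x →ₗ[ℝ] (H.deg l).Fib x
  i : ∀ l x, (H.deg l).Fib x →ₗ[ℝ] (E.deg l).Fib x
  h_smooth : h.IsSmooth
  p_smooth : ∀ (l : ℤ) (n : ℕ) (b : Eu n → M) (w : ∀ z, (E.deg l).Fib (b z)),
    (E.deg l).SmoothAlong b w → (H.deg l).SmoothAlong b (fun z => p l (b z) (w z))
  i_smooth : ∀ (l : ℤ) (n : ℕ) (b : Eu n → M) (w : ∀ z, (H.deg l).Fib (b z)),
    (H.deg l).SmoothAlong b w → (E.deg l).SmoothAlong b (fun z => i l (b z) (w z))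
  h_h : ∀ (l l' l'' : ℤ) (hl : l + -1 = l') (hl' : l' + -1 = l'') (x : M) (v : (E.deg l).Fib x),
    h l' l'' hl' x (h l l' hl x v) = 0
  p_bd : ∀ (l l' : ℤ) (hl : l + 1 = l') (x : M) (v : (E.deg l).Fib x), p l' x (bd l l' hl x v) = 0
  bd_i : ∀ (l l' : ℤ) (hl : l + 1 = l') (x : M) (v : (H.deg l).Fib x), bd l l' hl x (i l x v) = 0
  p_h : ∀ (l l' : ℤ) (hl : l + -1 = l') (x : M) (v : (E.deg l).Fib x), p l' x (h l l' hl x v) = 0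
  h_i : ∀ (l l' : ℤ) (hl : l + -1 = l') (x : M) (v : (H.deg l).Fib x), h l l' hl x (i l x v) = 0
  p_i : ∀ (l : ℤ) (x : M) (v : (H.deg l).Fib x), p l x (i l x v) = v
  i_p : ∀ (l l₁ l₂ : ℤ) (h₁ : l + -1 = l₁) (h₁' : l₁ + 1 = l) (h₂ : l + 1 = l₂) (h₂' : l₂ + -1 = l)
    (x : M) (v : (E.deg l).Fib x),
    i l x (p l x v) = v - bd l₁ l h₁' x (h l l₁ h₁ x v) - h l₂ l h₂' x (bd l l₂ h₂ x v)

theorem exists_homotopy [IsManifold (𝓡 m) ∞ M] [T2Space M] [SecondCountableTopology M]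
    (bd : FibMaps E E 1) (hbd : bd.IsSmooth)
    (hsq : ∀ (l l' l'' : ℤ) (hl : l + 1 = l') (hl' : l' + 1 = l'') x v,
      bd l' l'' hl' x (bd l l' hl x v) = 0)
    (hr : ∀ l : ℤ, ∃ r : ℕ, ∀ x, Module.finrank ℝ (LinearMap.range (bd l (l + 1) rfl x)) = r) :
    ∃ h : FibMaps E E (-1), h.IsSmooth ∧
      (∀ (l l' : ℤ) (h₁ : l + 1 = l') (h₂ : l' + -1 = l) x v,
        bd l l' h₁ x (h l' l h₂ x (bd l l' h₁ x v)) = bd l l' h₁ x v) ∧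
      (∀ (l l' : ℤ) (h₁ : l + 1 = l') (h₂ : l' + -1 = l) x v,
        h l' l h₂ x (bd l l' h₁ x (h l' l h₂ x v)) = h l' l h₂ x v) ∧
      (∀ (l l' l'' : ℤ) (hl : l + -1 = l') (hl' : l' + -1 = l'') x v,
        h l' l'' hl' x (h l l' hl x v) = 0) := by
  have h0 : ∀ (l l' : ℤ) (h₂ : l + -1 = l'), ∃ k : ∀ x, (E.deg l).Fib x →ₗ[ℝ] (E.deg l').Fib x,
      (∀ x, SmoothVectorBundle.HomSmoothAt k x) ∧ ∀ x,
        bd l' l (by omega) x ∘ₗ k x ∘ₗ bd l' l (by omega) x = bd l' l (by omega) x := by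
    intro l l' h₂
    obtain rfl : l = l' + 1 := by omega
    obtain ⟨r, hr⟩ := hr l'
    exact SmoothVectorBundle.exists_generalizedInverse (bd l' (l' + 1) rfl)
      (SmoothVectorBundle.homSmoothAt_of_plots (hbd l' (l' + 1) rfl)) hr
  choose k hks hk using h0
  replace hk : ∀ (l l' : ℤ) (h₁ : l + 1 = l') (h₂ : l' + -1 = l) x v,
      bd l l' h₁ x (k l' l h₂ x (bd l l' h₁ x v)) = bd l l' h₁ x v :=
    fun l l' h₁ h₂ x v => congrArg (fun f => f v) (hk l' l h₂ x)
  have hks' : ∀ (l l' : ℤ) (h₂ : l + -1 = l') (n : ℕ) (b : Eu n → M)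
      (w : ∀ z, (E.deg l).Fib (b z)), (E.deg l).SmoothAlong b w →
      (E.deg l').SmoothAlong b (fun z => k l l' h₂ (b z) (w z)) := fun l l' h₂ n b w hw =>
    SmoothVectorBundle.smoothAlong_of_homSmooth (hks l l' h₂) hw
  -- Passing from k to k₁ = k∂k adds the identity k₁∂k₁ = k₁.
  let k₁ : FibMaps E E (-1) := fun l l' hl x => k l l' hl x ∘ₗ bd l' l (by omega) x ∘ₗ k l l' hl x
  have hk₁ : ∀ (l l' : ℤ) (h₁ : l + 1 = l') (h₂ : l' + -1 = l) x v,
      k₁ l' l h₂ x v = k l' l h₂ x (bd l l' h₁ x (k l' l h₂ x v)) := fun _ _ _ _ _ _ => rfl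
  -- The factor 1 − k∂ kills the image of k₁, which gives square zero. It is the identity on im ∂
  -- because ∂∂ = 0, so the other two identities are kept.
  let k₂ : FibMaps E E (-1) := fun l l' hl x =>
    k₁ l l' hl x ∘ₗ (LinearMap.id - k (l + 1) l (by omega) x ∘ₗ bd l (l + 1) rfl x)
  have hk₂ : ∀ (l l' l'' : ℤ) (h₁ : l' + -1 = l) (h₂ : l' + 1 = l'') (h₃ : l'' + -1 = l') x v,
      k₂ l' l h₁ x v = k₁ l' l h₁ x (v - k l'' l' h₃ x (bd l' l'' h₂ x v)) := by
    intro l l' l'' h₁ h₂ h₃ x v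
    subst h₂
    rfl
  have hk₂' : ∀ (l l' : ℤ) (h₁ : l + 1 = l') (h₂ : l' + -1 = l) x v,
      k₂ l' l h₂ x (bd l l' h₁ x v) = k₁ l' l h₂ x (bd l l' h₁ x v) := by
    intro l l' h₁ h₂ x v
    rw [hk₂ l l' (l' + 1) h₂ rfl (by omega), hsq, map_zero, sub_zero]
  refine ⟨k₂, ?_, ?_, ?_, ?_⟩
  · intro l l' hl n b w hw
    have e : ∀ z, k₂ l l' hl (b z) (w z) = k l l' hl (b z) (bd l' l (by omega) (b z)
        (k l l' hl (b z) (w z + (-1 : ℝ) • k (l + 1) l (by omega) (b z)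
          (bd l (l + 1) rfl (b z) (w z))))) := by
      intro z
      rw [hk₂ l' l (l + 1) hl rfl (by omega), hk₁ l' l (by omega), sub_eq_add_neg (w z), neg_one_smul]
    simp only [e]
    exact hks' _ _ _ _ _ _ (hbd _ _ _ _ _ _ (hks' _ _ _ _ _ _ (hw.add hw.contMDiff_base
      ((hks' _ _ _ _ _ _ (hbd _ _ _ _ _ _ hw)).smul hw.contMDiff_base _))))
  · intro l l' h₁ h₂ x v
    rw [hk₂' l l' h₁ h₂, hk₁ l l' h₁ h₂, hk, hk]
  · intro l l' h₁ h₂ x v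
    rw [hk₂' l l' h₁ h₂, hk₂ l l' (l' + 1) h₂ rfl (by omega)]
    simp only [hk₁ l l' h₁ h₂, hk]
  · intro l l' l'' hl hl' x v
    rw [hk₂ l'' l' l hl' (by omega) hl, hk₂ l' l (l + 1) hl rfl (by omega),
      hk₁ l' l (by omega) hl, hk, sub_self, map_zero]

theorem _root_.LinearMap.finrank_range_eq_trace {V : Type*} [AddCommGroup V] [Module ℝ V]
    [FiniteDimensional ℝ V] (P : V →ₗ[ℝ] V) (hP : ∀ v, P (P v) = P v) :
    (Module.finrank ℝ (LinearMap.range P) : ℝ) = LinearMap.trace ℝ V P := by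
  refine (LinearMap.IsProj.trace (p := LinearMap.range P) ⟨fun v => ⟨v, rfl⟩, ?_⟩).symm
  rintro _ ⟨v, rfl⟩
  exact hP v

/-- The rank of an idempotent is its trace, and traces are additive. Here ah and bk are idempotents
with the ranges of a and b, and tr(kb) = tr(bk). Applied to 1 − ∂h − h∂, this makes the rank of the
cohomology constant. -/
theorem finrank_range_id_sub {U V W : Type*} [AddCommGroup U] [Module ℝ U] [FiniteDimensional ℝ U]
    [AddCommGroup V] [Module ℝ V] [FiniteDimensional ℝ V] [AddCommGroup W] [Module ℝ W]
    [FiniteDimensional ℝ W] (a : U →ₗ[ℝ] V) (b : V →ₗ[ℝ] W) (h : V →ₗ[ℝ] U) (k : W →ₗ[ℝ] V)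
    (ha : ∀ v, a (h (a v)) = a v) (hb : ∀ v, b (k (b v)) = b v)
    {P : V →ₗ[ℝ] V} (hP : ∀ v, P (P v) = P v) (hPe : P = LinearMap.id - a ∘ₗ h - k ∘ₗ b) :
    Module.finrank ℝ (LinearMap.range P) =
      Module.finrank ℝ V - Module.finrank ℝ (LinearMap.range a) -
        Module.finrank ℝ (LinearMap.range b) := by
  have h1 : LinearMap.range (a ∘ₗ h) = LinearMap.range a := by
    refine le_antisymm (LinearMap.range_comp_le_range _ _) ?_
    rintro _ ⟨v, rfl⟩
    exact ⟨a v, ha v⟩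
  have h2 : LinearMap.range (b ∘ₗ k) = LinearMap.range b := by
    refine le_antisymm (LinearMap.range_comp_le_range _ _) ?_
    rintro _ ⟨v, rfl⟩
    exact ⟨b v, hb v⟩
  have h3 := LinearMap.finrank_range_eq_trace _ hP
  have h4 := LinearMap.finrank_range_eq_trace (a ∘ₗ h) (fun v => ha (h v))
  have h5 := LinearMap.finrank_range_eq_trace (b ∘ₗ k) (fun v => hb (k v))
  rw [hPe, map_sub, map_sub, ← hPe, ← h4, LinearMap.trace_comp_comm', ← h5, h1, h2, LinearMap.trace_id] at h3
  -- The equality over the integers shows that the subtractions of natural numbers in the statement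
  -- are not truncated.
  have h6 : (Module.finrank ℝ (LinearMap.range P) : ℤ) =
      Module.finrank ℝ V - Module.finrank ℝ (LinearMap.range a) -
        Module.finrank ℝ (LinearMap.range b) := by
    exact_mod_cast h3
  omega

theorem exists_contraction [IsManifold (𝓡 m) ∞ M] [T2Space M] [SecondCountableTopology M]
    (bd : FibMaps E E 1) (hbd : bd.IsSmooth)
    (hsq : ∀ (l l' l'' : ℤ) (hl : l + 1 = l') (hl' : l' + 1 = l'') x v,
      bd l' l'' hl' x (bd l l' hl x v) = 0)
    (hr : ∀ l : ℤ, ∃ r : ℕ, ∀ x, Module.finrank ℝ (LinearMap.range (bd l (l + 1) rfl x)) = r) :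
    ∃ H : GradedBundle.{u, v} m M, Nonempty (Contraction bd H) := by
  obtain ⟨h, hs, hbhb, hhbh, hhh⟩ := exists_homotopy bd hbd hsq hr
  choose r hr using hr
  have hr' : ∀ (l l' : ℤ) (hl : l + 1 = l') x,
      Module.finrank ℝ (LinearMap.range (bd l l' hl x)) = r l := by
    rintro l _ rfl x
    exact hr l x
  let P₀ : ∀ l x, (E.deg l).Fib x →ₗ[ℝ] (E.deg l).Fib x := fun l x =>
    LinearMap.id - bd (l - 1) l (by omega) x ∘ₗ h l (l - 1) (by omega) x -
      h (l + 1) l (by omega) x ∘ₗ bd l (l + 1) rfl x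
  have hP₀ : ∀ (l l₁ l₂ : ℤ) (h₁ : l + -1 = l₁) (h₁' : l₁ + 1 = l) (h₂ : l + 1 = l₂)
      (h₂' : l₂ + -1 = l) (x : M) (v : (E.deg l).Fib x),
      P₀ l x v = v - bd l₁ l h₁' x (h l l₁ h₁ x v) - h l₂ l h₂' x (bd l l₂ h₂ x v) := by
    intro l l₁ l₂ h₁ h₁' h₂ h₂' x v
    obtain rfl : l₁ = l - 1 := by omega
    subst h₂
    rfl
  have hPb : ∀ (l l' : ℤ) (hl : l + 1 = l') (x : M) (v : (E.deg l).Fib x),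
      P₀ l' x (bd l l' hl x v) = 0 := by
    intro l l' hl x v
    rw [hP₀ l' l (l' + 1) (by omega) hl rfl (by omega), hbhb, hsq, map_zero, sub_self, sub_zero]
  have hPh : ∀ (l l' : ℤ) (hl : l + -1 = l') (x : M) (v : (E.deg l).Fib x),
      P₀ l' x (h l l' hl x v) = 0 := by
    intro l l' hl x v
    rw [hP₀ l' (l' - 1) l (by omega) (by omega) (by omega) hl, hhh, hhbh, map_zero, sub_zero,
      sub_self]
  have hidem : ∀ l x v, P₀ l x (P₀ l x v) = P₀ l x v := by
    intro l x v
    conv_lhs => enter [2]; rw [hP₀ l (l - 1) (l + 1) (by omega) (by omega) rfl (by omega)]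
    rw [map_sub, map_sub, hPb, hPh, sub_zero, sub_zero]
  let P : ∀ l, (E.deg l).SmoothProjection ((E.deg l).rank - r (l - 1) - r l) := fun l =>
    { toFun := P₀ l
      smooth := by
        refine SmoothVectorBundle.homSmoothAt_of_plots fun n b w hw => ?_
        have e : ∀ z, P₀ l (b z) (w z) = w z + (-1 : ℝ) • (bd (l - 1) l (by omega) (b z)
            (h l (l - 1) (by omega) (b z) (w z)) + h (l + 1) l (by omega) (b z)
              (bd l (l + 1) rfl (b z) (w z))) := by
          intro z
          rw [hP₀ l (l - 1) (l + 1) (by omega) (by omega) rfl (by omega)]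
          module
        simp only [e]
        have hb := hw.contMDiff_base
        exact hw.add hb (((hbd _ _ _ _ _ _ (hs _ _ _ _ _ _ hw)).add hb
          (hs _ _ _ _ _ _ (hbd _ _ _ _ _ _ hw))).smul hb _)
      idem := hidem l
      finrank_range := fun x => by
        rw [← (E.deg l).finrank_fib x, ← hr' (l - 1) l (by omega) x, ← hr l x]
        exact finrank_range_id_sub _ _ _ _ (hbhb _ _ _ _ x) (hbhb _ _ _ _ x) (hidem l x) rfl }
  obtain ⟨a, b, hab⟩ := E.bounded
  refine ⟨⟨fun l => (P l).image, a, b, fun l hl => ?_⟩, ⟨?_⟩⟩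
  · change (E.deg l).rank - r (l - 1) - r l = 0
    rw [hab l hl]
    omega
  have hi : ∀ l x (w : (P l).image.Fib x), (P l).incl x w = P₀ l x ((P l).incl x w) := by
    intro l x w
    conv_lhs => rw [← (P l).proj_incl x w]
    rfl
  exact
    { h := h
      p := fun l x => (P l).proj x
      i := fun l x => (P l).incl x
      h_smooth := hs
      p_smooth := fun l n b w hw => (P l).smoothAlong_proj hw
      i_smooth := fun l n b w hw => (P l).smoothAlong_incl_iff.2 hw
      h_h := hhh
      p_bd := fun l l' hl x v => (P l').incl_injective x
        (((P l').incl_proj x _).trans ((hPb l l' hl x v).trans (map_zero _).symm))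
      bd_i := fun l l' hl x w => by
        rw [hi, hP₀ l (l - 1) l' (by omega) (by omega) hl (by omega), map_sub, map_sub, hsq, hbhb,
          sub_zero, sub_self]
      p_h := fun l l' hl x v => (P l').incl_injective x
        (((P l').incl_proj x _).trans ((hPh l l' hl x v).trans (map_zero _).symm))
      h_i := fun l l' hl x w => by
        rw [hi, hP₀ l l' (l + 1) hl (by omega) rfl (by omega), map_sub, map_sub, hhh, hhbh,
          sub_zero, sub_self]
      p_i := fun l x w => (P l).proj_incl x w
      i_p := fun l l₁ l₂ h₁ h₁' h₂ h₂' x v => hP₀ l l₁ l₂ h₁ h₁' h₂ h₂' x v }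

end Contraction

/-! ### Representations up to homotopy and morphisms as operators given by series. -/

section TotalD

variable {G : LieGroupoid m d M G₁} {E F : GradedBundle.{u, v} m M}

/-- The operator `η ↦ ∑ₖ Tₖ ⋆ η + D̂₀ η`. -/
def totalD (T : HomSeries G E E 1) : Module.End ℝ (Cochains G E) := star T + hatD

theorem totalD_apply (T : HomSeries G E E 1) (η : Cochains G E) :
    totalD T η = star T η + hatD η := rfl

theorem totalD_apply' (T : HomSeries G E E 1) (η : Cochains G E) (j : ℕ) (l : ℤ) {x y : M}
    (g : G.Str j x y) :
    (totalD T η j l).1 x y g = (star T η j l).1 x y g + (hatD η j l).1 x y g := rfl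

theorem Cochains.ext_apply {η ζ : Cochains G E}
    (h : ∀ (j : ℕ) (l : ℤ) (x y : M) (g : G.Str j x y), (η j l).1 x y g = (ζ j l).1 x y g) :
    η = ζ := by
  funext j l
  apply Subtype.ext
  funext x y g
  exact h j l x y g

theorem totalD_res (T : HomSeries G E E 1) (n n' : ℤ) (h : n + 1 = n') (ζ : Cochains G E) (j : ℕ)
    (l : ℤ) (hl : (j : ℤ) + l = n') {x y : M} (g : G.Str j x y) :
    (totalD T ζ j l).1 x y g = starSum T.fn (Cochains.res n ζ) j l (by omega) g +
      hatDiff (Cochains.res n ζ) j l (by omega) g := by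
  obtain rfl : n = j + l - 1 := by omega
  rfl

theorem totalD_congr (T : HomSeries G E E 1) (n n' : ℤ) (h : n + 1 = n') {ζ ξ : Cochains G E}
    (hz : Cochains.res n ζ = Cochains.res n ξ) :
    Cochains.res n' (totalD T ζ) = Cochains.res n' (totalD T ξ) := by
  funext i
  apply Subtype.ext
  funext x y g
  refine (totalD_res T n n' h ζ _ _ i.2 g).trans ?_
  rw [hz]
  exact (totalD_res T n n' h ξ _ _ i.2 g).symm

theorem Cochains.add_rmul (η ζ : Cochains G E) {j : ℕ} (f : SCochain G j) :
    (η + ζ).rmul f = η.rmul f + ζ.rmul f := by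
  refine ext_apply fun k l x y g => ?_
  change _ = (η.rmul f k l).1 x y g + (ζ.rmul f k l).1 x y g
  by_cases hk : k < j
  · rw [rmul_of_lt _ _ _ _ hk, rmul_of_lt _ _ _ _ hk, rmul_of_lt _ _ _ _ hk]
    exact (add_zero _).symm
  obtain ⟨q, rfl⟩ : ∃ q, k = q + j := ⟨k - j, by omega⟩
  rw [rmul_apply _ _ _ q _ rfl, rmul_apply _ _ _ q _ rfl, rmul_apply _ _ _ q _ rfl]
  exact smul_add _ _ _

/-- The operator `η ↦ ∑ₖ Tₖ ⋆ η + D̂₀ η` in a given total degree. -/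
def totalDTot (T : HomSeries G E E 1) (n n' : ℤ) : Tot G E n →ₗ[ℝ] Tot G E n' :=
  Cochains.res n' ∘ₗ totalD T ∘ₗ Cochains.ext n

theorem totalDTot_res (T : HomSeries G E E 1) (n n' : ℤ) (h : n + 1 = n') (ζ : Cochains G E) :
    totalDTot T n n' (Cochains.res n ζ) = Cochains.res n' (totalD T ζ) :=
  totalD_congr T n n' h (Cochains.res_ext n _)

theorem totalD_rmul (T : HomSeries G E E 1) (ζ : Cochains G E) {j : ℕ} (f : SCochain G j)
    (k : ℕ) (l : ℤ) {x y : M} (g : G.Str k x y) :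
    (totalD T (ζ.rmul f) k l).1 x y g = ((totalD T ζ).rmul f k l).1 x y g +
      (-1 : ℝ) ^ ((k : ℤ) + l - 1 - j) • (ζ.rmul (delta f) k l).1 x y g := by
  rw [totalD_apply', star_rmul, hatD_rmul, ← add_assoc, totalD_apply, Cochains.add_rmul]
  rfl

theorem totalDTot_rmul (T : HomSeries G E E 1) (n n₁ n₂ n₃ : ℤ) (j : ℕ) (h : n + 1 = n₁)
    (h₂ : n + j = n₂) (h₃ : n₂ + 1 = n₃) (ζ : Cochains G E) (f : SCochain G j) :
    totalDTot T n₂ n₃ (rmul (Cochains.res n ζ) f n₂ h₂) =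
      rmul (totalDTot T n n₁ (Cochains.res n ζ)) f n₃ (by omega) +
      (-1 : ℝ) ^ n • rmul (Cochains.res n ζ) (delta f) n₃ (by push_cast; omega) := by
  rw [rmul_res, totalDTot_res _ _ _ h₃, totalDTot_res _ _ _ h, rmul_res, rmul_res]
  funext i
  apply Subtype.ext
  funext x y g
  refine (totalD_rmul T ζ f i.1.1 i.1.2 g).trans ?_
  have h4 : (i.1.1 : ℤ) + i.1.2 - 1 - j = n := by have := i.2; omega
  rw [h4]
  rfl

/-- The representation up to homotopy with given components. -/
def RepUpToHomotopy.ofSeries (T : HomSeries G E E 1) (hT : totalD T * totalD T = 0) :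
    RepUpToHomotopy G E where
  D n n' _ := totalDTot T n n'
  D_sq n n' n'' h h' η := by
    rw [← Cochains.res_ext n η, totalDTot_res _ _ _ h, totalDTot_res _ _ _ h']
    exact congrArg (fun f : Module.End ℝ (Cochains G E) => Cochains.res n'' (f (Cochains.ext n η))) hT
  leibniz n n₁ n₂ n₃ j h h₂ h₃ η f := by
    have h1 := totalDTot_rmul T n n₁ n₂ n₃ j h h₂ h₃ (Cochains.ext n η) f
    rwa [Cochains.res_ext] at h1

theorem RepUpToHomotopy.hasComponents_ofSeries (T : HomSeries G E E 1)
    (hT : totalD T * totalD T = 0) : (RepUpToHomotopy.ofSeries T hT).HasComponents T.fn where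
  smooth := T.isSmooth
  eq n n' hn η j l h x y g := by
    refine (totalD_res T n n' hn (Cochains.ext n η) j l h g).trans ?_
    rw [Cochains.res_ext]

namespace RepUpToHomotopy.HasComponents

variable {A : RepUpToHomotopy G E} {R : ∀ k : ℕ, HomCochain G E E k (1 - k)}

theorem D_res (hR : A.HasComponents R) (n n' : ℤ) (h : n + 1 = n') (η : Cochains G E) :
    A.D n n' h (Cochains.res n η) =
      Cochains.res n' (totalD (HomSeries.mk R hR.smooth) η) := by
  funext i
  apply Subtype.ext
  funext x y g
  exact (hR.eq n n' h _ _ _ i.2 x y g).trans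
    (totalD_res (HomSeries.mk R hR.smooth) n n' h η _ _ i.2 g).symm

/-- The component of D²η in bidegree (j, l) depends only on the part of η of total degree j + l − 2,
so the identity in each total degree gives it on the whole product. -/
theorem totalD_sq (hR : A.HasComponents R) :
    totalD (HomSeries.mk R hR.smooth) * totalD (HomSeries.mk R hR.smooth) = 0 := by
  refine LinearMap.ext fun η => Cochains.ext_apply fun j l x y g => ?_
  have h1 := A.D_sq (j + l - 2) (j + l - 1) (j + l) (by ring) (by ring)
    (Cochains.res (j + l - 2) η)
  rw [hR.D_res, hR.D_res] at h1
  exact congrArg (fun ζ : Tot G E (j + l) => (ζ ⟨(j, l), rfl⟩).1 x y g) h1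

end RepUpToHomotopy.HasComponents

/-- The morphism with given components. -/
def RepUpToHomotopy.Morphism.ofSeries {A : RepUpToHomotopy G E} {B : RepUpToHomotopy G F}
    (φ : HomSeries G E F 0)
    (hφ : ∀ (n n' : ℤ) (h : n + 1 = n') (η : Tot G E n),
      starTot φ n' n' (by ring) (A.D n n' h η) = B.D n n' h (starTot φ n n (by ring) η)) :
    RepUpToHomotopy.Morphism A B where
  map n := starTot φ n n (by ring)
  map_rmul n n' j h η f := by
    have h1 : rmul η f n' h = Cochains.res n' ((Cochains.ext n η).rmul f) := by
      rw [← rmul_res _ f n n' h, Cochains.res_ext]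
    conv_rhs => rw [← Cochains.res_ext n η]
    rw [h1, starTot_res, starTot_res, star_rmul, rmul_res]
  comm := hφ

end TotalD

/-! ### Nilpotency of the perturbation. -/

section Transfer

variable {G : LieGroupoid m d M G₁} {E F H : GradedBundle.{u, v} m M}

/-- Fibrewise linear maps of degree zero. -/
def FibMaps.ofDegZero (T : ∀ l x, (E.deg l).Fib x →ₗ[ℝ] (F.deg l).Fib x) : FibMaps E F 0 :=
  fun l l' h x => (show l = l' by simpa using h).rec
    (motive := fun l' _ => (E.deg l).Fib x →ₗ[ℝ] (F.deg l').Fib x) (T l x)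

theorem FibMaps.isSmooth_ofDegZero {T : ∀ l x, (E.deg l).Fib x →ₗ[ℝ] (F.deg l).Fib x}
    (hT : ∀ (l : ℤ) (n : ℕ) (b : Eu n → M) (w : ∀ z, (E.deg l).Fib (b z)),
      (E.deg l).SmoothAlong b w → (F.deg l).SmoothAlong b (fun z => T l (b z) (w z))) :
    (FibMaps.ofDegZero T).IsSmooth := by
  intro l l' h n b w hw
  obtain rfl : l = l' := by simpa using h
  exact hT l n b w hw

theorem star_ofDegZero {T : ∀ l x, (E.deg l).Fib x →ₗ[ℝ] (F.deg l).Fib x}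
    (hT : (FibMaps.ofDegZero T).IsSmooth) (η : Cochains G E) (j : ℕ) (l : ℤ) {x y : M}
    (g : G.Str j x y) : (star (ofFib G _ hT) η j l).1 x y g = T l x ((η j l).1 x y g) :=
  star_ofFib _ hT η l l (add_zero l) g

/-- The components of `η` with values in `E^l` vanish for `l > c`. -/
def Cochains.VanishAbove (c : ℤ) (η : Cochains G E) : Prop :=
  ∀ (j : ℕ) (l : ℤ), c < l → η j l = 0

theorem star_tail_vanishAbove (T : HomSeries G E E 1) {c : ℤ} {η : Cochains G E}
    (hη : η.VanishAbove c) : (star T.tail η).VanishAbove c := by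
  intro j l hl
  apply Subtype.ext
  funext x y g
  rw [star_apply]
  refine Finset.sum_eq_zero fun k _ => ?_
  obtain ⟨_ | k, hk⟩ := k
  · exact smul_zero _
  · rw [starTerm, hη _ _ (by push_cast; omega)]
    exact (congrArg _ (map_zero _)).trans (smul_zero _)

theorem hatD_vanishAbove {c : ℤ} {η : Cochains G E} (hη : η.VanishAbove c) :
    (hatD η).VanishAbove c := by
  intro j l hl
  apply Subtype.ext
  funext x y g
  cases j with
  | zero => rfl
  | succ k =>
    rw [hatD_succ, hη _ _ hl]
    exact (congrArg _ ((congrArg₂ (· + ·) (Finset.sum_eq_zero fun i _ => smul_zero _)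
        (smul_zero _)).trans (add_zero _))).trans (smul_zero _)

theorem star_ofFib_vanishAbove {e : ℤ} {T : FibMaps E F e} (hT : T.IsSmooth) {c : ℤ}
    {η : Cochains G E} (hη : η.VanishAbove c) : (star (ofFib G T hT) η).VanishAbove (c + e) := by
  intro j l hl
  apply Subtype.ext
  funext x y g
  rw [star_ofFib T hT η (l - e) l (by ring), hη _ _ (by omega)]
  exact map_zero _

theorem cochain_eq_zero_of_rank {V : SmoothVectorBundle.{u, v} m M} (hV : V.rank = 0) {k : ℕ}
    (η : Cochain G k V) : η = 0 := by
  apply Subtype.ext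
  funext x y g
  have h1 : Module.finrank ℝ (V.Fib x) = 0 := (V.finrank_fib x).trans hV
  have := Module.finrank_zero_iff.1 h1
  exact Subsingleton.elim _ _

/-- The sections Tₖ with k ≥ 1 shift the degree of E by 1 − k ≤ 0 and D̂₀ preserves it, while h
lowers it by one. After n steps nothing is left above degree b − n. -/
theorem isNilpotent_perturbation (T : HomSeries G E E 1) {h : FibMaps E E (-1)} (hh : h.IsSmooth) :
    ∃ N : ℕ, 0 < N ∧ ((star T.tail + hatD : Module.End ℝ (Cochains G E)) *
      (star (ofFib G h hh) : Module.End ℝ (Cochains G E))) ^ N = 0 := by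
  obtain ⟨a, b, hab⟩ := E.bounded
  set X : Module.End ℝ (Cochains G E) := (star T.tail + hatD : Module.End ℝ (Cochains G E)) *
      (star (ofFib G h hh) : Module.End ℝ (Cochains G E)) with hX
  have h1 : ∀ (n : ℕ) (η : Cochains G E), ((X ^ n) η).VanishAbove (b - n) := by
    intro n η
    induction n with
    | zero =>
      intro j l hl
      exact cochain_eq_zero_of_rank (hab l (Or.inr (by simpa using hl))) _
    | succ n ih =>
      have h2 := star_ofFib_vanishAbove hh ih
      have h3 : (b : ℤ) - n + -1 = b - (n + 1 : ℕ) := by push_cast; ring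
      rw [h3] at h2
      rw [pow_succ']
      intro j l hl
      exact (congrArg₂ (· + ·) (star_tail_vanishAbove T h2 j l hl)
        (hatD_vanishAbove h2 j l hl)).trans (add_zero _)
  -- The final summand 1 keeps the exponent positive even when the bounds a, b describe an empty
  -- range; the term n = 0 of the geometric sum is then always present.
  refine ⟨(b - a + 1).toNat + 1, by omega, LinearMap.ext fun η => ?_⟩
  funext j l
  by_cases hl : l < a
  · exact cochain_eq_zero_of_rank (hab l (Or.inl hl)) _
  · exact h1 _ η j l (by omega)

end Transfer

/-! ### The transferred differential and the perturbed projection. -/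

section Transfer

variable {G : LieGroupoid m d M G₁} {E H : GradedBundle.{u, v} m M}

namespace Contraction

variable {bd : FibMaps E E 1} (c : Contraction bd H)

theorem isSmooth_p : (FibMaps.ofDegZero c.p).IsSmooth := FibMaps.isSmooth_ofDegZero c.p_smooth

theorem isSmooth_i : (FibMaps.ofDegZero c.i).IsSmooth := FibMaps.isSmooth_ofDegZero c.i_smooth

variable (G)

/-- The homotopy as an operator on cochains. -/
def hOp : Module.End ℝ (Cochains G E) := star (ofFib G c.h c.h_smooth)

/-- The projection as an operator on cochains. -/
def pOp : Cochains G E →ₗ[ℝ] Cochains G H := star (ofFib G _ c.isSmooth_p)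

/-- The inclusion as an operator on cochains. -/
def iOp : Cochains G H →ₗ[ℝ] Cochains G E := star (ofFib G _ c.isSmooth_i)

variable {G}

theorem hOp_apply (η : Cochains G E) {j : ℕ} (l l' : ℤ) (h : l + -1 = l') {x y : M}
    (g : G.Str j x y) : (c.hOp G η j l').1 x y g = c.h l l' h x ((η j l).1 x y g) :=
  star_ofFib _ _ _ _ _ _ _

theorem pOp_apply (η : Cochains G E) (j : ℕ) (l : ℤ) {x y : M} (g : G.Str j x y) :
    (c.pOp G η j l).1 x y g = c.p l x ((η j l).1 x y g) :=
  star_ofDegZero _ _ _ _ _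

theorem iOp_apply (η : Cochains G H) (j : ℕ) (l : ℤ) {x y : M} (g : G.Str j x y) :
    (c.iOp G η j l).1 x y g = c.i l x ((η j l).1 x y g) :=
  star_ofDegZero _ _ _ _ _

theorem hOp_hOp (η : Cochains G E) : c.hOp G (c.hOp G η) = 0 :=
  Cochains.ext_apply fun j l x y g => by
    rw [c.hOp_apply _ (l + 1) l (by ring), c.hOp_apply _ (l + 2) (l + 1) (by ring), c.h_h]
    rfl

theorem hOp_iOp (η : Cochains G H) : c.hOp G (c.iOp G η) = 0 :=
  Cochains.ext_apply fun j l x y g => by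
    rw [c.hOp_apply _ (l + 1) l (by ring), c.iOp_apply, c.h_i]
    rfl

theorem pOp_hOp (η : Cochains G E) : c.pOp G (c.hOp G η) = 0 :=
  Cochains.ext_apply fun j l x y g => by
    rw [c.pOp_apply, c.hOp_apply _ (l + 1) l (by ring), c.p_h]
    rfl

theorem pOp_iOp (η : Cochains G H) : c.pOp G (c.iOp G η) = η :=
  Cochains.ext_apply fun j l x y g => by rw [c.pOp_apply, c.iOp_apply, c.p_i]

theorem hatD_hOp (η : Cochains G E) : hatD (c.hOp G η) = -c.hOp G (hatD η) := by
  refine (hatD_star_ofFib c.h c.h_smooth η).trans ?_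
  rw [zpow_neg_one, inv_neg, inv_one, neg_one_smul]
  rfl

theorem hatD_pOp (η : Cochains G E) : hatD (c.pOp G η) = c.pOp G (hatD η) := by
  refine (hatD_star_ofFib _ c.isSmooth_p η).trans ?_
  rw [zpow_zero, one_smul]
  rfl

theorem hatD_iOp (η : Cochains G H) : hatD (c.iOp G η) = c.iOp G (hatD η) := by
  refine (hatD_star_ofFib _ c.isSmooth_i η).trans ?_
  rw [zpow_zero, one_smul]
  rfl

variable (hbd : bd.IsSmooth)

theorem pOp_bd (η : Cochains G E) : c.pOp G (star (ofFib G bd hbd) η) = 0 :=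
  Cochains.ext_apply fun j l x y g => by
    rw [c.pOp_apply, star_ofFib bd hbd _ (l - 1) l (by ring), c.p_bd]
    rfl

theorem bd_iOp (η : Cochains G H) : star (ofFib G bd hbd) (c.iOp G η) = 0 :=
  Cochains.ext_apply fun j l x y g => by
    rw [star_ofFib bd hbd _ (l - 1) l (by ring), c.iOp_apply, c.bd_i]
    rfl

theorem iOp_pOp (η : Cochains G E) : c.iOp G (c.pOp G η) =
    η - star (ofFib G bd hbd) (c.hOp G η) - c.hOp G (star (ofFib G bd hbd) η) :=
  Cochains.ext_apply fun j l x y g => by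
    rw [c.iOp_apply, c.pOp_apply, c.i_p l (l - 1) (l + 1) (by ring) (by ring) rfl (by ring)]
    change _ = (η j l).1 x y g - (star (ofFib G bd hbd) (c.hOp G η) j l).1 x y g -
      (c.hOp G (star (ofFib G bd hbd) η) j l).1 x y g
    rw [star_ofFib bd hbd _ (l - 1) l (by ring), c.hOp_apply _ l (l - 1) (by ring),
      c.hOp_apply _ (l + 1) l (by ring), star_ofFib bd hbd _ l (l + 1) rfl]

variable (T : HomSeries G E E 1)

/-- The terms of the series of the perturbed projection. -/
def transferTerm : ℕ → HomSeries G E H 0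
  | 0 => ofFib G _ c.isSmooth_p
  | n + 1 => (transferTerm n).comp (-(T.tail.comp (ofFib G c.h c.h_smooth) 0 (by norm_num))) 0
      (by norm_num)

theorem star_transferTerm (n : ℕ) (η : Cochains G E) : star (c.transferTerm T n) η =
    c.pOp G (((-((star T.tail : Module.End ℝ (Cochains G E)) * c.hOp G)) ^ n) η) := by
  induction n generalizing η with
  | zero => rfl
  | succ n ih =>
    rw [transferTerm, star_comp, ih, pow_succ, map_neg, LinearMap.neg_apply, star_comp]
    rfl

/-- The part of positive degree of the differential. -/
abbrev pert : Module.End ℝ (Cochains G E) := star T.tail + hatD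

/-- The perturbation contains D̂₀, which is not multiplication by sections, but it drops out: pD̂₀h
= D̂₀ph = 0, and hD̂₀h = −D̂₀hh = 0 removes every later occurrence. Hence p u is given by a series
of sections, as a morphism must be. -/
theorem pOp_pert_pow (n : ℕ) (η : Cochains G E) :
    c.pOp G (((-(pert T * c.hOp G)) ^ n) η) = star (c.transferTerm T n) η := by
  rw [star_transferTerm]
  set b : Module.End ℝ (Cochains G E) := -((star T.tail : Module.End ℝ (Cochains G E)) * c.hOp G)
    with hb
  have h1 : ∀ η, (-(pert T * c.hOp G)) η = b η - hatD (c.hOp G η) := by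
    intro η
    change -(star T.tail (c.hOp G η) + hatD (c.hOp G η)) = -(star T.tail (c.hOp G η)) - _
    abel
  have h2 : ∀ n η, c.pOp G ((b ^ n) (hatD (c.hOp G η))) = 0 := by
    intro n η
    cases n with
    | zero =>
      change c.pOp G (hatD (c.hOp G η)) = 0
      rw [← hatD_pOp, pOp_hOp, map_zero]
    | succ n =>
      rw [pow_succ]
      change c.pOp G ((b ^ n) (-(star T.tail (c.hOp G (hatD (c.hOp G η)))))) = 0
      have h3 : c.hOp G (hatD (c.hOp G η)) = 0 := by
        rw [← neg_eq_zero, ← hatD_hOp, hOp_hOp, map_zero]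
      rw [h3, map_zero, neg_zero, map_zero, map_zero]
  induction n generalizing η with
  | zero => rfl
  | succ n ih =>
    rw [pow_succ, Module.End.mul_apply, ih, h1, map_sub, map_sub, h2, sub_zero, pow_succ,
      Module.End.mul_apply]

theorem transferTerm_nil (n : ℕ) (l : ℤ) (x : M) :
    (c.transferTerm T n).fn 0 l l (by simp) (nil x) = if n = 0 then c.p l x else 0 := by
  cases n with
  | zero => rfl
  | succ n =>
    rw [transferTerm, HomSeries.comp_nil _ _ _ _ l l l _ (by simp) (by simp), if_neg (by omega)]
    have h1 : (-(T.tail.comp (ofFib G c.h c.h_smooth) 0 (by norm_num))).fn 0 l l (by simp)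
        (nil x) = 0 := by
      change -((T.tail.comp (ofFib G c.h c.h_smooth) 0 _).fn 0 l l _ (nil x)) = 0
      rw [HomSeries.comp_nil _ _ _ _ l (l - 1) l _ (by push_cast; ring) (by push_cast; ring),
        HomSeries.tail_zero, LinearMap.zero_comp, neg_zero]
    rw [h1, LinearMap.comp_zero]

/-- The series of the perturbed projection. -/
def transfer (N : ℕ) : HomSeries G E H 0 := ∑ n ∈ Finset.range N, c.transferTerm T n

/-- The series of the transferred differential. -/
def transferD (N : ℕ) : HomSeries G H H 1 :=
  ((c.transfer T N).comp T.tail 1 (by norm_num)).comp (ofFib G _ c.isSmooth_i) 1 (by norm_num)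

theorem transfer_nil {N : ℕ} (hN : 0 < N) (l : ℤ) (x : M) :
    (c.transfer T N).fn 0 l l (by simp) (nil x) = c.p l x := by
  let f : HomSeries G E H 0 →+ ((E.deg l).Fib x →ₗ[ℝ] (H.deg l).Fib x) :=
    { toFun := fun S => S.fn 0 l l (by simp) (nil x)
      map_zero' := rfl
      map_add' := fun _ _ => rfl }
  change f (c.transfer T N) = _
  rw [transfer, map_sum, Finset.sum_eq_single 0]
  · rfl
  · intro n _ hn
    exact (c.transferTerm_nil T n l x).trans (if_neg hn)
  · intro h
    exact absurd (Finset.mem_range.2 hN) h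

theorem transferD_nil (N : ℕ) (l l' : ℤ) (h : l + (1 - (0 : ℕ)) = l') (x : M) :
    (c.transferD T N).fn 0 l l' h (nil x) = 0 := by
  rw [transferD, HomSeries.comp_nil _ _ _ _ l l l' _ (by simp) h,
    HomSeries.comp_nil _ _ _ _ l l' l' _ h (by simp), HomSeries.tail_zero, LinearMap.comp_zero,
    LinearMap.zero_comp]

/-- The middle factor `T.tail` has no component of length zero and must take the whole arrow; the
higher terms of the perturbed projection therefore do not contribute. -/
theorem transferD_single {N : ℕ} (hN : 0 < N) (l : ℤ) {x y : M} (g : G.Arrow x y) :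
    (c.transferD T N).fn 1 l l (by simp) (single g) =
      c.p l x ∘ₗ T.fn 1 l l (by simp) (single g) ∘ₗ c.i l y := by
  rw [transferD, HomSeries.comp_single _ _ _ _ l (l - 1) l l _ (by push_cast; ring)
    (by push_cast; ring) (by simp) (by simp), ofFib_succ, LinearMap.comp_zero, zero_add, zpow_zero,
    one_smul, HomSeries.comp_single _ _ _ _ l l (l + 1) l _ (by simp) (by simp) (by simp)
    (by push_cast; ring), HomSeries.tail_zero, LinearMap.comp_zero, smul_zero, add_zero,
    c.transfer_nil T hN]
  rfl

theorem star_transfer (N : ℕ) (η : Cochains G E) : star (c.transfer T N) η =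
    c.pOp G ((∑ n ∈ Finset.range N, (-(pert T * c.hOp G)) ^ n) η) := by
  rw [transfer, map_sum, LinearMap.sum_apply, LinearMap.sum_apply, map_sum]
  exact Finset.sum_congr rfl fun n _ => (c.pOp_pert_pow T n η).symm

/-- The series only involves `T.tail`; what remains is that p u D̂₀ i = D̂₀. Since D̂₀i = iD̂₀ and
hi = 0, only the term n = 0 of u survives, and pi = 1. -/
theorem totalD_transferD {N : ℕ} (hN : 0 < N) (η : Cochains G H) :
    totalD (c.transferD T N) η = star (c.transfer T N) (pert T (c.iOp G η)) := by
  have h1 : star (c.transfer T N) (hatD (c.iOp G η)) = hatD η := by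
    rw [hatD_iOp, star_transfer, LinearMap.sum_apply, map_sum, Finset.sum_eq_single 0]
    · exact c.pOp_iOp _
    · intro n _ hn
      obtain ⟨k, rfl⟩ := Nat.exists_eq_succ_of_ne_zero hn
      rw [pow_succ, Module.End.mul_apply, LinearMap.neg_apply, Module.End.mul_apply, hOp_iOp,
        map_zero, neg_zero, map_zero, map_zero]
    · intro h
      exact absurd (Finset.mem_range.2 hN) h
  rw [totalD_apply, transferD, star_comp, star_comp, LinearMap.add_apply, map_add, h1]
  rfl

end Contraction

theorem exists_transfer (T : HomSeries G E E 1) (hT : totalD T * totalD T = 0)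
    (hbd : ∀ (l l' l'' : ℤ) (hl : l + 1 = l') (hl' : l' + 1 = l'') x v,
      T.base l' l'' hl' x (T.base l l' hl x v) = 0) (c : Contraction T.base H) :
    ∃ (φ : HomSeries G E H 0) (T' : HomSeries G H H 1), totalD T' * totalD T' = 0 ∧
      (∀ η, star φ (totalD T η) = totalD T' (star φ η)) ∧
      (∀ l x, φ.fn 0 l l (by simp) (nil x) = c.p l x) ∧
      (∀ l l' h x, T'.fn 0 l l' h (nil x) = 0) ∧
      ∀ (l : ℤ) (x y : M) (g : G.Arrow x y), T'.fn 1 l l (by simp) (single g) =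
        c.p l x ∘ₗ T.fn 1 l l (by simp) (single g) ∘ₗ c.i l y := by
  obtain ⟨N, hN, hnil⟩ := isNilpotent_perturbation T c.h_smooth
  set d : Module.End ℝ (Cochains G E) := star (ofFib G T.base T.isSmooth_base) with hd
  set x : Module.End ℝ (Cochains G E) := Contraction.pert T * c.hOp G with hx
  set u : Module.End ℝ (Cochains G E) := ∑ n ∈ Finset.range N, (-x) ^ n with hu
  have h1 : d + Contraction.pert T = totalD T := by
    rw [totalD, hd, Contraction.pert, ← add_assoc, ← map_add, T.base_add_tail]
  have h2 : d * d = 0 := LinearMap.ext fun η => Cochains.ext_apply fun j l x y g => by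
    change (star (ofFib G T.base T.isSmooth_base) (star (ofFib G T.base T.isSmooth_base) η) j l).1
      x y g = 0
    rw [star_ofFib _ _ _ (l - 1) l (by ring), star_ofFib _ _ _ (l - 2) (l - 1) (by ring), hbd]
  have h3 : (-x) ^ N = 0 := (neg_pow x N).trans ((congrArg _ hnil).trans (mul_zero _))
  have h4 : u * (1 + x) = 1 := by
    have := geom_sum_mul_neg (-x) N
    rwa [sub_neg_eq_add, h3, sub_zero] at this
  have h5 : (1 + x) * u = 1 := by
    have := mul_neg_geom_sum (-x) N
    rwa [sub_neg_eq_add, h3, sub_zero] at this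
  have h6 : (d + Contraction.pert T) * (d + Contraction.pert T) = 0 := by rw [h1, hT]
  have h7 : ∀ η, star (c.transfer T N) η = c.pOp G (u η) := c.star_transfer T N
  refine ⟨c.transfer T N, c.transferD T N, ?_, ?_, c.transfer_nil T hN, c.transferD_nil T N,
    fun l x y g => c.transferD_single T hN l g⟩
  · refine LinearMap.ext fun η => ?_
    rw [Module.End.mul_apply, c.totalD_transferD T hN, c.totalD_transferD T hN, h7, h7]
    exact perturbation_sq h2 h6 h4 h5 (c.iOp_pOp T.isSmooth_base) (c.pOp_bd T.isSmooth_base)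
      (c.bd_iOp T.isSmooth_base) η
  · intro η
    rw [c.totalD_transferD T hN, h7, h7, h7, ← h1]
    exact perturbation_comm h2 h6 h4 h5 (c.iOp_pOp T.isSmooth_base) (c.pOp_bd T.isSmooth_base) η

end Transfer

/-! ### Leading components of D, and the identities obtained from D² = 0 on short strings. -/

section Evaluation

variable {G : LieGroupoid m d M G₁} {E H : GradedBundle.{u, v} m M}

theorem HomSeries.fn_zero_eq_zero {e : ℤ} {T : HomSeries G E H e}
    (hT : ∀ l l' h x, T.fn 0 l l' h (nil x) = 0) (l l' : ℤ) (h : l + (e - (0 : ℕ)) = l') {x y : M}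
    (g : G.Str 0 x y) : T.fn 0 l l' h g = 0 := by
  obtain rfl := g.eq_of_zero
  rw [g.eq_nil, hT]

/-- The components of `η` of cocycle degree less than `p` vanish. -/
def Cochains.VanishBelow (p : ℕ) (η : Cochains G E) : Prop := ∀ k < p, ∀ l, η k l = 0

theorem hatD_vanishBelow {p : ℕ} {η : Cochains G E} (hη : η.VanishBelow p) :
    (hatD η).VanishBelow (p + 1) := by
  intro k hk l
  apply Subtype.ext
  funext x y g
  cases k with
  | zero => rfl
  | succ k =>
    rw [hatD_succ, hη _ (by omega)]
    exact (congrArg _ ((congrArg₂ (· + ·) (Finset.sum_eq_zero fun i _ => smul_zero _)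
        (smul_zero _)).trans (add_zero _))).trans (smul_zero _)

theorem star_vanishBelow {e : ℤ} {T : HomSeries G E H e}
    (hT : ∀ l l' h x, T.fn 0 l l' h (nil x) = 0) {p : ℕ} {η : Cochains G E}
    (hη : η.VanishBelow p) : (star T η).VanishBelow (p + 1) := by
  intro j hj l
  apply Subtype.ext
  funext x y g
  rw [star_apply]
  refine Finset.sum_eq_zero fun k _ => ?_
  obtain ⟨_ | k, hk⟩ := k
  · rw [starTerm, HomSeries.fn_zero_eq_zero hT]
    exact smul_zero _
  · rw [starTerm, hη _ (by change j - (k + 1) < p; omega)]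
    exact (congrArg _ (map_zero _)).trans (smul_zero _)

theorem totalD_vanishBelow {T : HomSeries G E E 1}
    (hT : ∀ l l' h x, T.fn 0 l l' h (nil x) = 0) {p : ℕ} {η : Cochains G E}
    (hη : η.VanishBelow p) : (totalD T η).VanishBelow (p + 1) := fun k hk l =>
  (congrArg₂ (· + ·) (star_vanishBelow hT hη k hk l) (hatD_vanishBelow hη k hk l)).trans
    (add_zero _)

theorem star_eq_base_add_tail {e : ℤ} (T : HomSeries G E H e) (η : Cochains G E) (j : ℕ)
    (l l' : ℤ) (h : l + e = l') {x y : M} (g : G.Str j x y) :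
    (star T η j l').1 x y g = T.base l l' h x ((η j l).1 x y g) + (star T.tail η j l').1 x y g := by
  conv_lhs => rw [← T.base_add_tail]
  rw [← star_ofFib T.base T.isSmooth_base η l l' h g, map_add]
  rfl

theorem star_apply_of_vanishBelow {e : ℤ} (T : HomSeries G E H e) {p : ℕ} {η : Cochains G E}
    (hη : η.VanishBelow p) (l l' : ℤ) (h : l + e = l') {x y : M} (g : G.Str p x y) :
    (star T η p l').1 x y g = T.base l l' h x ((η p l).1 x y g) := by
  rw [star_eq_base_add_tail T η p l l' h, star_vanishBelow (fun _ _ _ _ => rfl) hη p (by omega)]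
  exact add_zero _

theorem totalD_eq_base_add_tail (T : HomSeries G E E 1) (η : Cochains G E) (j : ℕ) (l l' : ℤ)
    (h : l + 1 = l') {x y : M} (g : G.Str j x y) : (totalD T η j l').1 x y g =
      T.base l l' h x ((η j l).1 x y g) + (totalD T.tail η j l').1 x y g := by
  rw [totalD_apply', star_eq_base_add_tail T η j l l' h, add_assoc]
  rfl

theorem totalD_apply_of_vanishBelow (T : HomSeries G E E 1) {p : ℕ} {η : Cochains G E}
    (hη : η.VanishBelow p) (l l' : ℤ) (h : l + 1 = l') {x y : M} (g : G.Str p x y) :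
    (totalD T η p l').1 x y g = T.base l l' h x ((η p l).1 x y g) := by
  rw [totalD_eq_base_add_tail T η p l l' h, totalD_vanishBelow (fun _ _ _ _ => rfl) hη p (by omega)]
  exact add_zero _

theorem _root_.LieRep.LieGroupoid.Str.front_one {k : ℕ} {x y : M} (g : G.Str (k + 1) x y) :
    g.front 1 (by omega) = single g.head := by
  ext i
  · obtain ⟨_ | _ | i, hi⟩ := i
    · exact g.pt_zero
    · rfl
    · omega
  · obtain ⟨i, hi⟩ := i
    obtain rfl : i = 0 := by omega
    rfl

/-- When R₀ = 0, only R₁ and D̂₀ can reach cocycle degree p + 1 from cochains that start in degree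
p. The common sign is that of the total degree p + l, and the bracket is the one in
`GroupoidRep.diff`. -/
theorem totalD_succ_apply {T : HomSeries G E E 1} (hT : ∀ l l' h x, T.fn 0 l l' h (nil x) = 0)
    {p : ℕ} {η : Cochains G E} (hη : η.VanishBelow p) (l : ℤ) {x y : M} (g : G.Str (p + 1) x y) :
    (totalD T η (p + 1) l).1 x y g = (-1 : ℝ) ^ ((p : ℤ) + l) •
      (T.fn 1 l l (by simp) (single g.head) ((η p l).1 _ _ (g.back 1 p (by omega))) +
        ∑ i : Fin p, (-1 : ℝ) ^ ((i : ℕ) + 1) • (η p l).1 _ _ (g.inner i) +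
        (-1 : ℝ) ^ (p + 1) • (η p l).1 _ _ (g.front p (by omega))) := by
  rw [totalD_apply', hatD_succ, star_apply, Finset.sum_eq_single (⟨1, by omega⟩ : Fin (p + 1 + 1))]
  · rw [starTerm_congr T η g _ _ p _ (by change 1 + p = p + 1; omega) _ l _
      (by change l + (1 - ((1 : ℕ) : ℤ)) = l; simp), starTerm]
    change (-1 : ℝ) ^ (((1 : ℕ) : ℤ) * (p + l)) • T.fn 1 l l _ (g.front 1 _) _ + _ = _
    have e : ((1 : ℕ) : ℤ) * (p + l) = p + l := by simp
    rw [g.front_one, e, ← smul_add, ← add_assoc]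
  · intro k _ hk
    obtain ⟨_ | _ | k, hk'⟩ := k
    · rw [starTerm, HomSeries.fn_zero_eq_zero hT]
      exact smul_zero _
    · exact absurd rfl hk
    · rw [starTerm, hη _ (by change p + 1 - (k + 1 + 1) < p; omega)]
      exact (congrArg _ (map_zero _)).trans (smul_zero _)
  · intro h
    exact absurd (Finset.mem_univ _) h

/-- A string of length one as an arrow. -/
def _root_.LieRep.LieGroupoid.Str.toArrow {x y : M} (g : G.Str 1 x y) : G.Arrow x y where
  val := g.arr 0
  tgt_eq := (g.tgt_arr 0).trans g.pt_zero
  src_eq := (g.src_arr 0).trans g.pt_last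

theorem totalD_one_apply {T : HomSeries G E E 1} (hT : ∀ l l' h x, T.fn 0 l l' h (nil x) = 0)
    {η : Cochains G E} (l : ℤ) {s : ∀ x, (E.deg l).Fib x}
    (hs : ∀ x y (g : G.Str 0 x y), (η 0 l).1 x y g = s x) {x y : M} (g : G.Str 1 x y) :
    (totalD T η 1 l).1 x y g = (-1 : ℝ) ^ l •
      (T.fn 1 l l (by simp) (single g.toArrow) (s y) - s x) := by
  refine (totalD_succ_apply hT (η := η) (p := 0) (fun k hk => absurd hk (by omega)) l g).trans ?_
  have key : ∀ v w : (E.deg l).Fib x, v - w = v + (-1 : ℝ) • w := fun v w => by module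
  rw [hs, hs, Fin.sum_univ_zero, add_zero, key]
  obtain ⟨pt, arr, ta, sa, rfl, rfl⟩ := g
  congr 1
  · congr 1
    exact zero_add l
  · congr 2
    exact pow_one _

theorem exists_cochains [IsManifold (𝓡 m) ∞ M] [T2Space M] [SecondCountableTopology M]
    (l : ℤ) (x₀ : M) (v : (E.deg l).Fib x₀) :
    ∃ (η : Cochains G E) (s : ∀ x, (E.deg l).Fib x),
      (∀ x y (g : G.Str 0 x y), (η 0 l).1 x y g = s x) ∧ s x₀ = v := by
  obtain ⟨s, hs, hsv⟩ := (E.deg l).exists_section x₀ v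
  let σ : Cochain G 0 (E.deg l) := ⟨fun x _ _ => s x, fun n x y c hc => hs.comp hc.smooth_tgt⟩
  refine ⟨Pi.single 0 (Pi.single l σ), s, fun x y g => ?_, hsv⟩
  rw [Pi.single_eq_same, Pi.single_eq_same]

variable {T : HomSeries G E E 1} [IsManifold (𝓡 m) ∞ M] [T2Space M] [SecondCountableTopology M]

/-- D² = 0 in cocycle degree zero, evaluated on a section through `v`. -/
theorem base_base (hT : totalD T * totalD T = 0) (l l' l'' : ℤ) (hl : l + 1 = l')
    (hl' : l' + 1 = l'') (x : M) (v : (E.deg l).Fib x) :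
    T.base l' l'' hl' x (T.base l l' hl x v) = 0 := by
  obtain ⟨η, s, hs, rfl⟩ := exists_cochains (G := G) l x v
  rw [← hs x x (nil x),
    ← totalD_apply_of_vanishBelow T (fun k hk => absurd hk (by omega)) l l' hl,
    ← totalD_apply_of_vanishBelow T (fun k hk => absurd hk (by omega)) l' l'' hl']
  exact congrArg (fun f : Module.End ℝ (Cochains G E) => (f η 0 l'').1 x x (nil x)) hT

/-- D² = 0 on one arrow. In degrees l and l' = l + 1 the operator yields λs − s and λ∂s − ∂s with
opposite signs, so the terms ∂s at the target of `g` cancel. -/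
theorem base_comm (hT : totalD T * totalD T = 0) (l l' : ℤ) (hl : l + 1 = l') {x y : M}
    (g : G.Arrow x y) (v : (E.deg l).Fib y) :
    T.base l l' hl x (T.fn 1 l l (by simp) (single g) v) =
      T.fn 1 l' l' (by simp) (single g) (T.base l l' hl y v) := by
  obtain ⟨η, s, hs, rfl⟩ := exists_cochains (G := G) l y v
  have h1 : (totalD T (totalD T η) 1 l').1 x y (single g) = 0 :=
    congrArg (fun f : Module.End ℝ (Cochains G E) => (f η 1 l').1 x y (single g)) hT
  -- The component of η in bidegree (1, l − 1) is not controlled; it enters only through ∂∂ and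
  -- disappears.
  rw [totalD_eq_base_add_tail T _ 1 l l' hl, totalD_eq_base_add_tail T _ 1 (l - 1) l (by ring),
    map_add, base_base hT, zero_add, totalD_one_apply (fun _ _ _ _ => rfl) l hs,
    totalD_one_apply (fun _ _ _ _ => rfl) l' (s := fun x => T.base l l' hl x (s x))
      (fun x y g => by
        rw [totalD_apply_of_vanishBelow T (fun k hk => absurd hk (by omega)) l l' hl, hs])] at h1
  have h2 : (-1 : ℝ) ^ l' = -(-1 : ℝ) ^ l := by
    rw [← hl, zpow_add_one₀ (by norm_num)]
    ring
  rw [h2, map_smul, map_sub, neg_smul, ← sub_eq_add_neg, ← smul_sub, sub_sub_sub_cancel_right,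
    smul_eq_zero] at h1
  exact sub_eq_zero.1 (h1.resolve_left (zpow_ne_zero _ (by norm_num)))

/-- Two composable arrows as a string. -/
def pair {x y z : M} (g : G.Arrow x y) (h : G.Arrow y z) : G.Str 2 x z where
  pt := ![x, y, z]
  arr := ![g.val, h.val]
  tgt_arr i := by fin_cases i; exacts [g.tgt_eq, h.tgt_eq]
  src_arr i := by fin_cases i; exacts [g.src_eq, h.src_eq]
  pt_zero := rfl
  pt_last := rfl

/-- D² = 0 on a pair of arrows, where R₀ = 0 removes the homotopy given by R₂. The values of the
section at the other two points cancel. -/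
theorem fn_one_comp (hT : totalD T * totalD T = 0)
    (h0 : ∀ l l' h x, T.fn 0 l l' h (nil x) = 0) (l : ℤ) {x y z : M} (g : G.Arrow x y)
    (h : G.Arrow y z) (v : (E.deg l).Fib z) :
    T.fn 1 l l (by simp) (single (G.comp g h)) v =
      T.fn 1 l l (by simp) (single g) (T.fn 1 l l (by simp) (single h) v) := by
  obtain ⟨η, s, hs, rfl⟩ := exists_cochains (G := G) l z v
  have h1 : (totalD T (totalD T η) 2 l).1 x z (pair g h) = 0 :=
    congrArg (fun f : Module.End ℝ (Cochains G E) => (f η 2 l).1 x z (pair g h)) hT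
  rw [totalD_succ_apply h0 (p := 1) (totalD_vanishBelow h0 (p := 0)
    (fun k hk => absurd hk (by omega))), smul_eq_zero] at h1
  replace h1 := h1.resolve_left (zpow_ne_zero _ (by norm_num))
  rw [Fin.sum_univ_one, totalD_one_apply h0 l hs, totalD_one_apply h0 l hs,
    totalD_one_apply h0 l hs] at h1
  have h2 : T.fn 1 l l (by simp) (single g)
      ((-1 : ℝ) ^ l • (T.fn 1 l l (by simp) (single h) (s z) - s y)) +
      (-1 : ℝ) ^ (0 + 1) • (-1 : ℝ) ^ l •
        (T.fn 1 l l (by simp) (single (G.comp g h)) (s z) - s x) +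
      (-1 : ℝ) ^ (1 + 1) • (-1 : ℝ) ^ l • (T.fn 1 l l (by simp) (single g) (s y) - s x) = 0 := h1
  have h3 : (-1 : ℝ) ^ l • (T.fn 1 l l (by simp) (single (G.comp g h)) (s z) -
      T.fn 1 l l (by simp) (single g) (T.fn 1 l l (by simp) (single h) (s z))) = 0 := by
    rw [← neg_eq_zero, ← h2, map_smul, map_sub]
    module
  exact sub_eq_zero.1 ((smul_eq_zero.1 h3).resolve_left (zpow_ne_zero _ (by norm_num)))

end Evaluation

/-! ### The cohomology bundle and the action on it. -/

section Cohomology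

variable {G : LieGroupoid m d M G₁} {E H : GradedBundle.{u, v} m M}

namespace Contraction

variable {bd : FibMaps E E 1} (c : Contraction bd H)

/-- The homotopy formula v = ipv + ∂hv + h∂v with pv = 0 and ∂v = 0: an explicit smooth primitive,
used in all exactness arguments. -/
theorem eq_bd_h (l l' l'' : ℤ) (hl : l + 1 = l') (hl' : l' + -1 = l) (h : l' + 1 = l'') {x : M}
    {v : (E.deg l').Fib x} (hv : bd l' l'' h x v = 0) (hp : c.p l' x v = 0) :
    v = bd l l' hl x (c.h l' l hl' x v) := by
  have h1 := c.i_p l' l l'' hl' hl h (by omega) x v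
  rw [hp, map_zero, hv, map_zero, sub_zero] at h1
  exact sub_eq_zero.1 h1.symm

section Smooth

variable [IsManifold (𝓡 m) ∞ M]

theorem smoothOn_p {l : ℤ} {w : ∀ x, (E.deg l).Fib x} {U : Set M} (hw : (E.deg l).SmoothOn w U) :
    (H.deg l).SmoothOn (fun x => c.p l x (w x)) U :=
  SmoothVectorBundle.smoothOn_of_homSmooth
    (SmoothVectorBundle.homSmoothAt_of_plots (c.p_smooth l)) hw

theorem smoothOn_i {l : ℤ} {w : ∀ x, (H.deg l).Fib x} {U : Set M} (hw : (H.deg l).SmoothOn w U) :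
    (E.deg l).SmoothOn (fun x => c.i l x (w x)) U :=
  SmoothVectorBundle.smoothOn_of_homSmooth
    (SmoothVectorBundle.homSmoothAt_of_plots (c.i_smooth l)) hw

end Smooth

end Contraction

variable [IsManifold (𝓡 m) ∞ M]

/-- The cohomology bundle defined by a contraction. -/
def Contraction.cohomologyBundle {T : HomSeries G E E 1} (c : Contraction T.base H) :
    RepUpToHomotopy.CohomologyBundle T.fn H where
  proj l x := c.p l x ∘ₗ (LinearMap.ker (RepUpToHomotopy.bdry T.fn l (l + 1) rfl x)).subtype
  proj_surjective l x w :=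
    ⟨⟨c.i l x w, LinearMap.mem_ker.2 (c.bd_i l (l + 1) rfl x w)⟩, c.p_i l x w⟩
  ker_proj l x := by
    ext v
    rw [LinearMap.mem_ker]
    constructor
    · intro hv
      exact ⟨_, (c.eq_bd_h (l - 1) l (l + 1) (by ring) (by ring) rfl
        (LinearMap.mem_ker.1 v.2) hv).symm⟩
    · rintro ⟨w, hw⟩
      change c.p l x v.1 = 0
      exact (congrArg (c.p l x) hw.symm).trans (c.p_bd (l - 1) l (by ring) x w)
  smooth_iff l U hU h := by
    constructor
    · intro hh x hx
      exact ⟨U, hU, hx, fun x => c.i l x (h x), c.smoothOn_i hh, fun y _ =>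
        ⟨LinearMap.mem_ker.2 (c.bd_i l (l + 1) rfl y _), c.p_i l y _⟩⟩
    · intro hh x hx
      obtain ⟨W, hW, hxW, s, hs, hsh⟩ := hh x hx
      have h1 := (c.smoothOn_p hs) x hxW
      have h2 := h1.contMDiffAt (hW.mem_nhds hxW)
      refine (h2.congr_of_eventuallyEq ?_).contMDiffWithinAt
      filter_upwards [hW.mem_nhds hxW] with y hy
      obtain ⟨hy', h3⟩ := hsh y hy
      rw [← h3]
      rfl

variable [T2Space M] [SecondCountableTopology M]

/-- The action given by the component of degree one, if the component of degree zero vanishes. -/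
def HomSeries.groupoidRep (T : HomSeries G H H 1) (hT : totalD T * totalD T = 0)
    (h0 : ∀ l l' h x, T.fn 0 l l' h (nil x) = 0) (l : ℤ)
    (h1 : ∀ x, T.fn 1 l l (by simp) (single (G.idArrow x)) = LinearMap.id) :
    GroupoidRep G (H.deg l) where
  act g := T.fn 1 l l (by simp) (single g)
  act_id := h1
  act_comp g h := LinearMap.ext fun v => fn_one_comp hT h0 l g h v
  smooth n x y g v hg hx hv := by
    refine T.isSmooth 1 l l (by simp) n x y (fun z => single (g z)) v ⟨fun i => ?_, fun i => hg⟩ hv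
    obtain ⟨_ | _ | i, hi⟩ := i
    · exact hx
    · exact hv.contMDiff_base
    · omega

end Cohomology

/-! ### The spectral sequence of a filtered complex. -/

section SpectralSequence

open ShortComplex in
theorem _root_.CategoryTheory.ShortComplex.homologyπ_eq_zero_iff (S : ShortComplex (ModuleCat.{w} ℝ))
    (c : S.cycles) : S.homologyπ c = 0 ↔ S.iCycles c ∈ LinearMap.range S.f.hom := by
  have h1 : S.moduleCatHomologyIso.hom (S.homologyπ c) =
      (LinearMap.range S.moduleCatToCycles).mkQ (S.moduleCatCyclesIso.hom c) :=
    congrArg (fun f => f c) (congrArg (fun f => ⇑(ModuleCat.Hom.hom f)) S.π_moduleCatCyclesIso_hom)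
  have h2 : S.moduleCatLeftHomologyData.i (S.moduleCatCyclesIso.hom c) = S.iCycles c :=
    congrArg (fun f => f c) (congrArg (fun f => ⇑(ModuleCat.Hom.hom f)) S.moduleCatCyclesIso_hom_i)
  have h3 : S.homologyπ c = 0 ↔ S.moduleCatHomologyIso.hom (S.homologyπ c) = 0 := by
    constructor
    · intro h
      rw [h, map_zero]
    · intro h
      exact (ModuleCat.mono_iff_injective S.moduleCatHomologyIso.hom).1 inferInstance
        (h.trans (map_zero _).symm)
  rw [h3, h1]
  refine (Submodule.Quotient.mk_eq_zero (LinearMap.range S.moduleCatToCycles)).trans ?_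
  rw [← h2]
  constructor
  · rintro ⟨x, hx⟩
    exact ⟨x, congrArg (fun v : LinearMap.ker S.g.hom => (v : S.X₂)) hx⟩
  · rintro ⟨x, hx⟩
    exact ⟨x, Subtype.ext hx⟩

/-- The homology and `N` are both quotients of `W` by the same subspace. For the pages, `W` is
Z_{r+1} with its maps to E_r and E_{r+1}; the map `a` need not be injective. -/
theorem exists_homologyIso {ι : Type*} {c : ComplexShape ι}
    (K : HomologicalComplex (ModuleCat.{w} ℝ) c) (j : ι) (N : ModuleCat.{w} ℝ) {W : Type w}
    [AddCommGroup W] [Module ℝ W] (a : W →ₗ[ℝ] K.X j) (b : W →ₗ[ℝ] N)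
    (hb : Function.Surjective b) (ha : ∀ x, K.d j (c.next j) x = 0 ↔ x ∈ LinearMap.range a)
    (hab : ∀ w, b w = 0 ↔ a w ∈ LinearMap.range (K.d (c.prev j) j).hom) :
    ∃ e : K.homology j ≅ N, ∀ (z : K.cycles j) (w : W), K.iCycles j z = a w →
      e.hom (K.homologyπ j z) = b w := by
  have hi : Function.Injective (K.iCycles j) :=
    (ModuleCat.mono_iff_injective (K.iCycles j)).1 inferInstance
  have hπ : Function.Surjective (K.homologyπ j) :=
    (ModuleCat.epi_iff_surjective (K.homologyπ j)).1 inferInstance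
  let l : ModuleCat.of ℝ W ⟶ K.cycles j := K.liftCycles (ModuleCat.ofHom a) (c.next j) rfl
    (by ext w; exact (ha (a w)).2 ⟨w, rfl⟩)
  have hl : ∀ w, K.iCycles j (l w) = a w := fun w =>
    congrArg (fun f => f w) (congrArg (fun f => ⇑(ModuleCat.Hom.hom f))
      (K.liftCycles_i (ModuleCat.ofHom a) (c.next j) rfl _))
  have hlz : ∀ (z : K.cycles j) (w : W), K.iCycles j z = a w → l w = z := fun z w h =>
    hi ((hl w).trans h.symm)
  let f : W →ₗ[ℝ] K.homology j := (l ≫ K.homologyπ j).hom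
  have hf : Function.Surjective f := by
    intro y
    obtain ⟨z, rfl⟩ := hπ y
    obtain ⟨w, hw⟩ := (ha (K.iCycles j z)).1
      (congrArg (fun f => f z) (congrArg (fun f => ⇑(ModuleCat.Hom.hom f)) (K.iCycles_d j _)))
    exact ⟨w, congrArg (K.homologyπ j) (hlz z w hw.symm)⟩
  have hker : LinearMap.ker f = LinearMap.ker b := by
    ext w
    rw [LinearMap.mem_ker, LinearMap.mem_ker, hab w, ← hl w]
    exact (K.sc j).homologyπ_eq_zero_iff (l w)
  let e : K.homology j ≃ₗ[ℝ] N := (f.quotKerEquivOfSurjective hf).symm ≪≫ₗ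
    (Submodule.quotEquivOfEq _ _ hker) ≪≫ₗ (b.quotKerEquivOfSurjective hb)
  refine ⟨e.toModuleIso, fun z w h => ?_⟩
  have h1 : (f.quotKerEquivOfSurjective hf).symm (K.homologyπ j z) = Submodule.Quotient.mk w := by
    rw [LinearEquiv.symm_apply_eq, ← hlz z w h]
    rfl
  change e (K.homologyπ j z) = b w
  rw [LinearEquiv.trans_apply, LinearEquiv.trans_apply, h1]
  rfl

namespace Filtered

variable {C : ℤ → Type w} [∀ n, AddCommGroup (C n)] [∀ n, Module ℝ (C n)]
  {D : ∀ n n' : ℤ, n + 1 = n' → C n →ₗ[ℝ] C n'} {L : ∀ _ n : ℤ, Submodule ℝ (C n)}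

theorem mem_cycles_iff {r p n : ℤ} {z : C n} (p' n' : ℤ) (hp : p + r = p') (hn : n + 1 = n') :
    z ∈ cycles D L r p n ↔ z ∈ L p n ∧ D n n' hn z ∈ L p' n' := by
  subst hp hn
  rfl

theorem mem_boundaries_iff {r p n : ℤ} {z : C n} (r' p₁ p₂ n' : ℤ) (hr : r' + 1 = r)
    (hp₁ : p + 1 = p₁) (hp₂ : p₂ + r = p + 1) (hn : n' + 1 = n) :
    z ∈ boundaries D L r p n ↔
      ∃ y ∈ cycles D L r' p₁ n, ∃ w ∈ cycles D L r' p₂ n', y + D n' n hn w = z := by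
  obtain rfl : r' = r - 1 := by omega
  obtain rfl : n' = n - 1 := by omega
  obtain rfl : p₂ = p - r + 1 := by omega
  subst hp₁
  rw [boundaries, Submodule.mem_sup]
  constructor
  · rintro ⟨y, hy, _, ⟨w, hw, rfl⟩, rfl⟩
    exact ⟨y, hy, w, hw, rfl⟩
  · rintro ⟨y, hy, w, hw, rfl⟩
    exact ⟨y, hy, _, ⟨w, hw, rfl⟩, rfl⟩

variable (D L) in
/-- The conditions on the differential and the filtration of a filtered complex. -/
structure IsFilteredComplex : Prop where
  sq : ∀ (n n' n'' : ℤ) (h : n + 1 = n') (h' : n' + 1 = n'') (z : C n), D n' n'' h' (D n n' h z) = 0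
  anti : ∀ p n, L (p + 1) n ≤ L p n
  stable : ∀ (p n n' : ℤ) (h : n + 1 = n') (z : C n), z ∈ L p n → D n n' h z ∈ L p n'

namespace IsFilteredComplex

theorem le (hL : IsFilteredComplex D L) {p p' : ℤ} (h : p ≤ p') (n : ℤ) : L p' n ≤ L p n := by
  obtain ⟨k, rfl⟩ := Int.le.dest h
  induction k with
  | zero => simp
  | succ k ih =>
    refine le_trans ?_ (ih (by omega))
    rw [Nat.cast_succ, ← add_assoc]
    exact hL.anti _ _

theorem map_mem_cycles (hL : IsFilteredComplex D L) {r p p' n n' : ℤ} (hp : p + r = p')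
    (hn : n + 1 = n') (r' : ℤ) {z : C n} (hz : z ∈ cycles D L r p n) :
    D n n' hn z ∈ cycles D L r' p' n' := by
  refine (mem_cycles_iff (p' + r') (n' + 1) rfl rfl).2
    ⟨((mem_cycles_iff p' n' hp hn).1 hz).2, ?_⟩
  rw [hL.sq]
  exact zero_mem _

theorem map_mem_boundaries (hL : IsFilteredComplex D L) {r p p' n n' : ℤ} (hp : p + r = p')
    (hn : n + 1 = n') {z : C n} (hz : z ∈ boundaries D L r p n) :
    D n n' hn z ∈ boundaries D L r p' n' := by
  obtain ⟨y, hy, w, hw, rfl⟩ := (mem_boundaries_iff (r - 1) (p + 1) (p - r + 1) (n - 1) (by ring)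
    rfl (by ring) (by ring)).1 hz
  rw [map_add, hL.sq, add_zero]
  exact (mem_boundaries_iff (r - 1) (p' + 1) (p + 1) n (by ring) rfl (by omega) hn).2
    ⟨0, zero_mem _, y, hy, zero_add _⟩

/-- The differential of a page. -/
def pageD (hL : IsFilteredComplex D L) (r p q p' q' : ℤ) (hp : p + r = p') (hq : q + 1 - r = q') :
    Page D L r p q →ₗ[ℝ] Page D L r p' q' :=
  Submodule.mapQ _ _ ((D (p + q) (p' + q') (by omega)).restrict
    fun _ hz => hL.map_mem_cycles hp _ r hz) fun _ hz => hL.map_mem_boundaries hp _ hz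

theorem pageD_mk (hL : IsFilteredComplex D L) (r p q p' q' : ℤ) (hp : p + r = p')
    (hq : q + 1 - r = q') (z : C (p + q)) (hz : z ∈ cycles D L r p (p + q)) :
    hL.pageD r p q p' q' hp hq (Page.mk D L r p q z hz) =
      Page.mk D L r p' q' (D (p + q) (p' + q') (by omega) z) (hL.map_mem_cycles hp _ r hz) := rfl

theorem mk_surjective (r p q : ℤ) (x : Page D L r p q) :
    ∃ (z : C (p + q)) (hz : z ∈ cycles D L r p (p + q)), Page.mk D L r p q z hz = x := by
  obtain ⟨⟨z, hz⟩, rfl⟩ := Submodule.Quotient.mk_surjective _ x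
  exact ⟨z, hz, rfl⟩

theorem mk_eq_zero_iff {r p q : ℤ} {z : C (p + q)} (hz : z ∈ cycles D L r p (p + q)) :
    Page.mk D L r p q z hz = 0 ↔ z ∈ boundaries D L r p (p + q) :=
  Submodule.Quotient.mk_eq_zero _

theorem mk_eq_mk_iff {r p q : ℤ} {z z' : C (p + q)} (hz : z ∈ cycles D L r p (p + q))
    (hz' : z' ∈ cycles D L r p (p + q)) :
    Page.mk D L r p q z hz = Page.mk D L r p q z' hz' ↔ z - z' ∈ boundaries D L r p (p + q) :=
  Submodule.Quotient.eq _

open Classical in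
/-- The page of the spectral sequence of a filtered complex. -/
def page (hL : IsFilteredComplex D L) (r : ℤ) :
    HomologicalComplex (ModuleCat.{w} ℝ) (ComplexShape.up' ((r, 1 - r) : ℤ × ℤ)) where
  X i := ModuleCat.of ℝ (Page D L r i.1 i.2)
  d i j := if h : i.1 + r = j.1 ∧ i.2 + 1 - r = j.2 then
    ModuleCat.ofHom (hL.pageD r i.1 i.2 j.1 j.2 h.1 h.2) else 0
  shape i j h := dif_neg fun h' => h (Prod.ext h'.1 (by
    have := h'.2
    change i.2 + (1 - r) = j.2
    omega))
  d_comp_d' i j k _ _ := by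
    split_ifs with h h'
    · refine ModuleCat.hom_ext (LinearMap.ext fun x => ?_)
      obtain ⟨z, hz, rfl⟩ := mk_surjective _ _ _ x
      change hL.pageD r j.1 j.2 k.1 k.2 h'.1 h'.2
        (hL.pageD r i.1 i.2 j.1 j.2 h.1 h.2 (Page.mk _ _ _ _ _ z hz)) = 0
      rw [pageD_mk, pageD_mk, mk_eq_zero_iff, hL.sq]
      exact zero_mem _
    all_goals simp

theorem page_d (hL : IsFilteredComplex D L) (r p q p' q' : ℤ) (hp : p + r = p')
    (hq : q + 1 - r = q') (z : C (p + q)) (hz : z ∈ cycles D L r p (p + q)) :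
    (hL.page r).d (p, q) (p', q') (Page.mk D L r p q z hz) =
      Page.mk D L r p' q' (D (p + q) (p' + q') (by omega) z) (hL.map_mem_cycles hp _ r hz) := by
  have h1 : (hL.page r).d (p, q) (p', q') = ModuleCat.ofHom (hL.pageD r p q p' q' hp hq) :=
    dif_pos ⟨hp, hq⟩
  rw [h1]
  rfl

theorem cycles_succ_le (hL : IsFilteredComplex D L) (r p n : ℤ) :
    cycles D L (r + 1) p n ≤ cycles D L r p n := fun _ hz =>
  ⟨hz.1, hL.le (by omega) _ hz.2⟩

/-- If Dz = y + Dw with y in Z_{r-1}^{p+r+1} and w in Z_{r-1}^{p+1}, then z − w lies in Z_{r+1}^p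
and represents the same class as z, because w is a boundary of the page. -/
theorem page_d_eq_zero_iff (hL : IsFilteredComplex D L) (r p q p' q' : ℤ) (hp : p + r = p')
    (hq : q + 1 - r = q') (x : Page D L r p q) : (hL.page r).d (p, q) (p', q') x = 0 ↔
      ∃ (z : C (p + q)) (hz : z ∈ cycles D L (r + 1) p (p + q)),
        Page.mk D L r p q z (hL.cycles_succ_le r p _ hz) = x := by
  constructor
  · obtain ⟨z, hz, rfl⟩ := mk_surjective _ _ _ x
    rw [hL.page_d r p q p' q' hp hq]
    intro h
    obtain ⟨y, hy, w, hw, hyw⟩ := (mem_boundaries_iff (r - 1) (p' + 1) (p + 1) (p + q) (by ring)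
      rfl (by omega) (by omega)).1 ((mk_eq_zero_iff _).1 h)
    have h1 : w ∈ boundaries D L r p (p + q) :=
      (mem_boundaries_iff (r - 1) (p + 1) (p - r + 1) (p + q - 1) (by ring) rfl (by ring)
        (by ring)).2 ⟨w, hw, 0, zero_mem _, by rw [map_zero, add_zero]⟩
    refine ⟨z - w, (mem_cycles_iff (p' + 1) (p' + q') (by omega) (by omega)).2 ⟨?_, ?_⟩, ?_⟩
    · exact sub_mem hz.1 (hL.anti _ _ hw.1)
    · rw [map_sub, ← hyw, add_sub_cancel_right]
      exact hy.1
    · rw [mk_eq_mk_iff, sub_sub_cancel_left]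
      exact neg_mem h1
  · rintro ⟨z, hz, rfl⟩
    rw [hL.page_d r p q p' q' hp hq]
    refine (mk_eq_zero_iff _).2 ?_
    exact (mem_boundaries_iff (r - 1) (p' + 1) (p + 1) (p + q) (by ring) rfl (by omega)
      (by omega)).2 ⟨_, hL.map_mem_cycles (by omega) _ _ hz, 0, zero_mem _,
        by rw [map_zero, add_zero]⟩

theorem page_succ_mk_eq_zero_iff (hL : IsFilteredComplex D L) (r p q p' q' : ℤ) (hp : p' + r = p)
    (hq : q' + 1 - r = q) (z : C (p + q)) (hz : z ∈ cycles D L (r + 1) p (p + q)) :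
    Page.mk D L (r + 1) p q z hz = 0 ↔ ∃ x : Page D L r p' q',
      (hL.page r).d (p', q') (p, q) x = Page.mk D L r p q z (hL.cycles_succ_le r p _ hz) := by
  rw [mk_eq_zero_iff, mem_boundaries_iff r (p + 1) p' (p' + q') rfl rfl (by omega) (by omega)]
  constructor
  · rintro ⟨y, hy, v, hv, hyv⟩
    refine ⟨Page.mk D L r p' q' v hv, ?_⟩
    refine (hL.page_d r p' q' p q hp hq v hv).trans ((mk_eq_mk_iff _ _).2 ?_)
    rw [← hyv, sub_add_cancel_right]
    refine neg_mem ((mem_boundaries_iff (r - 1) (p + 1) (p - r + 1) (p + q - 1) (by ring) rfl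
      (by ring) (by ring)).2 ⟨y, ?_, 0, zero_mem _, by rw [map_zero, add_zero]⟩)
    refine hL.cycles_succ_le _ _ _ ?_
    rwa [sub_add_cancel]
  · rintro ⟨x, hx⟩
    obtain ⟨v, hv, rfl⟩ := mk_surjective _ _ _ x
    obtain ⟨y, hy, u, hu, hyu⟩ := (mem_boundaries_iff (r - 1) (p + 1) (p' + 1) (p' + q') (by ring)
      rfl (by omega) (by omega)).1
      ((mk_eq_mk_iff _ _).1 ((hL.page_d r p' q' p q hp hq v hv).symm.trans hx))
    have h0 : z = D (p' + q') (p + q) (by omega) v - (y + D (p' + q') (p + q) (by omega) u) := by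
      rw [hyu, sub_sub_cancel]
    -- This is a decomposition as required for the page r + 1. That −y has the better property D(−y)
    -- ∈ L^{p+1+r} is inherited from z, since D(−y) = Dz.
    have h1 : z = -y + D (p' + q') (p + q) (by omega) (v - u) := by
      rw [map_sub]
      exact h0.trans (by abel)
    refine ⟨-y, ?_, v - u, ?_, h1.symm⟩
    · refine (mem_cycles_iff (p + 1 + r) (p + q + 1) rfl rfl).2 ⟨neg_mem hy.1, ?_⟩
      have h2 : D (p + q) (p + q + 1) rfl z = D (p + q) (p + q + 1) rfl (-y) := by
        rw [h1, map_add, hL.sq, add_zero]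
      rw [← h2]
      exact ((mem_cycles_iff (p + 1 + r) (p + q + 1) (by ring) rfl).1 hz).2
    · refine sub_mem hv ((mem_cycles_iff p (p + q) (by omega) (by omega)).2 ⟨?_, ?_⟩)
      · exact hL.anti _ _ hu.1
      · exact ((mem_cycles_iff p (p + q) (by omega) (by omega)).1 hu).2

theorem exists_pageIso (hL : IsFilteredComplex D L) (r : ℤ) (i : ℤ × ℤ) :
    ∃ e : (hL.page r).homology i ≅ (hL.page (r + 1)).X i, ∀ (c : (hL.page r).cycles i)
      (z : C (i.1 + i.2)) (hz : z ∈ cycles D L (r + 1) i.1 (i.1 + i.2)),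
      (hL.page r).iCycles i c = Page.mk D L r i.1 i.2 z (hL.cycles_succ_le r _ _ hz) →
      e.hom ((hL.page r).homologyπ i c) = Page.mk D L (r + 1) i.1 i.2 z hz := by
  obtain ⟨p, q⟩ := i
  have hnext : (ComplexShape.up' ((r, 1 - r) : ℤ × ℤ)).next (p, q) = (p + r, q + 1 - r) :=
    ComplexShape.next_eq' _ (Prod.ext rfl (by change q + (1 - r) = q + 1 - r; ring))
  have hprev : (ComplexShape.up' ((r, 1 - r) : ℤ × ℤ)).prev (p, q) = (p - r, q - 1 + r) :=
    ComplexShape.prev_eq' _ (Prod.ext (by change p - r + r = p; ring)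
      (by change q - 1 + r + (1 - r) = q; ring))
  let a : cycles D L (r + 1) p (p + q) →ₗ[ℝ] Page D L r p q :=
    Submodule.mkQ _ ∘ₗ Submodule.inclusion (hL.cycles_succ_le r p _)
  obtain ⟨e, he⟩ := exists_homologyIso (hL.page r) (p, q) ((hL.page (r + 1)).X (p, q)) a
    (Submodule.mkQ _) (Submodule.mkQ_surjective _) (fun x => by
      rw [hnext]
      refine (hL.page_d_eq_zero_iff r p q (p + r) (q + 1 - r) rfl rfl x).trans ?_
      constructor
      · rintro ⟨z, hz, rfl⟩
        exact ⟨⟨z, hz⟩, rfl⟩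
      · rintro ⟨⟨z, hz⟩, rfl⟩
        exact ⟨z, hz, rfl⟩) (fun w => by
      rw [hprev]
      exact hL.page_succ_mk_eq_zero_iff r p q (p - r) (q - 1 + r) (by ring) (by ring) w.1 w.2)
  exact ⟨e, fun c z hz h => he c ⟨z, hz⟩ h⟩

/-- The identification of the homology of a page with the next page. -/
def pageIso (hL : IsFilteredComplex D L) (r r' : ℤ) (i : ℤ × ℤ) (h : r + 1 = r') :
    (hL.page r).homology i ≅ (hL.page r').X i :=
  h.rec (motive := fun r' _ => (hL.page r).homology i ≅ (hL.page r').X i) (hL.exists_pageIso r i).choose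

/-- The spectral sequence of a filtered complex. -/
def spectralSequence (hL : IsFilteredComplex D L) :
    CohomologicalSpectralSequence (ModuleCat.{w} ℝ) 0 where
  page r _ := hL.page r
  iso r r' i h _ := hL.pageIso r r' i h

theorem spectralSequence_iso (hL : IsFilteredComplex D L) (r : ℤ) (hr : 0 ≤ r) (p q : ℤ)
    (c : (hL.page r).cycles (p, q)) (z : C (p + q)) (hz : z ∈ cycles D L (r + 1) p (p + q))
    (h : (hL.page r).iCycles (p, q) c = Page.mk D L r p q z (hL.cycles_succ_le r _ _ hz)) :
    (hL.spectralSequence.iso r (r + 1) (p, q) rfl hr).hom ((hL.page r).homologyπ (p, q) c) =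
      Page.mk D L (r + 1) p q z hz :=
  (hL.exists_pageIso r (p, q)).choose_spec c z hz h

/-- The spectral sequence of a filtered complex is the one defined here. -/
def isSpectralSequence (hL : IsFilteredComplex D L) :
    IsSpectralSequence D L hL.spectralSequence where
  equiv r _ p q := LinearEquiv.refl ℝ (Page D L r p q)
  equiv_d r _ p q p' q' hp hq z hz _ := hL.page_d r p q p' q' hp hq z hz
  equiv_iso r hr p q c z _ hz' h := hL.spectralSequence_iso r hr p q c z hz' h

end IsFilteredComplex

end Filtered

end SpectralSequence

/-! ### Convergence for a filtration that is finite in each degree. -/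

section Convergence

namespace Filtered

variable {C : ℤ → Type w} [∀ n, AddCommGroup (C n)] [∀ n, Module ℝ (C n)]
  {D : ∀ n n' : ℤ, n + 1 = n' → C n →ₗ[ℝ] C n'} {L : ∀ _ n : ℤ, Submodule ℝ (C n)}

theorem mem_inducedFiltration_iff {p n : ℤ} (z : C n) (hz : D n (n + 1) rfl z = 0) :
    (Submodule.Quotient.mk ⟨z, hz⟩ : Cohomology D n) ∈ inducedFiltration D L p n ↔
      ∃ y ∈ L p n, ∃ w : C (n - 1), z = y + D (n - 1) n (by omega) w ∧ D n (n + 1) rfl y = 0 := by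
  rw [inducedFiltration, Submodule.mem_map]
  constructor
  · rintro ⟨y, hy, hyz⟩
    obtain ⟨w, hw⟩ := (Submodule.Quotient.eq _).1 hyz
    refine ⟨y.1, hy, -w, ?_, y.2⟩
    rw [map_neg, hw]
    change z = y.1 + -(y.1 - z)
    abel
  · rintro ⟨y, hy, w, hw, hDy⟩
    refine ⟨⟨y, hDy⟩, hy, (Submodule.Quotient.eq _).2 ⟨-w, ?_⟩⟩
    change D (n - 1) n _ (-w) = y - z
    rw [hw, map_neg]
    abel

namespace IsFilteredComplex

/-- If L^{p+1} is everything, an element of Z_r^p already lies in Z_{r-1}^{p+1}. This serves both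
for the entries with p < 0 and for the vanishing of incoming differentials. -/
theorem page_subsingleton (r p q : ℤ)
    (h : L (p + 1) (p + q) = ⊤) : Subsingleton (Page D L r p q) := by
  refine subsingleton_of_forall_eq 0 fun x => ?_
  obtain ⟨z, hz, rfl⟩ := mk_surjective _ _ _ x
  refine (mk_eq_zero_iff hz).2 ((mem_boundaries_iff (r - 1) (p + 1) (p - r + 1) (p + q - 1)
    (by ring) rfl (by ring) (by ring)).2 ⟨z, ?_, 0, zero_mem _, by rw [map_zero, add_zero]⟩)
  refine (mem_cycles_iff (p + r) (p + q + 1) (by ring) rfl).2 ⟨?_, hz.2⟩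
  rw [h]
  trivial

theorem inducedFiltration_anti (hL : IsFilteredComplex D L) (p n : ℤ) :
    inducedFiltration D L (p + 1) n ≤ inducedFiltration D L p n :=
  Submodule.map_mono (Submodule.comap_mono (hL.anti p n))

/-- The first condition makes the elements of Z_r^p genuine cocycles, the second admits every
primitive of a coboundary. The page is then the associated graded space of the cohomology. -/
theorem exists_limitEquiv (hL : IsFilteredComplex D L) (r p q : ℤ)
    (h1 : L (p + r) (p + q + 1) = ⊥) (h2 : L (p - r + 1) (p + q - 1) = ⊤) :
    ∃ e : Page D L r p q ≃ₗ[ℝ] inducedFiltration D L p (p + q) ⧸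
      (inducedFiltration D L (p + 1) (p + q)).submoduleOf (inducedFiltration D L p (p + q)),
      ∀ (z : C (p + q)) (hz : z ∈ cycles D L r p (p + q))
        (hz' : z ∈ LinearMap.ker (D (p + q) (p + q + 1) rfl))
        (hF : (Submodule.Quotient.mk ⟨z, hz'⟩ : Cohomology D (p + q)) ∈
          inducedFiltration D L p (p + q)),
        e (Page.mk D L r p q z hz) = Submodule.Quotient.mk ⟨_, hF⟩ := by
  have hker : ∀ z : cycles D L r p (p + q), z.1 ∈ LinearMap.ker (D (p + q) (p + q + 1) rfl) :=
    fun z => by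
      have h := ((mem_cycles_iff _ _ rfl rfl).1 z.2).2
      rwa [h1] at h
  let f₁ : cycles D L r p (p + q) →ₗ[ℝ] Cohomology D (p + q) :=
    Submodule.mkQ _ ∘ₗ (Submodule.subtype _).codRestrict _ hker
  have hf₁ : ∀ z, f₁ z ∈ inducedFiltration D L p (p + q) := fun z =>
    ⟨⟨z.1, hker z⟩, z.2.1, rfl⟩
  let f : cycles D L r p (p + q) →ₗ[ℝ] inducedFiltration D L p (p + q) ⧸
      (inducedFiltration D L (p + 1) (p + q)).submoduleOf (inducedFiltration D L p (p + q)) :=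
    Submodule.mkQ _ ∘ₗ f₁.codRestrict _ hf₁
  have hf : Function.Surjective f := by
    intro x
    obtain ⟨⟨_, y, hy, rfl⟩, rfl⟩ := Submodule.Quotient.mk_surjective _ x
    refine ⟨⟨y.1, (mem_cycles_iff _ _ rfl rfl).2 ⟨hy, ?_⟩⟩, rfl⟩
    rw [LinearMap.mem_ker.1 y.2]
    exact zero_mem _
  have hkerf : LinearMap.ker f =
      (boundaries D L r p (p + q)).submoduleOf (cycles D L r p (p + q)) := by
    ext z
    have h3 : f z = 0 ↔ f₁ z ∈ inducedFiltration D L (p + 1) (p + q) :=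
      Submodule.Quotient.mk_eq_zero _
    have h4 : z ∈ (boundaries D L r p (p + q)).submoduleOf (cycles D L r p (p + q)) ↔
        z.1 ∈ boundaries D L r p (p + q) := Iff.rfl
    rw [LinearMap.mem_ker, h3, h4, mem_boundaries_iff (r - 1) (p + 1) (p - r + 1) (p + q - 1)
      (by ring) rfl (by ring) (by ring)]
    refine (mem_inducedFiltration_iff z.1 (hker z)).trans ?_
    constructor
    · rintro ⟨y, hy, w, hw, hDy⟩
      refine ⟨y, (mem_cycles_iff _ _ rfl rfl).2 ⟨hy, ?_⟩, w, ?_, hw.symm⟩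
      · rw [hDy]
        exact zero_mem _
      · refine (mem_cycles_iff p (p + q) (by ring) (by ring)).2 ⟨by rw [h2]; trivial, ?_⟩
        rw [← sub_eq_iff_eq_add'.2 hw]
        exact sub_mem z.2.1 (hL.anti _ _ hy)
    · rintro ⟨y, hy, w, -, hw⟩
      refine ⟨y, hy.1, w, hw.symm, ?_⟩
      have h := ((mem_cycles_iff (p + r) (p + q + 1) (by ring) rfl).1 hy).2
      rwa [h1] at h
  exact ⟨Submodule.quotEquivOfEq _ _ hkerf.symm ≪≫ₗ f.quotKerEquivOfSurjective hf,
    fun z hz hz' hF => rfl⟩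

/-- The spectral sequence of a filtered complex converges if the filtration is finite in each
degree. -/
theorem convergesTo (hL : IsFilteredComplex D L) (htop : ∀ p n, p ≤ 0 → L p n = ⊤)
    (hbot : ∀ n, ∃ p, L p n = ⊥) :
    ConvergesTo hL.spectralSequence (inducedFiltration D L) where
  decreasing := hL.inducedFiltration_anti
  exhaustive n := ⟨0, by
    refine eq_top_iff.2 fun x _ => ?_
    obtain ⟨z, rfl⟩ := Submodule.Quotient.mk_surjective _ x
    refine ⟨z, ?_, rfl⟩
    change z.1 ∈ L 0 n
    rw [htop 0 n le_rfl]
    trivial⟩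
  separated n := by
    obtain ⟨p, hp⟩ := hbot n
    refine ⟨p, eq_bot_iff.2 ?_⟩
    rintro _ ⟨z, hz, rfl⟩
    have h : z.1 ∈ L p n := hz
    rw [hp] at h
    rw [show z = 0 from Subtype.ext h, map_zero]
    exact zero_mem _
  limit p q := by
    obtain ⟨P, hP⟩ := hbot (p + q + 1)
    -- From r ≥ P − p on, outgoing differentials land in L^{p+r} = 0; from r ≥ p + 1 on, incoming
    -- ones start at a negative filtration index.
    have hr0 : ∀ r, max (max (P - p) (p + 1)) 0 ≤ r →
        L (p + r) (p + q + 1) = ⊥ ∧ L (p - r + 1) (p + q - 1) = ⊤ ∧ p - r + 1 ≤ 0 := by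
      intro r hr
      have h1 : P ≤ p + r := by omega
      have h2 : p - r + 1 ≤ 0 := by omega
      exact ⟨eq_bot_iff.2 ((hL.le h1 _).trans hP.le), htop _ _ h2, h2⟩
    have hd : ∀ r, max (max (P - p) (p + 1)) 0 ≤ r → ∀ b, (hL.page r).d (p, q) b = 0 := by
      intro r hr b
      by_cases hb : (ComplexShape.up' ((r, 1 - r) : ℤ × ℤ)).Rel (p, q) b
      · obtain ⟨p', q'⟩ := b
        have hp' : p + r = p' := congrArg Prod.fst hb
        have hq' : q + (1 - r) = q' := congrArg Prod.snd hb
        refine ModuleCat.hom_ext (LinearMap.ext fun x => ?_)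
        refine (hL.page_d_eq_zero_iff r p q p' q' hp' (by omega) x).2 ?_
        obtain ⟨z, hz, rfl⟩ := mk_surjective _ _ _ x
        refine ⟨z, (mem_cycles_iff (p + (r + 1)) (p + q + 1) rfl rfl).2 ⟨hz.1, ?_⟩, rfl⟩
        have h := ((mem_cycles_iff (p + r) (p + q + 1) rfl rfl).1 hz).2
        rw [(hr0 r hr).1] at h
        rw [(Submodule.mem_bot ℝ).1 h]
        exact zero_mem _
      · exact (hL.page r).shape _ _ hb
    choose e he using fun r (hr : max (max (P - p) (p + 1)) 0 ≤ r) =>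
      hL.exists_limitEquiv r p q (hr0 r hr).1 (hr0 r hr).2.1
    refine ⟨max (max (P - p) (p + 1)) 0, le_max_right _ _, fun r hr b => ⟨hd r hr b, ?_⟩,
      fun r hr => e r hr, fun r hr c => ?_⟩
    · by_cases hb : (ComplexShape.up' ((r, 1 - r) : ℤ × ℤ)).Rel b (p, q)
      · obtain ⟨p', q'⟩ := b
        have hp' : p' + r = p := congrArg Prod.fst hb
        have := page_subsingleton (D := D) r p' q' (htop _ _ (by have := (hr0 r hr).2.2; omega))
        refine ModuleCat.hom_ext (LinearMap.ext fun x => ?_)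
        rw [show x = 0 from this.elim _ _, map_zero, map_zero]
      · exact (hL.page r).shape _ _ hb
    · have h1 : (hL.page r).d (p, q) (p + r, q + 1 - r) ((hL.page r).iCycles (p, q) c) = 0 := by
        rw [hd r hr]
        rfl
      obtain ⟨z, hz, hzc⟩ := (hL.page_d_eq_zero_iff r p q _ _ rfl rfl _).1 h1
      have hz' : z ∈ LinearMap.ker (D (p + q) (p + q + 1) rfl) := by
        have h := ((mem_cycles_iff _ _ rfl rfl).1 (hL.cycles_succ_le r p _ hz)).2
        rwa [(hr0 r hr).1] at h
      have hF : (Submodule.Quotient.mk ⟨z, hz'⟩ : Cohomology D (p + q)) ∈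
          inducedFiltration D L p (p + q) := ⟨⟨z, hz'⟩, hz.1, rfl⟩
      -- Both identifications send the class of the cocycle z to its cohomology class, so they are
      -- compatible.
      refine (congrArg (e (r + 1) (by omega)) (hL.spectralSequence_iso r ((le_max_right _ _).trans hr) p q c z
        hz hzc.symm)).trans ((he (r + 1) (by omega) z hz hz' hF).trans ?_)
      exact ((congrArg (e r hr) hzc.symm).trans (he r hr z _ hz' hF)).symm

end IsFilteredComplex

end Filtered

end Convergence

/-! ### The filtration by cocycle degree. -/

section CocycleFiltration

variable {G : LieGroupoid m d M G₁} {E H : GradedBundle.{u, v} m M}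

theorem Tot.component_eq_ext {n : ℤ} (η : Tot G E n) (k : ℕ) (l : ℤ) (h : (k : ℤ) + l = n) :
    Tot.component η k l h = Cochains.ext n η k l :=
  (congrFun (Cochains.res_ext n η) ⟨(k, l), h⟩).symm

theorem mem_cocycleFiltration_iff {p n : ℤ} {η : Tot G E n} : η ∈ cocycleFiltration G E p n ↔
    ∀ (k : ℕ) (l : ℤ) (h : (k : ℤ) + l = n), (k : ℤ) < p → Tot.component η k l h = 0 :=
  ⟨fun hη k l h hk => hη ⟨(k, l), h⟩ hk, fun hη i hi => hη _ _ i.2 hi⟩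

theorem res_mem_cocycleFiltration {p : ℕ} {n : ℤ} {ζ : Cochains G E} (hζ : ζ.VanishBelow p) :
    Cochains.res n ζ ∈ cocycleFiltration G E p n :=
  mem_cocycleFiltration_iff.2 fun k l _ hk => hζ k (by omega) l

theorem ext_vanishBelow {p : ℕ} {n : ℤ} {η : Tot G E n} (hη : η ∈ cocycleFiltration G E p n) :
    (Cochains.ext n η).VanishBelow p := by
  intro k hk l
  by_cases h : (k : ℤ) + l = n
  · rw [← Tot.component_eq_ext η k l h]
    exact mem_cocycleFiltration_iff.1 hη k l h (by omega)
  · exact dif_neg h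

theorem star_vanishBelow_of_vanishBelow {e : ℤ} (T : HomSeries G E H e) {p : ℕ} {η : Cochains G E}
    (hη : η.VanishBelow p) : (star T η).VanishBelow p := by
  intro k hk l
  apply Subtype.ext
  funext x y g
  have h1 : η.VanishBelow k := fun j hj => hη j (hj.trans hk)
  rw [star_apply_of_vanishBelow T h1 (l - e) l (by ring), hη k hk]
  exact map_zero _

theorem totalD_vanishBelow_of_vanishBelow (T : HomSeries G E E 1) {p : ℕ} {η : Cochains G E}
    (hη : η.VanishBelow p) : (totalD T η).VanishBelow p := fun k hk l =>
  (congrArg₂ (· + ·) (star_vanishBelow_of_vanishBelow T hη k hk l)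
    (hatD_vanishBelow hη k (by omega) l)).trans (add_zero _)

theorem cocycleFiltration_of_nonpos (p n : ℤ) (hp : p ≤ 0) : cocycleFiltration G E p n = ⊤ :=
  eq_top_iff.2 fun _ _ => mem_cocycleFiltration_iff.2 fun k l h hk => by omega

theorem exists_cocycleFiltration_eq_bot (n : ℤ) : ∃ p, cocycleFiltration G E p n = ⊥ := by
  obtain ⟨a, b, hab⟩ := E.bounded
  -- A component of cocycle degree k ≥ n − a + 1 has values in E^{n-k} with n − k < a, a bundle of
  -- rank zero.
  refine ⟨n - a + 1, eq_bot_iff.2 fun η hη => ?_⟩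
  refine (Submodule.mem_bot ℝ).2 (funext fun i => ?_)
  by_cases hi : (i.1.1 : ℤ) < n - a + 1
  · exact hη i hi
  · exact cochain_eq_zero_of_rank (hab _ (Or.inl (by have := i.2; omega))) _

namespace RepUpToHomotopy.HasComponents

variable {A : RepUpToHomotopy G E} {R : ∀ k : ℕ, HomCochain G E E k (1 - k)}

/-- No part of D lowers the cocycle degree. For p ≤ 0 the filtration is everything, so only natural
p need an argument. -/
theorem isFilteredComplex (hR : A.HasComponents R) :
    Filtered.IsFilteredComplex A.D (cocycleFiltration G E) where
  sq := A.D_sq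
  anti p n η hη i hi := hη i (by omega)
  stable p n n' h η hη := by
    by_cases hp : p ≤ 0
    · rw [cocycleFiltration_of_nonpos p n' hp]
      trivial
    · obtain ⟨k, rfl⟩ := Int.eq_ofNat_of_zero_le (not_le.1 hp).le
      rw [← Cochains.res_ext n η, hR.D_res]
      exact res_mem_cocycleFiltration (totalD_vanishBelow_of_vanishBelow _ (ext_vanishBelow hη))

theorem component_D (hR : A.HasComponents R) {p : ℕ} {n n' : ℤ} (h : n + 1 = n') {η : Tot G E n}
    (hη : η ∈ cocycleFiltration G E p n) (l l' : ℤ) (hl : (p : ℤ) + l = n)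
    (hl' : (p : ℤ) + l' = n') (hll' : l + 1 = l') {x y : M} (g : G.Str p x y) :
    (Tot.component (A.D n n' h η) p l' hl').1 x y g =
      bdry R l l' hll' x ((Tot.component η p l hl).1 x y g) := by
  have h1 := hR.D_res n n' h (Cochains.ext n η)
  rw [Cochains.res_ext] at h1
  rw [h1, Tot.component_eq_ext η p l hl]
  exact totalD_apply_of_vanishBelow _ (ext_vanishBelow hη) l l' hll' g

end RepUpToHomotopy.HasComponents

/-- The sign of D involves the total degree, that of `GroupoidRep.diff` only p; the difference
(-1)^l does not affect kernels and ranges. -/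
theorem totalD_succ_eq_diff {T : HomSeries G E E 1} (hT : ∀ l l' h x, T.fn 0 l l' h (nil x) = 0)
    {l : ℤ} (ρ : GroupoidRep G (E.deg l))
    (hρ : ∀ (x y : M) (g : G.Arrow x y), T.fn 1 l l (by simp) (single g) = ρ.act g)
    {p : ℕ} {η : Cochains G E} (hη : η.VanishBelow p) :
    totalD T η (p + 1) l = (-1 : ℝ) ^ l • ρ.diff p (η p l) := by
  apply Subtype.ext
  funext x y g
  rw [totalD_succ_apply hT hη, hρ, zpow_add₀ (by norm_num), zpow_natCast, mul_comm, mul_smul]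
  rfl

/-- A morphism to a representation up to homotopy with zero differential on the cohomology bundle
which extends the projection. -/
structure CohomologyTransfer {T : HomSeries G E E 1} (c : Contraction T.base H)
    (ρ : ∀ l : ℤ, GroupoidRep G (H.deg l)) where
  φ : HomSeries G E H 0
  T' : HomSeries G H H 1
  comm : ∀ η, star φ (totalD T η) = totalD T' (star φ η)
  φ_nil : ∀ l x, φ.fn 0 l l (by simp) (nil x) = c.p l x
  T'_nil : ∀ l l' h x, T'.fn 0 l l' h (nil x) = 0
  act : ∀ (l : ℤ) (x y : M) (g : G.Arrow x y), T'.fn 1 l l (by simp) (single g) = (ρ l).act g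

namespace Contraction

variable {T : HomSeries G E E 1} (c : Contraction T.base H)

/-- The projection of a component to the cohomology bundle. -/
def projComponent {n : ℤ} (p : ℕ) (q : ℤ) : Tot G E n →ₗ[ℝ] Cochain G p (H.deg q) :=
  LinearMap.proj (R := ℝ) (φ := fun l => Cochain G p (H.deg l)) q ∘ₗ
    LinearMap.proj (R := ℝ) (φ := fun k => ∀ l, Cochain G k (H.deg l)) p ∘ₗ
      c.pOp G ∘ₗ Cochains.ext n

theorem projComponent_apply {n : ℤ} (p : ℕ) (q : ℤ) (h : (p : ℤ) + q = n) (η : Tot G E n)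
    {x y : M} (g : G.Str p x y) :
    (c.projComponent p q η).1 x y g = c.p q x ((Tot.component η p q h).1 x y g) := by
  rw [Tot.component_eq_ext]
  exact c.pOp_apply _ _ _ _

theorem projComponent_eq_zero {n : ℤ} {p : ℕ} {q : ℤ} (h : (p : ℤ) + q = n) {η : Tot G E n}
    (hη : η ∈ cocycleFiltration G E (p + 1) n) : c.projComponent p q η = 0 := by
  apply Subtype.ext
  funext x y g
  rw [c.projComponent_apply p q h, mem_cocycleFiltration_iff.1 hη p q h (by omega)]
  exact map_zero _

end Contraction

end CocycleFiltration

/-! ### The second page as cohomology with values in the cohomology bundle. -/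

section SecondPage

variable {G : LieGroupoid m d M G₁} {E H : GradedBundle.{u, v} m M}
  {A : RepUpToHomotopy G E} {R : ∀ k : ℕ, HomCochain G E E k (1 - k)}

open Filtered

namespace RepUpToHomotopy.HasComponents

variable (hR : A.HasComponents R) {c : Contraction (HomSeries.mk R hR.smooth).base H}
  {ρ : ∀ l : ℤ, GroupoidRep G (H.deg l)}

/-- This is ΦD = D'Φ in cocycle degree p + 1. On a lowest component Φ acts by p, so the left side is
the projection of the component of Dw, and the leading term of D' is the differential of the
representation. -/
theorem projComponent_D (τ : CohomologyTransfer c ρ) {p : ℕ} {q n n' : ℤ} (h : n + 1 = n')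
    (hq : (p : ℤ) + q = n) {w : Tot G E n} (hw : w ∈ cocycleFiltration G E p n)
    (hDw : A.D n n' h w ∈ cocycleFiltration G E ((p + 1 : ℕ) : ℤ) n') :
    c.projComponent (p + 1) q (A.D n n' h w) = (-1 : ℝ) ^ q • (ρ q).diff p (c.projComponent p q w) := by
  have hφ : ∀ (k : ℕ) (l : ℤ) {x y : M} (g : G.Str k x y) {ζ : Cochains G E}, ζ.VanishBelow k →
      (star τ.φ ζ k l).1 x y g = c.p l x ((ζ k l).1 x y g) := fun k l x y g ζ hζ =>
    (star_apply_of_vanishBelow τ.φ hζ l l (add_zero l) g).trans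
      (congrArg (fun f => f ((ζ k l).1 x y g)) (τ.φ_nil l x))
  have h1 : star τ.φ (Cochains.ext n w) p q = c.projComponent p q w := by
    apply Subtype.ext
    funext x y g
    rw [hφ p q g (ext_vanishBelow hw), c.projComponent_apply p q hq, Tot.component_eq_ext]
  have h2 : Cochains.res n' (star τ.φ (Cochains.ext n' (A.D n n' h w))) =
      Cochains.res n' (totalD τ.T' (star τ.φ (Cochains.ext n w))) := by
    rw [← τ.comm, ← starTot_res τ.φ n' n' (by ring), ← starTot_res τ.φ n' n' (by ring),
      ← hR.D_res n n' h, Cochains.res_ext, Cochains.res_ext]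
  have h3 : star τ.φ (Cochains.ext n' (A.D n n' h w)) (p + 1) q =
      totalD τ.T' (star τ.φ (Cochains.ext n w)) (p + 1) q :=
    congrFun h2 ⟨(p + 1, q), by push_cast; omega⟩
  rw [← h1, ← totalD_succ_eq_diff τ.T'_nil (ρ q) (τ.act q)
    (star_vanishBelow_of_vanishBelow τ.φ (ext_vanishBelow hw)), ← h3]
  apply Subtype.ext
  funext x y g
  rw [hφ (p + 1) q g (ext_vanishBelow hDw), c.projComponent_apply (p + 1) q (by push_cast; omega),
    Tot.component_eq_ext]

theorem diff_projComponent (τ : CohomologyTransfer c ρ) {p : ℕ} {q n : ℤ} (hq : (p : ℤ) + q = n)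
    {z : Tot G E n} (hz : z ∈ cycles A.D (cocycleFiltration G E) 2 p n) :
    (ρ q).diff p (c.projComponent p q z) = 0 := by
  have h1 := ((mem_cycles_iff (p + 2) (n + 1) rfl rfl).1 hz).2
  have h2 := hR.projComponent_D τ rfl hq hz.1 (hR.isFilteredComplex.le (by push_cast; omega) _ h1)
  rw [c.projComponent_eq_zero (by push_cast; omega)
    (hR.isFilteredComplex.le (by push_cast; omega) _ h1)] at h2
  exact (smul_eq_zero.1 h2.symm).resolve_left (zpow_ne_zero _ (by norm_num))

theorem component_mem_ker (hR : A.HasComponents R) {p : ℕ} {q n : ℤ} (hq : (p : ℤ) + q = n)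
    {z : Tot G E n} (hz : z ∈ cycles A.D (cocycleFiltration G E) 2 p n) {x y : M}
    (g : G.Str p x y) : (Tot.component z p q hq).1 x y g ∈ LinearMap.ker (bdry R q (q + 1) rfl x) := by
  have h1 := ((mem_cycles_iff (p + 2) (n + 1) rfl rfl).1 hz).2
  rw [LinearMap.mem_ker, ← hR.component_D rfl hz.1 q (q + 1) hq (by omega) rfl,
    mem_cocycleFiltration_iff.1 h1 _ _ _ (by omega)]
  rfl

/-- Applying the homotopy componentwise. -/
theorem exists_homotopy_lift (c : Contraction (HomSeries.mk R hR.smooth).base H) {p : ℕ}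
    {n n' : ℤ} (h : n + 1 = n') {w : Tot G E n'} (hw : w ∈ cocycleFiltration G E p n')
    (hDw : A.D n' (n' + 1) rfl w ∈ cocycleFiltration G E (p + 1) (n' + 1)) (q : ℤ)
    (hq : (p : ℤ) + q = n') (hpw : c.projComponent p q w = 0) :
    ∃ u ∈ cocycleFiltration G E p n, w - A.D n n' h u ∈ cocycleFiltration G E (p + 1) n' := by
  -- In cocycle degree p only ∂ contributes to Du. The component of w there is ∂-closed with zero
  -- projection, so hw is a primitive by `eq_bd_h`.
  have hu : Cochains.res n (c.hOp G (Cochains.ext n' w)) ∈ cocycleFiltration G E p n :=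
    res_mem_cocycleFiltration (star_vanishBelow_of_vanishBelow _ (ext_vanishBelow hw))
  refine ⟨_, hu, mem_cocycleFiltration_iff.2 fun k l hk hkp => ?_⟩
  rcases lt_or_eq_of_le (show k ≤ p by omega) with hlt | rfl
  · exact mem_cocycleFiltration_iff.1 (sub_mem hw (hR.isFilteredComplex.stable _ _ _ h _ hu)) k l hk
      (by omega)
  obtain rfl : q = l := by omega
  apply Subtype.ext
  funext x y g
  refine sub_eq_zero.2 ?_
  have h0 := hR.component_D rfl hw q (q + 1) hq (by omega) rfl g
  rw [mem_cocycleFiltration_iff.1 hDw _ _ _ (by omega)] at h0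
  have h1 : c.p q x ((Tot.component w k q hq).1 x y g) = 0 := by
    rw [← c.projComponent_apply, hpw]
    rfl
  refine (c.eq_bd_h (q - 1) q (q + 1) (by ring) (by ring) rfl h0.symm h1).trans ?_
  refine Eq.trans ?_ (hR.component_D h hu (q - 1) q (by omega) hk (by ring) g).symm
  refine congrArg (bdry R (q - 1) q _ x) ?_
  rw [Tot.component_eq_ext]
  exact (c.hOp_apply _ q (q - 1) (by ring) g).symm

/-- The lift is i b. Its lowest component is annihilated by ∂, so D moves it up by one step of the
filtration. -/
theorem exists_projComponent_eq (c : Contraction (HomSeries.mk R hR.smooth).base H) {p : ℕ}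
    {q n n' : ℤ} (h : n + 1 = n') (hq : (p : ℤ) + q = n) (b : Cochain G p (H.deg q)) :
    ∃ w ∈ cocycleFiltration G E p n, c.projComponent p q w = b ∧
      A.D n n' h w ∈ cocycleFiltration G E (p + 1) n' := by
  classical
  let b' : Tot G H n := Pi.single ⟨(p, q), hq⟩ b
  have hb' : b' ∈ cocycleFiltration G H p n := mem_cocycleFiltration_iff.2 fun k l h hk => by
    have hne : (⟨(k, l), h⟩ : {i : ℕ × ℤ // (i.1 : ℤ) + i.2 = n}) ≠ ⟨(p, q), hq⟩ := fun h => by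
      have h1 : k = p := congrArg (fun i => i.1.1) h
      omega
    exact Pi.single_eq_of_ne (M := fun i : {i : ℕ × ℤ // (i.1 : ℤ) + i.2 = n} =>
      Cochain G i.1.1 (H.deg i.1.2)) hne b
  have hb : Cochains.ext n b' p q = b := by
    rw [← Tot.component_eq_ext b' p q hq]
    exact Pi.single_eq_same _ _
  have hw : Cochains.res n (c.iOp G (Cochains.ext n b')) ∈ cocycleFiltration G E p n :=
    res_mem_cocycleFiltration (star_vanishBelow_of_vanishBelow _ (ext_vanishBelow hb'))
  have hwg : ∀ (l : ℤ) (hl : (p : ℤ) + l = n) {x y : M} (g : G.Str p x y),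
      (Tot.component (Cochains.res n (c.iOp G (Cochains.ext n b'))) p l hl).1 x y g =
        c.i l x ((Cochains.ext n b' p l).1 x y g) := fun l hl x y g => c.iOp_apply _ _ _ _
  refine ⟨_, hw, ?_, mem_cocycleFiltration_iff.2 fun k l hk hkp => ?_⟩
  · apply Subtype.ext
    funext x y g
    rw [c.projComponent_apply p q hq, hwg, c.p_i, hb]
  rcases lt_or_eq_of_le (show k ≤ p by omega) with hlt | rfl
  · exact mem_cocycleFiltration_iff.1 (hR.isFilteredComplex.stable _ _ _ h _ hw) k l hk (by omega)
  apply Subtype.ext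
  funext x y g
  rw [hR.component_D h hw (l - 1) l (by omega) hk (by ring), hwg]
  exact c.bd_i (l - 1) l (by ring) x _

/-- For the lift w = i b, the component of Dw of degree p + 1 is ∂-closed and projects to ± the
differential of b, which is zero. It is therefore removed by a correction u in L^{p+1}, which does
not change the projection in degree p. -/
theorem exists_mem_cycles_projComponent_eq (τ : CohomologyTransfer c ρ) {p : ℕ} {q n : ℤ}
    (hq : (p : ℤ) + q = n) {b : Cochain G p (H.deg q)} (hb : (ρ q).diff p b = 0) :
    ∃ z ∈ cycles A.D (cocycleFiltration G E) 2 p n, c.projComponent p q z = b := by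
  obtain ⟨w, hw, hwb, hDw⟩ := hR.exists_projComponent_eq c rfl hq b
  have h1 : c.projComponent (p + 1) q (A.D n (n + 1) rfl w) = 0 := by
    rw [hR.projComponent_D τ rfl hq hw (by push_cast; exact hDw), hwb, hb, smul_zero]
  obtain ⟨u, hu, huD⟩ := hR.exists_homotopy_lift c (p := p + 1) (n := n) rfl (by push_cast; exact hDw)
    (by rw [A.D_sq]; exact zero_mem _) q (by push_cast; omega) h1
  push_cast at hu huD
  refine ⟨w - u, (mem_cycles_iff (p + 2) (n + 1) rfl rfl).2
    ⟨sub_mem hw (hR.isFilteredComplex.anti _ _ hu), ?_⟩, ?_⟩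
  · rw [map_sub]
    exact hR.isFilteredComplex.le (by omega) _ huD
  · rw [map_sub, hwb, c.projComponent_eq_zero hq hu, sub_zero]

theorem mem_boundaries_of_projComponent_eq_zero (c : Contraction (HomSeries.mk R hR.smooth).base H)
    {p : ℕ} {q n : ℤ} (hq : (p : ℤ) + q = n) {z : Tot G E n}
    (hz : z ∈ cycles A.D (cocycleFiltration G E) 2 p n) (h : c.projComponent p q z = 0) :
    z ∈ boundaries A.D (cocycleFiltration G E) 2 p n := by
  have hDz := ((mem_cycles_iff (p + 2) (n + 1) rfl rfl).1 hz).2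
  obtain ⟨u, hu, huD⟩ := hR.exists_homotopy_lift c (n := n - 1) (by ring) hz.1
    (hR.isFilteredComplex.le (by omega) _ hDz) q hq h
  refine (mem_boundaries_iff 1 (p + 1) (p - 1) (n - 1) rfl rfl (by ring) (by ring)).2
    ⟨_, (mem_cycles_iff (p + 2) (n + 1) (by ring) rfl).2 ⟨huD, ?_⟩, u,
      (mem_cycles_iff p n (by ring) (by ring)).2 ⟨hR.isFilteredComplex.le (by omega) _ hu,
        hR.isFilteredComplex.stable _ _ _ _ _ hu⟩, sub_add_cancel _ _⟩
  rw [map_sub, A.D_sq, sub_zero]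
  exact hDz

theorem projComponent_mem_boundaries_iff (τ : CohomologyTransfer c ρ) {p : ℕ} {q n : ℤ}
    (hq : (p : ℤ) + q = n) {z : Tot G E n}
    (hz : z ∈ cycles A.D (cocycleFiltration G E) 2 p n) :
    c.projComponent p q z ∈ (ρ q).boundaries p ↔
      z ∈ boundaries A.D (cocycleFiltration G E) 2 p n := by
  constructor
  · intro h
    cases p with
    | zero => exact hR.mem_boundaries_of_projComponent_eq_zero c hq hz h
    | succ p =>
      obtain ⟨b, hb⟩ := h
      -- The factor (-1)^q compensates the sign in `projComponent_D`, so that z − Dw has zero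
      -- projection and is a boundary; Dw itself is one by construction.
      obtain ⟨w, hw, hwb, hDw⟩ := hR.exists_projComponent_eq c (n := n - 1) (p := p) (q := q)
        (n' := n) (by ring) (by push_cast at hq; omega) ((-1 : ℝ) ^ q • b)
      have hDw' : A.D (n - 1) n (by ring) w ∈ cocycleFiltration G E ((p + 1 : ℕ) : ℤ) n := by
        push_cast
        exact hDw
      have hDz : A.D (n - 1) n (by ring) w ∈ cycles A.D (cocycleFiltration G E) 2 (p + 1 : ℕ) n :=
        (mem_cycles_iff _ _ rfl rfl).2 ⟨hDw', by rw [A.D_sq]; exact zero_mem _⟩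
      have h1 : c.projComponent (p + 1) q (z - A.D (n - 1) n (by ring) w) = 0 := by
        rw [map_sub, hR.projComponent_D τ (by ring) (by push_cast at hq; omega) hw hDw', hwb,
          map_smul, smul_smul, ← mul_zpow, hb]
        simp
      have h2 := hR.mem_boundaries_of_projComponent_eq_zero c hq (sub_mem hz hDz) h1
      rw [← sub_add_cancel z (A.D (n - 1) n (by ring) w)]
      refine add_mem h2 ?_
      refine (mem_boundaries_iff 1 (p + 1 + 1) p (n - 1) rfl (by push_cast; ring)
        (by push_cast; ring) (by ring)).2
        ⟨0, zero_mem _, w, (mem_cycles_iff (p + 1) n rfl (by ring)).2 ⟨hw, hDw⟩, zero_add _⟩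
  · intro h
    obtain ⟨y, hy, w, hw, rfl⟩ := (mem_boundaries_iff 1 (p + 1) (p - 1) (n - 1) rfl rfl (by ring)
      (by ring)).1 h
    have hw' := (mem_cycles_iff (p : ℤ) n (by ring) (by ring)).1 hw
    rw [map_add, c.projComponent_eq_zero hq hy.1, zero_add]
    cases p with
    | zero =>
      refine (Submodule.mem_bot ℝ).2 (Subtype.ext ?_)
      funext x y g
      -- For p = 0 the cochain w comes from filtration index −1, which imposes no condition. The
      -- component of Dw of degree zero is ∂ of that of w, and p kills it.
      have hw0 : w ∈ cocycleFiltration G E ((0 : ℕ) : ℤ) (n - 1) := by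
        rw [cocycleFiltration_of_nonpos _ _ (le_of_eq Nat.cast_zero)]
        trivial
      rw [c.projComponent_apply 0 q hq,
        hR.component_D _ hw0 (q - 1) q (by omega) hq (by ring)]
      exact c.p_bd (q - 1) q (by ring) x _
    | succ p =>
      refine ⟨(-1 : ℝ) ^ q • c.projComponent p q w, ?_⟩
      rw [map_smul, ← hR.projComponent_D τ (by ring) (by push_cast at hq; omega) _ hw'.2]
      have := hw'.1
      push_cast at this
      rwa [add_sub_cancel_right] at this

theorem exists_secondPageEquiv (τ : CohomologyTransfer c ρ) (p : ℕ) (q : ℤ) :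
    ∃ e : Page A.D (cocycleFiltration G E) 2 p q ≃ₗ[ℝ] (ρ q).Cohomology p,
      ∀ (z : Tot G E (p + q)) (hz : z ∈ cycles A.D (cocycleFiltration G E) 2 p (p + q)),
        e (Page.mk A.D (cocycleFiltration G E) 2 p q z hz) =
          Submodule.Quotient.mk ⟨c.projComponent p q z, hR.diff_projComponent τ rfl hz⟩ := by
  let f₁ : cycles A.D (cocycleFiltration G E) 2 p (p + q) →ₗ[ℝ] LinearMap.ker ((ρ q).diff p) :=
    (c.projComponent p q ∘ₗ Submodule.subtype _).codRestrict _
      fun z => hR.diff_projComponent τ rfl z.2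
  let f : cycles A.D (cocycleFiltration G E) 2 p (p + q) →ₗ[ℝ] (ρ q).Cohomology p :=
    Submodule.mkQ _ ∘ₗ f₁
  have hf : Function.Surjective f := by
    intro b
    obtain ⟨⟨b, hb⟩, rfl⟩ := Submodule.Quotient.mk_surjective _ b
    obtain ⟨z, hz, rfl⟩ := hR.exists_mem_cycles_projComponent_eq τ rfl hb
    exact ⟨⟨z, hz⟩, rfl⟩
  have hker : (boundaries A.D (cocycleFiltration G E) 2 p (p + q)).submoduleOf
      (cycles A.D (cocycleFiltration G E) 2 p (p + q)) = LinearMap.ker f := by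
    ext z
    refine (hR.projComponent_mem_boundaries_iff τ rfl z.2).symm.trans ?_
    exact (Submodule.Quotient.mk_eq_zero (((ρ q).boundaries p).submoduleOf _)
      (x := f₁ z)).symm
  exact ⟨Submodule.quotEquivOfEq _ _ hker ≪≫ₗ f.quotKerEquivOfSurjective hf, fun z hz => rfl⟩

end RepUpToHomotopy.HasComponents

end SecondPage

end LieRep

end

theorem mainTheorem7 {m d : ℕ}
    {M : Type u} [TopologicalSpace M] [ChartedSpace (Eu m) M] [IsManifold (𝓡 m) ∞ M]
    [T2Space M] [SecondCountableTopology M]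
    {G₁ : Type u} [TopologicalSpace G₁] [ChartedSpace (Eu d) G₁] [IsManifold (𝓡 d) ∞ G₁]
    (G : LieGroupoid m d M G₁) (E : GradedBundle.{u, v} m M)
    (A : RepUpToHomotopy G E)
    (R : ∀ k : ℕ, HomCochain G E E k (1 - k)) (hR : A.HasComponents R)
    (hunital : RepUpToHomotopy.IsUnital R)
    (hregular : RepUpToHomotopy.IsRegular R) :
    ∃ (H : GradedBundle.{u, v} m M) (pr : RepUpToHomotopy.CohomologyBundle R H)
      (ρ : ∀ l : ℤ, GroupoidRep G (H.deg l)),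
      (∀ (l : ℤ) (x y : M) (g : G.Arrow x y)
        (v : LinearMap.ker (RepUpToHomotopy.bdry R l (l + 1) rfl y)),
        ∃ hv : RepUpToHomotopy.quasiAct R l g v ∈
            LinearMap.ker (RepUpToHomotopy.bdry R l (l + 1) rfl x),
          (ρ l).act g (pr.proj l y v) = pr.proj l x ⟨_, hv⟩) ∧
      (∃ (S : CohomologicalSpectralSequence (ModuleCat.{max u v} ℝ) 0)
        (φ : Filtered.IsSpectralSequence A.D (cocycleFiltration G E) S),
        ConvergesTo S
          (Filtered.inducedFiltration A.D (cocycleFiltration G E)) ∧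
        (∀ p q : ℤ, p < 0 → Subsingleton ((S.page 2 (by norm_num)).X (p, q))) ∧
        ∀ (p : ℕ) (q : ℤ),
          ∃ e : (S.page 2 (by norm_num)).X ((p : ℤ), q) ≃ₗ[ℝ] (ρ q).Cohomology p,
            ∀ (z : Tot G E (p + q))
              (hz : z ∈ Filtered.cycles A.D (cocycleFiltration G E) 2 p (p + q)),
              ∃ c : LinearMap.ker ((ρ q).diff p),
                (∀ (x y : M) (g : G.Str p x y),
                  ∃ hg : (Tot.component z p q rfl).1 x y g ∈
                      LinearMap.ker (RepUpToHomotopy.bdry R q (q + 1) rfl x),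
                    c.1.1 x y g = pr.proj q x ⟨_, hg⟩) ∧
                e ((φ.equiv 2 (by norm_num) p q).symm
                  (Filtered.Page.mk A.D (cocycleFiltration G E) 2 p q z hz)) =
                  Submodule.Quotient.mk c) ∧
      ∃ (B : RepUpToHomotopy G H) (R' : ∀ k : ℕ, HomCochain G H H k (1 - k))
        (Φ : RepUpToHomotopy.Morphism A B)
        (φ : ∀ k : ℕ, HomCochain G E H k (0 - k)),
        B.HasComponents R' ∧
        (∀ (l : ℤ) (x : M), RepUpToHomotopy.bdry R' l (l + 1) rfl x = 0) ∧
        (∀ (l : ℤ) (x y : M) (g : G.Arrow x y),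
          RepUpToHomotopy.quasiAct R' l g = (ρ l).act g) ∧
        Φ.HasComponents φ ∧ RepUpToHomotopy.IsQuasiIso R R' φ := by
  let T := HomSeries.mk R hR.smooth
  have hT : totalD T * totalD T = 0 := hR.totalD_sq
  have hsq : ∀ (l l' l'' : ℤ) (hl : l + 1 = l') (hl' : l' + 1 = l'') x v,
      T.base l' l'' hl' x (T.base l l' hl x v) = 0 := fun l l' l'' hl hl' x v =>
    base_base hT l l' l'' hl hl' x v
  obtain ⟨H, ⟨c⟩⟩ := exists_contraction T.base T.isSmooth_base hsq hregular
  obtain ⟨φ, T', hT', hcomm, hφ, h0, h1⟩ := exists_transfer T hT hsq c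
  have hid : ∀ l x, T'.fn 1 l l (by simp) (LieGroupoid.single (G.idArrow x)) = LinearMap.id := by
    intro l x
    refine (h1 l x x (G.idArrow x)).trans (LinearMap.ext fun v => ?_)
    refine (congrArg (fun f => c.p l x (f (c.i l x v))) (hunital.one l x)).trans (c.p_i l x v)
  let ρ : ∀ l : ℤ, GroupoidRep G (H.deg l) := fun l => T'.groupoidRep hT' h0 l (hid l)
  let τ : CohomologyTransfer c ρ :=
    { φ := φ, T' := T', comm := hcomm, φ_nil := hφ, T'_nil := h0, act := fun _ _ _ _ => rfl }
  have hL := hR.isFilteredComplex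
  refine ⟨H, c.cohomologyBundle, ρ, ?_, ⟨hL.spectralSequence, hL.isSpectralSequence,
    hL.convergesTo cocycleFiltration_of_nonpos exists_cocycleFiltration_eq_bot, ?_, ?_⟩,
    RepUpToHomotopy.ofSeries T' hT', T'.fn, RepUpToHomotopy.Morphism.ofSeries φ ?_, φ.fn,
    RepUpToHomotopy.hasComponents_ofSeries T' hT', fun l x => h0 l (l + 1) _ x,
    fun _ _ _ _ => rfl, ⟨φ.isSmooth, fun _ _ _ _ _ _ _ _ => rfl⟩, ?_⟩
  · intro l x y g v
    have hv : T.base l (l + 1) rfl y v.1 = 0 := v.2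
    refine ⟨?_, ?_⟩
    · refine LinearMap.mem_ker.2 ((base_comm hT l (l + 1) rfl g v.1).trans ?_)
      rw [hv, map_zero]
    · refine (congrArg (fun f => f (c.p l y v.1)) (h1 l x y g)).trans ?_
      -- On a closed vector, pλipv = pλv − pλ∂hv, and the last term is p∂λhv = 0.
      have h2 := c.i_p l (l - 1) (l + 1) (by ring) (by ring) rfl (by ring) y v.1
      rw [hv, map_zero, sub_zero] at h2
      refine (congrArg (fun w => c.p l x (T.fn 1 l l _ (LieGroupoid.single g) w)) h2).trans ?_
      have h3 := base_comm hT (l - 1) l (by ring) g (c.h l (l - 1) (by ring) y v.1)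
      have h4 := c.p_bd (l - 1) l (by ring) x
        (T.fn 1 (l - 1) (l - 1) (by simp) (LieGroupoid.single g) (c.h l (l - 1) (by ring) y v.1))
      rw [map_sub, map_sub, ← h3, h4, sub_zero]
      rfl
  · exact fun p q hp => Filtered.IsFilteredComplex.page_subsingleton 2 p q
      (cocycleFiltration_of_nonpos _ _ (by omega))
  · intro p q
    obtain ⟨e, he⟩ := hR.exists_secondPageEquiv τ p q
    refine ⟨e, fun z hz => ⟨_, fun x y g => ⟨hR.component_mem_ker rfl hz g, ?_⟩, he z hz⟩⟩
    exact c.projComponent_apply p q rfl z g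
  · intro n n' h' η
    rw [← Cochains.res_ext n η, hR.D_res]
    change starTot φ n' n' _ (Cochains.res n' _) = totalDTot T' n n' _
    rw [starTot_res, starTot_res, totalDTot_res T' n n' h', ← hcomm]
  · have hf : ∀ l x v, RepUpToHomotopy.Morphism.fiberMap φ.fn l x v = c.p l x v := fun l x v =>
      congrArg (fun f => f v) (hφ l x)
    have hb : ∀ l l' h x, RepUpToHomotopy.bdry T'.fn l l' h x = 0 := fun l l' _ x => h0 l l' _ x
    refine ⟨fun l x v _ => by rw [hb]; rfl, ?_, ?_, ?_⟩
    · rintro l x _ ⟨w, rfl⟩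
      rw [hf]
      refine ⟨0, ?_⟩
      rw [map_zero]
      exact (c.p_bd (l - 1) l (by ring) x w).symm
    · rintro l x v hv ⟨w, hw⟩
      rw [hf, hb] at hw
      -- As R'₀ = 0, a coboundary in H is zero, so `hw` says that pv = 0.
      exact ⟨_, (c.eq_bd_h (l - 1) l (l + 1) (by ring) (by ring) rfl hv hw.symm).symm⟩
    · intro l x w _
      refine ⟨c.i l x w, c.bd_i l (l + 1) rfl x w, ?_⟩
      rw [hf, c.p_i, sub_self]
      exact zero_mem _
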